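/- Conventions. An ordered ultrametric space is an ultrametric space $(X,d)$ with a convex linear order $\prec$, i.e. $x\prec y\prec z$ implies $d(x,y)\le d(x,z)$. Balls are the sets $\{y: d(x,y)<r\}$, $r>0$. A bp-bijection (ball-preserving bijection) between ultrametric spaces is a bijection such that a set is a ball if and only if its image is a ball; a bp-embedding of ordered ultrametric spaces is a strictly increasing injection that is a bp-bijection onto its image. An $r$-polygon ($r>0$) is a set whose distinct points are all at distance $r$. For $N\in\mathbb N\cup\{\mathbb N\}$ let $\mathcal K_N^{\prec}$ be the class of all finite ordered ultrametric spaces with rational distances in which every polygon has at most $N$ points (no restriction if $N=\mathbb N$). The ordered rational $N$-ultrametric Urysohn space $\mathrm{Ury}^{\prec}_N$ is the limit of $\mathcal K_N^{\prec}$ with bp-embeddings as morphisms, i.e. a countable ordered ultrametric space $M$ such that: (i) $M$ has rational distances and its polygons have at most $N$ points; (ii) every member of $\mathcal K_N^{\prec}$ bp-embeds into $M$; (iii) for every finite $A\subseteq M$ there is a finite $A'$ with $A\subseteq A'\subseteq M$ such that for every bp-embedding $f:A'\to B$ with $B\in\mathcal K_N^{\prec}$ there is a bp-embedding $g:B\to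 M$ with $g(f(a))=a$ for all $a\in A$; (iv) if $N\ge 2$, every positive rational is a distance from every point of $M$. Let $\mathrm{BP}(M)$ be the group of order preserving bp-bijections $M\to M$, with the topology of pointwise convergence ($M$ discrete). A partial bp-automorphism of $M$ is an order preserving bp-bijection between finite subspaces of $M$; it is extendable if it is a restriction of an element of $\mathrm{BP}(M)$. An embedding of $S$ into $T$ is a restriction $\varphi$ to $\mathrm{dom}(S)\cup\mathrm{rng}(S)$ of an element of $\mathrm{BP}(M)$ such that $\varphi\circ S\subseteq T\circ\varphi$. A family has the cofinal amalgamation property (CAP) if it has a subfamily $\mathcal C$ such that every member of the family embeds into a member of $\mathcal C$, and $\mathcal C$ has the amalgamation property: for all $S,T_1,T_2\in\mathcal C$ and embeddings $\varphi_i:S\to T_i$ there are $U\in\mathcal C$ and embeddings $\psi_i:T_i\to U$ with $\psi_1\circ\varphi_1=\psi_2\circ\varphi_2$. Theorem. For every $N\in\mathbb N\cup\{\mathbb N\}$ a space $\mathrm{Ury}^{\prec}_N$ exists, and for every such space the family of its extendable partial bp-automorphisms has CAP. If $N\le 2$ or $N=\mathbb N$, then every partial bp-automorphism of $\mathrm{Ury}^{\prec}_N$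 is extendable, so that the family of all its partial bp-automorphisms has CAP. For every $N$, the group $\mathrm{BP}(\mathrm{Ury}^{\prec}_N)$ has a comeager conjugacy class. -/

import Mathlib

universe u v w

/-! ### Ultrametric spaces, balls and ball-preserving maps -/

section Balls

variable {X : Type u} {Y : Type v} {Z : Type w}

/-- A ball of `X`: a set `{y | d(y, x) < r}` with `r > 0`. -/
def IsBall [MetricSpace X] (C : Set X) : Prop :=
  ∃ (x : X) (r : ℝ), 0 < r ∧ C = Metric.ball x r

/-- A ball-preserving bijection (bp-bijection): it induces a bijection between the balls of `X`
and the balls of `Y`. -/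
def IsBPEquiv [MetricSpace X] [MetricSpace Y] (e : X ≃ Y) : Prop :=
  ∀ C : Set X, IsBall (e '' C) ↔ IsBall C

/-- An order preserving bp-injection: a strictly increasing injection that is a bp-bijection onto
its image, the image being regarded as a metric subspace. -/
def IsOrderedBPEmbedding [MetricSpace X] [LinearOrder X] [MetricSpace Y] [LinearOrder Y]
    (f : X → Y) : Prop :=
  StrictMono f ∧ ∃ hf : Function.Injective f, IsBPEquiv (Equiv.ofInjective f hf)

/-- An `r`-polygon: a (finite) set whose distinct points are all at distance `r`. -/
def IsPolygon [MetricSpace X] (r : ℝ) (P : Finset X) : Prop :=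
  (P : Set X).Pairwise fun x y => dist x y = r

/-- `X` is a convexly ordered ultrametric space with rational distances all of whose polygons have
at most `N` points. For `N = ⊤` the sizes of polygons are not restricted. -/
structure IsOrderedUltrametric (N : ℕ∞) (X : Type u) [MetricSpace X] [LinearOrder X] : Prop where
  ultrametric : ∀ x y z : X, dist x z ≤ max (dist x y) (dist y z)
  convex : ∀ x y z : X, x < y → y < z → dist x y ≤ dist x z
  rational : ∀ x y : X, ∃ q : ℚ, dist x y = (q : ℝ)
  polygon : ∀ (r : ℝ) (P : Finset X), 0 < r → IsPolygon r P → (P.card : ℕ∞) ≤ N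

/-- `M` is an ordered rational `N`-ultrametric Urysohn space, i.e. a countable limit of the class of
all finite convexly ordered ultrametric spaces with rational distances and polygons of size at
most `N`, with order preserving bp-injections as morphisms. The last field says that every
positive rational is realized as a distance from every point (for `N ≤ 1` there is at most one
point, so that this has to be restricted to `2 ≤ N`). -/
structure IsOrderedUrysohn (N : ℕ∞) (M : Type u) [MetricSpace M] [LinearOrder M] : Prop where
  countable : Countable M
  /-- `M`, hence each of its finite subspaces, satisfies the conditions defining the class. -/
  isOrderedUltrametric : IsOrderedUltrametric N M
  /-- Each member of the class embeds into `M`. -/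
  universal : ∀ (B : Type u) [MetricSpace B] [LinearOrder B], Finite B →
    IsOrderedUltrametric N B → ∃ f : B → M, IsOrderedBPEmbedding f
  /-- Weak injectivity: every finite `A ⊆ M` is contained in a finite `A' ⊆ M` such that, whenever
  `f` embeds `A'` into a member `B` of the class, some embedding of `B` into `M` inverts `f`
  on `A`. -/
  weaklyInjective : ∀ A : Finset M, ∃ A' : Finset M, A ⊆ A' ∧
    ∀ (B : Type u) [MetricSpace B] [LinearOrder B], Finite B → IsOrderedUltrametric N B →
      ∀ f : A' → B, IsOrderedBPEmbedding f →
        ∃ g : B → M, IsOrderedBPEmbedding g ∧ ∀ a : A', (a : M) ∈ A → g (f a) = a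
  distances : 2 ≤ N → ∀ (x : M) (q : ℚ), 0 < q → ∃ y : M, dist x y = (q : ℝ)

end Balls

/-! ### The group of bp-automorphisms -/

section Group

variable (M : Type u) [MetricSpace M] [LinearOrder M]

/-- The group of bp-automorphisms of the ordered ultrametric space `M`, i.e. of order preserving
bp-bijections from `M` onto `M`. -/
def BP : Subgroup (Equiv.Perm M) where
  carrier := {g | IsBPEquiv g ∧ StrictMono g}
  one_mem' := by
    refine ⟨fun C => ?_, fun x y h => h⟩
    have h1 : ((1 : Equiv.Perm M) : M → M) '' C = C := by simp
    rw [h1]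
  mul_mem' := by
    rintro a b ⟨ha, ha'⟩ ⟨hb, hb'⟩
    refine ⟨fun C => ?_, fun x y h => ha' (hb' h)⟩
    have h1 : ((a * b : Equiv.Perm M) : M → M) '' C = a '' (b '' C) := by
      rw [Set.image_image]; rfl
    rw [h1, ha, hb]
  inv_mem' := by
    rintro a ⟨ha, ha'⟩
    refine ⟨fun C => ?_, fun x y h => ?_⟩
    · have h1 : a '' (((a⁻¹ : Equiv.Perm M) : M → M) '' C) = C := by
        rw [Set.image_image]; simp
      rw [← ha, h1]
    · have h2 : a (a⁻¹ x) < a (a⁻¹ y) := by simpa using h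
      exact ha'.lt_iff_lt.1 h2

/-- The topology of pointwise convergence on `BP M`: it is induced by the product topology on
`M → M`, where `M` is discrete. -/
abbrev BP.pointwiseTopology : TopologicalSpace (BP M) :=
  TopologicalSpace.induced (fun g : BP M => ((g : Equiv.Perm M) : M → M))
    (@Pi.topologicalSpace M (fun _ => M) (fun _ => ⊥))

end Group

/-! ### Partial bp-automorphisms -/

section Partial

/-- A partial bp-automorphism of the ordered ultrametric space `M`: an order preserving
bp-bijection between finite subspaces of `M`. -/
structure PartialBP (M : Type u) [MetricSpace M] [LinearOrder M] where
  dom : Finset M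
  rng : Finset M
  toEquiv : dom ≃ rng
  isBPEquiv : IsBPEquiv toEquiv
  strictMono : StrictMono toEquiv

variable {M : Type u} [MetricSpace M] [LinearOrder M]

/-- `S` is `BP M`-extendable: it is a restriction of a bp-automorphism of `M`. -/
def PartialBP.Extendable (S : PartialBP M) : Prop :=
  ∃ g ∈ BP M, ∀ x : S.dom, g x = S.toEquiv x

/-- The restriction of the bp-automorphism `g` of `M` to `dom S ∪ rng S` is an embedding `φ`
of `S` into `T`, that is, `φ ∘ S ⊆ T ∘ φ`. So embeddings are extendable injections, and each is
represented here by some `g` extending it; only the values of `g` on `dom S ∪ rng S` matter. -/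
def PartialBP.IsEmbedding (g : Equiv.Perm M) (S T : PartialBP M) : Prop :=
  g ∈ BP M ∧ ∀ x : S.dom, ∃ h : g x ∈ T.dom, (T.toEquiv ⟨g x, h⟩ : M) = g (S.toEquiv x)

/-- The subfamily `C` is cofinal in the family `K`: every member of `K` embeds into one of `C`. -/
def IsCofinalIn (C K : Set (PartialBP M)) : Prop :=
  C ⊆ K ∧ ∀ S ∈ K, ∃ T ∈ C, ∃ g, PartialBP.IsEmbedding g S T

/-- The amalgamation property for a family of partial bp-automorphisms. -/
def HasAP (C : Set (PartialBP M)) : Prop :=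
  ∀ S ∈ C, ∀ T₁ ∈ C, ∀ T₂ ∈ C, ∀ g₁ g₂ : Equiv.Perm M,
    PartialBP.IsEmbedding g₁ S T₁ → PartialBP.IsEmbedding g₂ S T₂ →
      ∃ U ∈ C, ∃ h₁ h₂ : Equiv.Perm M,
        PartialBP.IsEmbedding h₁ T₁ U ∧ PartialBP.IsEmbedding h₂ T₂ U ∧
          ∀ x : M, x ∈ S.dom ∨ x ∈ S.rng → h₁ (g₁ x) = h₂ (g₂ x)

/-- The cofinal amalgamation property: some cofinal subfamily has the amalgamation property. -/
def HasCAP (K : Set (PartialBP M)) : Prop :=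
  ∃ C : Set (PartialBP M), IsCofinalIn C K ∧ HasAP C

end Partial

/-! For `N ≤ 1` there is at most one point. Let `N ≥ 2`. Ball-preservation amounts to preserving,
from each point, the comparison of distances, so `M` is treated as the set of branches of a tree
whose nodes are balls. For finite `N` each node has exactly `N` children, and labels number them
from left to right; for `N = ⊤` the children are densely ordered without endpoints. Urysohn spaces
are exactly the rich ones (`IsOrderedUrysohn.isRich`, `IsRich.isOrderedUrysohn`). In a rich space,
finite maps preserving order, comparisons and labels extend by one point (`IsRich.exists_insert`),
hence to automorphisms (`IsRich.exists_extension`). Automorphisms preserve labels, since a polygon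
with `N` points has only one labelling. For `N = 2` the order determines the labels and for `N = ⊤`
they are void, so that all partial maps extend.

For CAP the cofinal subfamily consists of amalgamation bases: maps over which any two extending
automorphisms can be amalgamated, the first embedding being the identity. Everything rests on
`IsRich.resolvable_cell`: each finite restriction of an automorphism extends to a base. The proof is
an induction over cells, which are sets such as balls. Changed off a given finite set, an
automorphism of a cell acquires a fixed point `p` (`IsRich.exists_fixed`). The distance from `p`
preorders the other points of the cell, and the automorphism is monotone for this preorder.

Such a line is treated like `ℚ` with its order-automorphisms (`IsLine.resolvable`). A point mapped
to an equivalent one cuts the line into invariant pieces. Around the orbit of a moving point, new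
fixed markers can be inserted just below and just above; between them, long enough pieces of orbits
form a base, because conjugation makes two automorphisms agree on long segments of the orbit
(`IsLine.isAmalgBase_of_moving`). What remains are the invariant classes, here the spheres around
`p`. Such a sphere is a finite union of invariant balls for finite `N`, and a pair of lines whose
classes are balls for `N = ⊤`. The invariant balls are cells containing fewer points of the finite
set.

Comeagerness follows: generic automorphisms, which restrict to bases and realize all finite
extensions of them, form a residual set and are conjugate by back and forth. A rich space is built
from the finite modifications of a colouring of `ℚ` with dense colours. -/

/-! ### Convexly ordered ultrametric spaces -/

/-- The metric is an ultrametric and the linear order is convex. -/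
structure IsConvexUltrametric (X : Type u) [MetricSpace X] [LinearOrder X] : Prop where
  um : ∀ x y z : X, dist x z ≤ max (dist x y) (dist y z)
  cv : ∀ x y z : X, x < y → y < z → dist x y ≤ dist x z

theorem IsOrderedUltrametric.isConvexUltrametric {N : ℕ∞} {X : Type u} [MetricSpace X]
    [LinearOrder X] (h : IsOrderedUltrametric N X) : IsConvexUltrametric X :=
  ⟨h.ultrametric, h.convex⟩

namespace IsConvexUltrametric

variable {X : Type u} [MetricSpace X] [LinearOrder X]

theorem dist_le (h : IsConvexUltrametric X) {x y z : X} {r : ℝ} (h1 : dist x y ≤ r)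
    (h2 : dist y z ≤ r) : dist x z ≤ r := (h.um x y z).trans (max_le h1 h2)

theorem dist_lt (h : IsConvexUltrametric X) {x y z : X} {r : ℝ} (h1 : dist x y < r)
    (h2 : dist y z < r) : dist x z < r := (h.um x y z).trans_lt (max_lt h1 h2)

/-- The two longer sides of an ultrametric triangle are equal. -/
theorem dist_eq (h : IsConvexUltrametric X) {x u c : X} (h1 : dist x u < dist u c) :
    dist x c = dist u c := by
  apply le_antisymm (h.dist_le h1.le le_rfl)
  by_contra! h2
  exact lt_irrefl _ (h.dist_lt (by rwa [dist_comm u x]) h2)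

/-- By convexity, a point between `x` and `u` is no farther from either than they are from each
other, so a remote `c` cannot separate them. -/
theorem lt_iff (h : IsConvexUltrametric X) {x u c : X} (h1 : dist x u < dist u c) :
    x < c ↔ u < c := by
  have h2 := h.dist_eq h1
  have huc : u ≠ c := by rintro rfl; simp at h1; linarith [dist_nonneg (x := x) (y := u)]
  have hxc : x ≠ c := by rintro rfl; rw [dist_comm] at h1; exact lt_irrefl _ h1
  constructor
  · intro h3
    by_contra h4
    have h5 : c < u := lt_of_le_of_ne (not_lt.1 h4) huc.symm
    have := h.cv x c u h3 h5
    linarith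
  · intro h3
    by_contra h4
    have h5 : c < x := lt_of_le_of_ne (not_lt.1 h4) hxc.symm
    have := h.cv u c x h3 h5
    rw [dist_comm u x] at this
    linarith

theorem cv' (h : IsConvexUltrametric X) {x y z : X} (h1 : x < y) (h2 : y < z) :
    dist y z ≤ dist x z := by
  have := h.cv x y z h1 h2
  exact h.dist_le (y := x) (by rwa [dist_comm]) le_rfl

end IsConvexUltrametric

/-! ### Labellings -/

/-- For finite `N`, `rk x r` numbers, in increasing order, the open `r`-ball of `x` among the
open `r`-balls contained in the closed one, by numbers below `N`. For `N = ⊤` it is trivial. -/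
structure IsLabelling (N : ℕ∞) {X : Type u} [MetricSpace X] [LinearOrder X] (rk : X → ℝ → ℕ) :
    Prop where
  lt : N ≠ ⊤ → ∀ x y, x < y → rk x (dist x y) < rk y (dist x y)
  lt_bound : N ≠ ⊤ → ∀ x r, (rk x r : ℕ∞) < N
  congr : ∀ x x' r, dist x x' < r → rk x r = rk x' r
  top : N = ⊤ → ∀ x r, rk x r = 0

/-- The sizes of the `r`-polygons below `x` and at distance `r` from `x`. -/
def lowerPolygonCards {X : Type u} [MetricSpace X] [LinearOrder X] (x : X) (r : ℝ) : Set ℕ :=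
  {k | ∃ P : Finset X, P.card = k ∧ IsPolygon r P ∧ ∀ z ∈ P, z < x ∧ dist z x = r}

open Classical in
/-- The canonical labelling. -/
noncomputable def rank (N : ℕ∞) {X : Type u} [MetricSpace X] [LinearOrder X] (x : X) (r : ℝ) : ℕ :=
  if N = ⊤ then 0 else if 0 < r then sSup (lowerPolygonCards x r) else 0

section rank

variable {X : Type u} [MetricSpace X] [LinearOrder X] {N : ℕ∞}

omit [LinearOrder X] in
theorem IsPolygon.insert {r : ℝ} {P : Finset X} (hP : IsPolygon r P) {x : X}
    (h : ∀ z ∈ P, dist z x = r) [DecidableEq X] : IsPolygon r (insert x P) := by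
  intro a ha b hb hab
  simp only [Finset.coe_insert, Set.mem_insert_iff, Finset.mem_coe] at ha hb
  rcases ha with rfl | ha <;> rcases hb with rfl | hb
  · exact absurd rfl hab
  · rw [dist_comm]; exact h b hb
  · exact h a ha
  · exact hP ha hb hab

/-- The bound is strict because `x` itself can be added to the polygon. -/
theorem lowerPolygonCards_lt (h : IsOrderedUltrametric N X) {x : X} {r : ℝ} (hr : 0 < r) {k : ℕ}
    (hk : k ∈ lowerPolygonCards x r) : (k : ℕ∞) < N := by
  classical
  obtain ⟨P, rfl, hP, hPx⟩ := hk
  have h1 := h.polygon r (insert x P) hr (hP.insert fun z hz => (hPx z hz).2)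
  rw [Finset.card_insert_of_notMem (fun hx => lt_irrefl _ (hPx x hx).1)] at h1
  refine lt_of_lt_of_le ?_ h1
  exact_mod_cast Nat.lt_succ_self _

/-- A largest lower polygon of `x`, enlarged by `x`, is a lower polygon of every `y` above `x` at
this distance. Points less than `r` apart see the same points at distance `r`, on the same side. -/
theorem isLabelling_rank (h : IsOrderedUltrametric N X) : IsLabelling N (rank N (X := X)) := by
  classical
  have hu := h.isConvexUltrametric
  have bdd : N ≠ ⊤ → ∀ (x : X) r, 0 < r → BddAbove (lowerPolygonCards x r) := by
    intro hN x r hr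
    refine ⟨N.toNat, fun k hk => ?_⟩
    have := lowerPolygonCards_lt h hr hk
    lift N to ℕ using hN
    exact_mod_cast this.le
  have ne : ∀ (x : X) r, (lowerPolygonCards x r).Nonempty := fun x r =>
    ⟨0, ∅, rfl, by simp [IsPolygon], by simp⟩
  refine ⟨fun hN x y hxy => ?_, fun hN x r => ?_, fun x x' r hx => ?_, fun hN x r => ?_⟩
  · have hr : 0 < dist x y := dist_pos.2 hxy.ne
    simp only [rank, hN, hr, if_true, if_false]
    obtain ⟨P, hP, hP1, hP2⟩ := Nat.sSup_mem (ne x (dist x y)) (bdd hN x _ hr)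
    have : (sSup (lowerPolygonCards x (dist x y))) + 1 ∈ lowerPolygonCards y (dist x y) := by
      refine ⟨insert x P, ?_, hP1.insert fun z hz => (hP2 z hz).2, ?_⟩
      · rw [Finset.card_insert_of_notMem (fun hx => lt_irrefl _ (hP2 x hx).1), hP]
      · intro z hz
        rcases Finset.mem_insert.1 hz with rfl | hz
        · exact ⟨hxy, rfl⟩
        · obtain ⟨h1, h2⟩ := hP2 z hz
          refine ⟨h1.trans hxy, le_antisymm (hu.dist_le h2.le le_rfl) ?_⟩
          exact h2.symm.le.trans (hu.cv z x y h1 hxy)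
    exact Nat.lt_of_succ_le (le_csSup (bdd hN y _ hr) this)
  · by_cases hr : 0 < r
    · simp only [rank, hN, hr, if_true, if_false]
      exact lowerPolygonCards_lt h hr (Nat.sSup_mem (ne x r) (bdd hN x r hr))
    · simp only [rank, hN, hr, if_false]
      -- A single point is a polygon, so `1 ≤ N`; this covers the default label `0` for `r ≤ 0`.
      have h0 := h.polygon 1 {x} one_pos (by simp [IsPolygon])
      refine lt_of_lt_of_le ?_ h0
      simp
  · have key : ∀ a b : X, dist a b < r → lowerPolygonCards a r ⊆ lowerPolygonCards b r := by
      rintro a b hab k ⟨P, h1, h2, h3⟩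
      refine ⟨P, h1, h2, fun z hz => ?_⟩
      obtain ⟨h4, h5⟩ := h3 z hz
      have h6 : dist b a < dist a z := by rw [dist_comm b, dist_comm a z, h5]; exact hab
      have h7 := hu.dist_eq h6
      have h8 := hu.lt_iff h6
      refine ⟨?_, by rw [dist_comm, h7, dist_comm, h5]⟩
      rcases lt_trichotomy z b with h9 | h9 | h9
      · exact h9
      · subst h9
        rw [dist_self] at h7
        rw [dist_comm, ← h7] at h5
        have := dist_nonneg (x := a) (y := z); linarith
      · exact absurd (h8.1 h9) h4.asymm
    have := Set.Subset.antisymm (key x x' hx) (key x' x (by rwa [dist_comm]))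
    simp only [rank, this]
  · simp [rank, hN]

end rank

/-! ### Partial isomorphisms -/

section PIso

variable {X : Type u} [MetricSpace X] [LinearOrder X] {M : Type v} [MetricSpace M] [LinearOrder M]

/-- `f` preserves the order, the comparison of distances from a point and the labels on `Y`. -/
structure PIso (rkX : X → ℝ → ℕ) (rkM : M → ℝ → ℕ) (f : X → M) (Y : Set X) : Prop where
  lt : ∀ x ∈ Y, ∀ y ∈ Y, x < y → f x < f y
  le : ∀ x ∈ Y, ∀ y ∈ Y, ∀ z ∈ Y, dist x y ≤ dist x z ↔ dist (f x) (f y) ≤ dist (f x) (f z)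
  rk : ∀ x ∈ Y, ∀ y ∈ Y, x ≠ y → rkX x (dist x y) = rkM (f x) (dist (f x) (f y))

namespace PIso

variable {rkX : X → ℝ → ℕ} {rkM : M → ℝ → ℕ} {f : X → M} {Y : Set X}

theorem mono (h : PIso rkX rkM f Y) {Y' : Set X} (hY : Y' ⊆ Y) : PIso rkX rkM f Y' :=
  ⟨fun x hx y hy => h.lt x (hY hx) y (hY hy),
    fun x hx y hy z hz => h.le x (hY hx) y (hY hy) z (hY hz),
    fun x hx y hy => h.rk x (hY hx) y (hY hy)⟩

theorem lt_iff (h : PIso rkX rkM f Y) {x y : X} (hx : x ∈ Y) (hy : y ∈ Y) :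
    x < y ↔ f x < f y := by
  refine ⟨h.lt x hx y hy, fun h1 => ?_⟩
  rcases lt_trichotomy x y with h2 | h2 | h2
  · exact h2
  · subst h2; exact absurd h1 (lt_irrefl _)
  · exact absurd (h.lt y hy x hx h2) h1.asymm

theorem injOn (h : PIso rkX rkM f Y) : Set.InjOn f Y := by
  intro x hx y hy hxy
  rcases lt_trichotomy x y with h2 | h2 | h2
  · exact absurd hxy (h.lt x hx y hy h2).ne
  · exact h2
  · exact absurd hxy (h.lt y hy x hx h2).ne'

theorem dist_lt_iff (h : PIso rkX rkM f Y) {x y z : X} (hx : x ∈ Y) (hy : y ∈ Y) (hz : z ∈ Y) :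
    dist x y < dist x z ↔ dist (f x) (f y) < dist (f x) (f z) := by
  rw [← not_le, ← not_le, h.le x hx z hz y hy]

theorem dist_eq_iff (h : PIso rkX rkM f Y) {x y z : X} (hx : x ∈ Y) (hy : y ∈ Y) (hz : z ∈ Y) :
    dist x y = dist x z ↔ dist (f x) (f y) = dist (f x) (f z) := by
  rw [le_antisymm_iff, le_antisymm_iff, h.le x hx z hz y hy, h.le x hx y hy z hz]

theorem of_inverse (h : PIso rkX rkM f Y) {g : M → X} (hg : ∀ y ∈ Y, g (f y) = y) :
    PIso rkM rkX g (f '' Y) := by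
  refine ⟨?_, ?_, ?_⟩
  · rintro _ ⟨x, hx, rfl⟩ _ ⟨y, hy, rfl⟩ hxy
    rw [hg x hx, hg y hy]; exact (h.lt_iff hx hy).2 hxy
  · rintro _ ⟨x, hx, rfl⟩ _ ⟨y, hy, rfl⟩ _ ⟨z, hz, rfl⟩
    rw [hg x hx, hg y hy, hg z hz]; exact (h.le x hx y hy z hz).symm
  · rintro _ ⟨x, hx, rfl⟩ _ ⟨y, hy, rfl⟩ hxy
    rw [hg x hx, hg y hy]
    exact (h.rk x hx y hy (fun e => hxy (by rw [e]))).symm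

/-- One-point extension. The points of `W` are those which are close to the new point `x`; from
the other points of `Y`, `x` looks like `u`. -/
theorem insert {N : ℕ∞} (hX : IsConvexUltrametric X) (hM : IsConvexUltrametric M)
    (hrX : IsLabelling N rkX) (hrM : IsLabelling N rkM) {u x : X} {y : M} {W : Set X}
    (hf : PIso rkX rkM f (Insert.insert u Y)) (hx : x ∉ Y) (hW : W ⊆ Y) (hu : u ∈ W ∨ W = ∅)
    (hne : ∀ b ∈ W, y ≠ f b) (hlt : ∀ b ∈ W, x < b ↔ y < f b)
    (hrk1 : ∀ b ∈ W, rkX x (dist x b) = rkM y (dist y (f b)))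
    (hrk2 : ∀ b ∈ W, rkX b (dist x b) = rkM (f b) (dist y (f b)))
    (hd1 : ∀ b ∈ W, ∀ b' ∈ W, dist x b = dist x b')
    (hd2 : ∀ b ∈ W, ∀ b' ∈ W, dist y (f b) = dist y (f b'))
    (hd3 : ∀ b ∈ W, ∀ b' ∈ W, dist b b' = dist x b ↔ dist (f b) (f b') = dist y (f b))
    (ho1 : ∀ c ∈ Y, c ∉ W → dist x u < dist u c)
    (ho2 : ∀ c ∈ Y, c ∉ W → dist y (f u) < dist (f u) (f c)) [DecidableEq X] :
    PIso rkX rkM (Function.update f x y) (Insert.insert x Y) := by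
  have hfY : PIso rkX rkM f Y := hf.mono (Set.subset_insert _ _)
  have uI : u ∈ Insert.insert u Y := Set.mem_insert _ _
  have YI : ∀ {b}, b ∈ Y → b ∈ Insert.insert u Y := fun h => Set.mem_insert_of_mem _ h
  have fx : Function.update f x y x = y := Function.update_self _ _ _
  have fY : ∀ b ∈ Y, Function.update f x y b = f b := fun b hb =>
    Function.update_of_ne (by rintro rfl; exact hx hb) _ _
  -- By the isosceles property, outside `W` all data of `x` and `y` reduce to those of `u` and `f
  -- u`, on which `f` is already known to be good.
  have o1 : ∀ c ∈ Y, c ∉ W → dist x c = dist u c := fun c hc hcW => hX.dist_eq (ho1 c hc hcW)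
  have o2 : ∀ c ∈ Y, c ∉ W → dist y (f c) = dist (f u) (f c) := fun c hc hcW =>
    hM.dist_eq (ho2 c hc hcW)
  have u1 : ∀ b ∈ W, dist x b = dist x u := by
    rcases hu with hu | rfl
    · exact fun b hb => hd1 b hb u hu
    · simp
  have u2 : ∀ b ∈ W, dist y (f b) = dist y (f u) := by
    rcases hu with hu | rfl
    · exact fun b hb => hd2 b hb u hu
    · simp
  have s1 : ∀ b ∈ W, ∀ c ∈ Y, c ∉ W → dist b x < dist b c := by
    intro b hb c hc hcW
    have h1 : dist b x < dist x c := by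
      rw [dist_comm, u1 b hb, o1 c hc hcW]; exact ho1 c hc hcW
    rw [hX.dist_eq h1]; exact h1
  have s2 : ∀ b ∈ W, ∀ c ∈ Y, c ∉ W → dist (f b) y < dist (f b) (f c) := by
    intro b hb c hc hcW
    have h1 : dist (f b) y < dist y (f c) := by
      rw [dist_comm, u2 b hb, o2 c hc hcW]; exact ho2 c hc hcW
    rw [hM.dist_eq h1]; exact h1
  have w1 : ∀ b ∈ W, ∀ b' ∈ W, dist b b' ≤ dist b x := fun b hb b' hb' =>
    hX.dist_le le_rfl (by rw [dist_comm b x]; exact (hd1 b' hb' b hb).le)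
  have w2 : ∀ b ∈ W, ∀ b' ∈ W, dist (f b) (f b') ≤ dist (f b) y := fun b hb b' hb' =>
    hM.dist_le le_rfl (by rw [dist_comm (f b) y]; exact (hd2 b' hb' b hb).le)
  -- comparisons
  have A : ∀ b ∈ Y, ∀ c ∈ Y, dist x b ≤ dist x c ↔ dist y (f b) ≤ dist y (f c) := by
    intro b hb c hc
    by_cases hbW : b ∈ W <;> by_cases hcW : c ∈ W
    · simp [hd1 b hbW c hcW, hd2 b hbW c hcW]
    · have h1 : dist x b < dist x c := by rw [u1 b hbW, o1 c hc hcW]; exact ho1 c hc hcW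
      have h2 : dist y (f b) < dist y (f c) := by
        rw [u2 b hbW, o2 c hc hcW]; exact ho2 c hc hcW
      simp [h1.le, h2.le]
    · have h1 : dist x c < dist x b := by rw [u1 c hcW, o1 b hb hbW]; exact ho1 b hb hbW
      have h2 : dist y (f c) < dist y (f b) := by
        rw [u2 c hcW, o2 b hb hbW]; exact ho2 b hb hbW
      simp [not_le.2 h1, not_le.2 h2]
    · rw [o1 b hb hbW, o1 c hc hcW, o2 b hb hbW, o2 c hc hcW]
      exact hf.le u uI b (YI hb) c (YI hc)
  have B : ∀ b ∈ Y, ∀ c ∈ Y, dist b x ≤ dist b c ↔ dist (f b) y ≤ dist (f b) (f c) := by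
    intro b hb c hc
    by_cases hbW : b ∈ W
    · by_cases hcW : c ∈ W
      · have h1 : dist b x ≤ dist b c ↔ dist b c = dist x b := by
          rw [dist_comm x b]
          exact ⟨fun h => le_antisymm (w1 b hbW c hcW) h, fun h => h.ge⟩
        have h2 : dist (f b) y ≤ dist (f b) (f c) ↔ dist (f b) (f c) = dist y (f b) := by
          rw [dist_comm y (f b)]
          exact ⟨fun h => le_antisymm (w2 b hbW c hcW) h, fun h => h.ge⟩
        rw [h1, h2]; exact hd3 b hbW c hcW
      · simp [(s1 b hbW c hc hcW).le, (s2 b hbW c hc hcW).le]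
    · rw [dist_comm b x, o1 b hb hbW, dist_comm u b, dist_comm (f b) y, o2 b hb hbW,
        dist_comm (f u) (f b)]
      exact hf.le b (YI hb) u uI c (YI hc)
  have C : ∀ b ∈ Y, ∀ c ∈ Y, dist b c ≤ dist b x ↔ dist (f b) (f c) ≤ dist (f b) y := by
    intro b hb c hc
    by_cases hbW : b ∈ W
    · by_cases hcW : c ∈ W
      · simp [w1 b hbW c hcW, w2 b hbW c hcW]
      · simp [not_le.2 (s1 b hbW c hc hcW), not_le.2 (s2 b hbW c hc hcW)]
    · rw [dist_comm b x, o1 b hb hbW, dist_comm u b, dist_comm (f b) y, o2 b hb hbW,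
        dist_comm (f u) (f b)]
      exact hf.le b (YI hb) c (YI hc) u uI
  have ny : ∀ b ∈ Y, y ≠ f b := by
    intro b hb
    by_cases hbW : b ∈ W
    · exact hne b hbW
    · rintro rfl
      have := ho2 b hb hbW
      rw [dist_comm] at this
      exact lt_irrefl _ this
  have D : ∀ b ∈ Y, x < b ↔ y < f b := by
    intro b hb
    by_cases hbW : b ∈ W
    · exact hlt b hbW
    · rw [hX.lt_iff (ho1 b hb hbW), hM.lt_iff (ho2 b hb hbW)]
      exact hf.lt_iff uI (YI hb)
  have xne : ∀ b ∈ Y, x ≠ b := fun b hb e => hx (e ▸ hb)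
  refine ⟨?_, ?_, ?_⟩
  · rintro a (rfl | ha) b (rfl | hb) hab
    · exact absurd hab (lt_irrefl _)
    · rw [fx, fY b hb]; exact (D b hb).1 hab
    · rw [fx, fY a ha]
      exact lt_of_le_of_ne (not_lt.1 fun h => hab.asymm ((D a ha).2 h)) (ny a ha).symm
    · rw [fY a ha, fY b hb]; exact hfY.lt a ha b hb hab
  · rintro a (rfl | ha) b (rfl | hb) c (rfl | hc)
    · simp
    · simp [dist_nonneg]
    · rw [fx, fY b hb]
      simp only [dist_self]
      rw [dist_le_zero, dist_le_zero]
      exact iff_of_false (xne b hb) (ny b hb)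
    · rw [fx, fY b hb, fY c hc]; exact A b hb c hc
    · simp
    · rw [fx, fY a ha, fY c hc]; exact B a ha c hc
    · rw [fx, fY a ha, fY b hb]; exact C a ha b hb
    · rw [fY a ha, fY b hb, fY c hc]; exact hfY.le a ha b hb c hc
  · have E1 : ∀ b ∈ Y, rkX x (dist x b) = rkM y (dist y (f b)) := by
      intro b hb
      by_cases hbW : b ∈ W
      · exact hrk1 b hbW
      · rw [o1 b hb hbW, o2 b hb hbW, hrX.congr x u _ (ho1 b hb hbW),
          hrM.congr y (f u) _ (ho2 b hb hbW)]
        refine hf.rk u uI b (YI hb) ?_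
        rintro rfl
        have := ho1 u hb hbW
        rw [dist_self] at this
        exact absurd this (not_lt.2 dist_nonneg)
    have E2 : ∀ b ∈ Y, rkX b (dist x b) = rkM (f b) (dist y (f b)) := by
      intro b hb
      by_cases hbW : b ∈ W
      · exact hrk2 b hbW
      · rw [o1 b hb hbW, o2 b hb hbW, dist_comm u, dist_comm (f u)]
        refine hf.rk b (YI hb) u uI ?_
        rintro rfl
        have := ho1 b hb hbW
        rw [dist_self] at this
        exact absurd this (not_lt.2 dist_nonneg)
    rintro a (rfl | ha) b (rfl | hb) hab
    · exact absurd rfl hab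
    · rw [fx, fY b hb]; exact E1 b hb
    · rw [fx, fY a ha, dist_comm a, dist_comm (f a)]; exact E2 a ha
    · rw [fY a ha, fY b hb]; exact hfY.rk a ha b hb hab

end PIso

end PIso

theorem IsLabelling.lt_iff {N : ℕ∞} {X : Type u} [MetricSpace X] [LinearOrder X] {rk : X → ℝ → ℕ}
    (h : IsLabelling N rk) (hN : N ≠ ⊤) {x y : X} (hxy : x ≠ y) :
    x < y ↔ rk x (dist x y) < rk y (dist x y) := by
  refine ⟨h.lt hN x y, fun h1 => ?_⟩
  by_contra h2
  have := h.lt hN y x (lt_of_le_of_ne (not_lt.1 h2) hxy.symm)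
  rw [dist_comm] at this
  exact h1.asymm this

theorem IsLabelling.ne {N : ℕ∞} {X : Type u} [MetricSpace X] [LinearOrder X] {rk : X → ℝ → ℕ}
    (h : IsLabelling N rk) (hN : N ≠ ⊤) {x y : X} (hxy : x ≠ y) :
    rk x (dist x y) ≠ rk y (dist x y) := by
  rcases lt_or_gt_of_ne hxy with h1 | h1
  · exact (h.lt hN x y h1).ne
  · rw [dist_comm]; exact (h.lt hN y x h1).ne'

/-- This yields room for a new level on a branch, between the distances to the points on the near
side and on the far side. Adding `0` to `S` makes `lo` nonnegative. -/
theorem exists_gap_of_finite {S T : Set ℝ} (hS : S.Finite) (hT : T.Finite)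
    (hST : ∀ s ∈ S, ∀ t ∈ T, s < t) (hT0 : ∀ t ∈ T, 0 < t) :
    ∃ lo hi : ℝ, 0 ≤ lo ∧ lo < hi ∧ (∀ s ∈ S, s ≤ lo) ∧ ∀ t ∈ T, hi ≤ t := by
  obtain ⟨lo, hlo, hlo'⟩ := Set.exists_max_image (insert 0 S) id (hS.insert 0) ⟨0, by simp⟩
  refine ⟨lo, ?_⟩
  have h0 : 0 ≤ lo := hlo' 0 (by simp)
  have hS' : ∀ s ∈ S, s ≤ lo := fun s hs => hlo' s (by simp [hs])
  have hlt : ∀ t ∈ T, lo < t := by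
    intro t ht
    rcases hlo with rfl | hlo
    · exact hT0 t ht
    · exact hST _ hlo t ht
  rcases T.eq_empty_or_nonempty with rfl | hne
  · exact ⟨lo + 1, h0, by linarith, hS', by simp⟩
  · obtain ⟨hi, hhi, hhi'⟩ := Set.exists_min_image T id hT hne
    exact ⟨hi, h0, hlt _ hhi, hS', fun t ht => hhi' t ht⟩

/-! ### Rich spaces and the one-step extension property. -/

/-- Countable convexly ordered ultrametric spaces which are as rich as possible: all positive
rationals are distances from each point, all nodes have `N` children if `N` is finite and children
ordered densely without endpoints if `N = ⊤`, and on each branch, nodes of all kinds are dense. -/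
structure IsRich (N : ℕ∞) {M : Type u} [MetricSpace M] [LinearOrder M] (rk : M → ℝ → ℕ) : Prop where
  countable : Countable M
  ou : IsOrderedUltrametric N M
  lab : IsLabelling N rk
  two_le : 2 ≤ N
  nonempty : Nonempty M
  distances : ∀ (x : M) (q : ℚ), 0 < q → ∃ y : M, dist x y = (q : ℝ)
  level_fin : N ≠ ⊤ → ∀ (a : M) (lo hi : ℝ), 0 ≤ lo → lo < hi → ∀ i j : ℕ, i ≠ j → (i : ℕ∞) < N →
    (j : ℕ∞) < N → ∃ y, lo < dist a y ∧ dist a y < hi ∧ rk a (dist a y) = i ∧ rk y (dist a y) = j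
  full : N ≠ ⊤ → ∀ a b : M, a ≠ b → ∀ j : ℕ, (j : ℕ∞) < N →
    ∃ y, dist a y ≤ dist a b ∧ rk y (dist a b) = j
  level_gt : N = ⊤ → ∀ (a : M) (lo hi : ℝ), 0 ≤ lo → lo < hi →
    ∃ y, lo < dist a y ∧ dist a y < hi ∧ a < y
  level_lt : N = ⊤ → ∀ (a : M) (lo hi : ℝ), 0 ≤ lo → lo < hi →
    ∃ y, lo < dist a y ∧ dist a y < hi ∧ y < a
  between : N = ⊤ → ∀ a b : M, a < b → ∃ y, a < y ∧ y < b ∧ dist a y = dist a b ∧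
    dist y b = dist a b
  exists_gt : N = ⊤ → ∀ a b : M, a ≠ b → ∃ y, a < y ∧ dist a y = dist a b
  exists_lt : N = ⊤ → ∀ a b : M, a ≠ b → ∃ y, y < a ∧ dist a y = dist a b

namespace IsRich

variable {N : ℕ∞} {M : Type v} [MetricSpace M] [LinearOrder M] {rk : M → ℝ → ℕ}

theorem cu (h : IsRich N rk) : IsConvexUltrametric M := h.ou.isConvexUltrametric

theorem exists_dist (h : IsRich N rk) {a b : M} (hab : a ≠ b) (c : M) :
    ∃ e, dist c e = dist a b := by
  obtain ⟨q, hq⟩ := h.ou.rational a b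
  have : 0 < q := by
    have := dist_pos.2 hab
    rw [hq] at this; exact_mod_cast this
  rw [hq]
  exact h.distances c q this

/-- A child in a prescribed gap between children of a node, for `N = ⊤`. -/
theorem exists_in_gap (h : IsRich N rk) (hN : N = ⊤) {P : Set M} (hP : P.Finite)
    (hne : P.Nonempty) {a b : M} (hab : a ≠ b)
    (hd : ∀ c ∈ P, ∀ d ∈ P, dist c d ≤ dist a b) {L : M → Prop}
    (hL : ∀ c ∈ P, L c → ∀ d ∈ P, ¬ L d → c < d ∧ dist c d = dist a b) :
    ∃ y, ∀ c ∈ P, dist y c = dist a b ∧ (L c → c < y) ∧ (¬ L c → y < c) := by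
  have hu := h.cu
  set r := dist a b with hr
  have r0 : 0 < r := dist_pos.2 hab
  have ex : ∀ c : M, ∃ e, c ≠ e ∧ dist c e = r := fun c => by
    obtain ⟨e, he⟩ := h.exists_dist hab c
    exact ⟨e, dist_pos.1 (he ▸ r0), he⟩
  have up : ∀ c ∈ P, ∀ y, c < y → dist c y = r → ∀ d ∈ P, d ≤ c → dist y d = r ∧ d < y := by
    intro c hc y hcy hy d hd' hdc
    refine ⟨le_antisymm (hu.dist_le (y := c) (by rw [dist_comm, hy]) (hd c hc d hd')) ?_,
      hdc.trans_lt hcy⟩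
    rcases hdc.eq_or_lt with rfl | hdc
    · rw [dist_comm, hy]
    · rw [dist_comm, ← hy]; exact hu.cv' hdc hcy
  have dn : ∀ c ∈ P, ∀ y, y < c → dist c y = r → ∀ d ∈ P, c ≤ d → dist y d = r ∧ y < d := by
    intro c hc y hcy hy d hd' hdc
    refine ⟨le_antisymm (hu.dist_le (y := c) (by rw [dist_comm, hy]) (hd c hc d hd')) ?_,
      hcy.trans_le hdc⟩
    rcases hdc.eq_or_lt with rfl | hdc
    · rw [dist_comm, hy]
    · rw [← hy, dist_comm]; exact hu.cv _ _ _ hcy hdc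
  -- If one side of the gap is empty, a child beyond the extreme point replaces the child between
  -- its two neighbours.
  by_cases h1 : ∃ c ∈ P, L c <;> by_cases h2 : ∃ c ∈ P, ¬ L c
  · obtain ⟨c, ⟨hc, hLc⟩, hcm⟩ := Set.exists_max_image {c ∈ P | L c} id (hP.subset (Set.sep_subset _ _)) h1
    obtain ⟨d, ⟨hd1, hLd⟩, hdm⟩ := Set.exists_min_image {c ∈ P | ¬ L c} id (hP.subset (Set.sep_subset _ _)) h2
    obtain ⟨hcd, hcd'⟩ := hL c hc hLc d hd1 hLd
    obtain ⟨y, hy1, hy2, hy3, hy4⟩ := h.between hN c d hcd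
    refine ⟨y, fun e he => ?_⟩
    by_cases hLe : L e
    · have := up c hc y hy1 (hy3.trans hcd') e he (hcm e ⟨he, hLe⟩)
      exact ⟨this.1, fun _ => this.2, fun h => absurd hLe h⟩
    · have := dn d hd1 y hy2 (by rw [dist_comm]; exact (hy4.trans hcd')) e he (hdm e ⟨he, hLe⟩)
      exact ⟨this.1, fun h => absurd h hLe, fun _ => this.2⟩
  · obtain ⟨c, ⟨hc, hLc⟩, hcm⟩ := Set.exists_max_image {c ∈ P | L c} id (hP.subset (Set.sep_subset _ _)) h1
    push Not at h2
    obtain ⟨e, hce, he⟩ := ex c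
    obtain ⟨y, hy1, hy2⟩ := h.exists_gt hN c e hce
    refine ⟨y, fun e he' => ?_⟩
    have := up c hc y hy1 (hy2.trans he) e he' (hcm e ⟨he', h2 e he'⟩)
    exact ⟨this.1, fun _ => this.2, fun h => absurd (h2 e he') h⟩
  · obtain ⟨d, ⟨hd1, hLd⟩, hdm⟩ := Set.exists_min_image {c ∈ P | ¬ L c} id (hP.subset (Set.sep_subset _ _)) h2
    push Not at h1
    obtain ⟨e, hce, he⟩ := ex d
    obtain ⟨y, hy1, hy2⟩ := h.exists_lt hN d e hce
    refine ⟨y, fun e he' => ?_⟩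
    have := dn d hd1 y hy1 (hy2.trans he) e he' (hdm e ⟨he', h1 e he'⟩)
    exact ⟨this.1, fun h => absurd h (h1 e he'), fun _ => this.2⟩
  · obtain ⟨c, hc⟩ := hne
    push Not at h1 h2
    exact absurd (h2 c hc) (h1 c hc)

variable {X : Type u} [MetricSpace X] [LinearOrder X] {rkX : X → ℝ → ℕ}

/-- Serves the case in which `x` leaves the branch of `a` at a new level: `y` stands to `m` as `x`
stands to `a`, at any prescribed height. For finite `N` the two labels already determine the order.
-/
theorem exists_level (h : IsRich N rk) (hrX : IsLabelling N rkX) {x a : X} (hxa : x ≠ a) (m : M)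
    {lo hi : ℝ} (h0 : 0 ≤ lo) (hlo : lo < hi) :
    ∃ y, lo < dist y m ∧ dist y m < hi ∧ (x < a ↔ y < m) ∧ rkX x (dist x a) = rk y (dist y m) ∧
      rkX a (dist x a) = rk m (dist y m) := by
  have aux : ∀ y, lo < dist m y → m ≠ y := fun y hy => dist_pos.1 (h0.trans_lt hy)
  by_cases hN : N = ⊤
  · have e : ∀ (x : X) (y : M) (r s : ℝ), rkX x r = rk y s := fun x y r s => by
      rw [h.lab.top hN, hrX.top hN]
    rcases lt_or_gt_of_ne hxa with h1 | h1
    · obtain ⟨y, h2, h3, h4⟩ := h.level_lt hN m lo hi h0 hlo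
      rw [dist_comm] at h2 h3
      exact ⟨y, h2, h3, iff_of_true h1 h4, e _ _ _ _, e _ _ _ _⟩
    · obtain ⟨y, h2, h3, h4⟩ := h.level_gt hN m lo hi h0 hlo
      rw [dist_comm] at h2 h3
      exact ⟨y, h2, h3, iff_of_false h1.asymm h4.asymm, e _ _ _ _, e _ _ _ _⟩
  · obtain ⟨y, h2, h3, h4, h5⟩ := h.level_fin hN m lo hi h0 hlo (rkX a (dist x a))
      (rkX x (dist x a)) (hrX.ne hN hxa).symm (hrX.lt_bound hN _ _) (hrX.lt_bound hN _ _)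
    refine ⟨y, by rwa [dist_comm], by rwa [dist_comm], ?_, by rw [dist_comm y, h5],
      by rw [dist_comm y, h4]⟩
    rw [hrX.lt_iff hN hxa, h.lab.lt_iff hN (aux y h2).symm, dist_comm y, h4, h5]

/-- One-step extension property. -/
theorem exists_insert (h : IsRich N rk) (hX : IsConvexUltrametric X) (hrX : IsLabelling N rkX)
    {f : X → M} {Y : Set X} (hf : PIso rkX rk f Y) (hY : Y.Finite) {x : X} (hx : x ∉ Y)
    [DecidableEq X] : ∃ y, PIso rkX rk (Function.update f x y) (insert x Y) := by
  have hM := h.cu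
  rcases Y.eq_empty_or_nonempty with rfl | hne
  · obtain ⟨y⟩ := h.nonempty
    refine ⟨y, ?_, ?_, ?_⟩
    · rintro _ (rfl | h1) _ (rfl | h2) h3
      · exact absurd h3 (lt_irrefl _)
      all_goals exact absurd ‹_ ∈ ∅› (Set.notMem_empty _)
    · rintro _ (rfl | h1) _ (rfl | h2) _ (rfl | h3)
      · simp
      all_goals exact absurd ‹_ ∈ ∅› (Set.notMem_empty _)
    · rintro _ (rfl | h1) _ (rfl | h2) h3
      · exact absurd rfl h3
      all_goals exact absurd ‹_ ∈ ∅› (Set.notMem_empty _)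
  obtain ⟨a, ha, hmin⟩ := Set.exists_min_image Y (fun a => dist x a) hY hne
  set r := dist x a with hr
  -- Since `a` is nearest to `x`, the set `W` consists of the points of `Y` at the minimal distance
  -- `r`. From all other points of `Y`, `x` looks like `a`.
  set W : Set X := {b ∈ Y | dist a b ≤ r} with hWdef
  have hWY : W ⊆ Y := Set.sep_subset _ _
  have xne : ∀ b ∈ Y, x ≠ b := by rintro b hb rfl; exact hx hb
  have r0 : 0 < r := dist_pos.2 (xne a ha)
  have aW : a ∈ W := ⟨ha, by simp [r0.le]⟩
  have hxW : ∀ b ∈ W, dist x b = r := fun b hb =>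
    le_antisymm (hX.dist_le hr.symm.le hb.2) (hmin b hb.1)
  have hfa : PIso rkX rk f (insert a Y) := by rwa [Set.insert_eq_of_mem ha]
  suffices H : ∃ y, (∀ b ∈ W, y ≠ f b) ∧ (∀ b ∈ W, x < b ↔ y < f b) ∧
      (∀ b ∈ W, rkX x (dist x b) = rk y (dist y (f b))) ∧
      (∀ b ∈ W, rkX b (dist x b) = rk (f b) (dist y (f b))) ∧
      (∀ b ∈ W, ∀ b' ∈ W, dist y (f b) = dist y (f b')) ∧
      (∀ b ∈ W, ∀ b' ∈ W, dist b b' = dist x b ↔ dist (f b) (f b') = dist y (f b)) ∧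
      (∀ c ∈ Y, c ∉ W → dist y (f a) < dist (f a) (f c)) by
    obtain ⟨y, h1, h2, h3, h4, h5, h6, h7⟩ := H
    refine ⟨y, PIso.insert hX hM hrX h.lab hfa hx hWY (Or.inl aW) h1 h2 h3 h4
      (fun b hb b' hb' => by rw [hxW b hb, hxW b' hb']) h5 h6 (fun c hc hcW => ?_) h7⟩
    exact not_le.1 fun h => hcW ⟨hc, h⟩
  -- Either the node at which `x` branches off is already a node of two points of `W`, and `x` is a
  -- further child of it, or a new level has to be created.
  by_cases hb : ∃ b0 ∈ W, dist a b0 = r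
  · obtain ⟨b0, hb0, hab0⟩ := hb
    set ρ := dist (f a) (f b0) with hρ
    have hle : ∀ b ∈ W, dist (f a) (f b) ≤ ρ := fun b hb =>
      (hf.le a ha b hb.1 b0 hb0.1).1 (by rw [hab0]; exact hb.2)
    have ab0 : f a ≠ f b0 := by
      intro e
      have := hf.injOn ha hb0.1 e
      rw [this, dist_self] at hab0
      exact r0.ne hab0
    have ρ0 : 0 < ρ := dist_pos.2 ab0
    -- Comparisons are only available from a common point. A partner `e` at distance exactly `r`
    -- shows that `r` corresponds to `ρ` from every `b`.
    have hex : ∀ b ∈ W, ∃ e ∈ Y, dist b e = r ∧ dist (f b) (f e) = ρ := by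
      intro b hb
      rcases hb.2.lt_or_eq with h1 | h1
      · refine ⟨b0, hb0.1, ?_, ?_⟩
        · rw [← hab0]; exact hX.dist_eq (by rw [dist_comm, hab0]; exact h1)
        · rw [hρ]
          refine hM.dist_eq ?_
          rw [dist_comm]
          exact (hf.dist_lt_iff ha hb.1 hb0.1).1 (by rwa [hab0])
      · refine ⟨a, ha, by rwa [dist_comm], ?_⟩
        rw [dist_comm]
        exact (hf.dist_eq_iff ha hb.1 hb0.1).1 (by rw [h1, hab0])
    suffices H : ∃ y, (∀ b ∈ W, dist y (f b) = ρ) ∧ (∀ b ∈ W, x < b ↔ y < f b) ∧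
        (rkX x r = rk y ρ) by
      obtain ⟨y, h1, h2, h3⟩ := H
      refine ⟨y, fun b hb e => ?_, h2, fun b hb => ?_, fun b hb => ?_, fun b hb b' hb' => ?_,
        fun b hb b' hb' => ?_, fun c hc hcW => ?_⟩
      · have := h1 b hb
        rw [e, dist_self] at this
        exact ρ0.ne this
      · rw [h1 b hb, hxW b hb, h3]
      · obtain ⟨e, he, h4, h5⟩ := hex b hb
        rw [h1 b hb, hxW b hb, ← h4, ← h5]
        refine hf.rk b hb.1 e he ?_
        rintro rfl
        rw [dist_self] at h4; exact r0.ne h4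
      · rw [h1 b hb, h1 b' hb']
      · obtain ⟨e, he, h4, h5⟩ := hex b hb
        rw [h1 b hb, hxW b hb, ← h4, ← h5]
        exact hf.dist_eq_iff hb.1 hb'.1 he
      · rw [h1 a aW]
        refine (hf.dist_lt_iff ha hb0.1 hc).1 ?_
        rw [hab0]
        exact not_le.1 fun h => hcW ⟨hc, h⟩
    by_cases hN : N = ⊤
    · obtain ⟨y, hy⟩ := h.exists_in_gap hN (P := f '' W) ((hY.subset hWY).image f)
        ⟨f a, a, aW, rfl⟩ ab0 (by
          rintro _ ⟨b, hb, rfl⟩ _ ⟨b', hb', rfl⟩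
          exact hM.dist_le (by rw [dist_comm]; exact hle b hb) (hle b' hb'))
        (L := fun m => ∃ b ∈ W, f b = m ∧ b < x) (by
          rintro _ - ⟨b, hb, rfl, hbx⟩ _ ⟨b', hb', rfl⟩ hL
          have hxb' : x < b' := lt_of_le_of_ne (not_lt.1 fun h => hL ⟨b', hb', rfl, h⟩)
            (xne b' hb'.1)
          refine ⟨hf.lt b hb.1 b' hb'.1 (hbx.trans hxb'), ?_⟩
          obtain ⟨e, he, h4, h5⟩ := hex b hb
          rw [← hρ, ← h5]
          refine (hf.dist_eq_iff hb.1 hb'.1 he).1 ?_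
          rw [h4]
          apply le_antisymm
          · exact hX.dist_le (y := x) (by rw [dist_comm, hxW b hb]) (hxW b' hb').le
          · rw [← hxW b hb, dist_comm]
            exact hX.cv _ _ _ hbx hxb')
      refine ⟨y, fun b hb => (hy _ ⟨b, hb, rfl⟩).1, fun b hb => ?_, by
        rw [h.lab.top hN, hrX.top hN]⟩
      obtain ⟨-, h1, h2⟩ := hy _ ⟨b, hb, rfl⟩
      constructor
      · intro hxb
        refine h2 ?_
        rintro ⟨b', hb', he, h4⟩
        rw [hf.injOn hb'.1 hb.1 he] at h4
        exact h4.asymm hxb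
      · intro hyb
        by_contra hxb
        exact hyb.asymm (h1 ⟨b, hb, rfl, lt_of_le_of_ne (not_lt.1 hxb) (xne b hb.1).symm⟩)
    -- For finite `N` the child carrying the label of `x` is taken. It contains no point of `f ''
    -- W`, since distinct children have distinct labels.
    · obtain ⟨y, hy1, hy2⟩ := h.full hN (f a) (f b0) ab0 (rkX x r) (hrX.lt_bound hN _ _)
      have hrb : ∀ b ∈ W, rkX b r = rk (f b) ρ := by
        intro b hb
        obtain ⟨e, he, h4, h5⟩ := hex b hb
        rw [← h4, ← h5]
        refine hf.rk b hb.1 e he ?_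
        rintro rfl
        rw [dist_self] at h4; exact r0.ne h4
      have hd : ∀ b ∈ W, dist y (f b) = ρ := by
        intro b hb
        refine le_antisymm (hM.dist_le (by rw [dist_comm]; exact hy1) (hle b hb))
          (not_lt.1 fun h1 => ?_)
        have h2 := h.lab.congr _ _ _ h1
        rw [hy2, ← hrb b hb, ← hxW b hb] at h2
        exact hrX.ne hN (xne b hb.1) h2
      refine ⟨y, hd, fun b hb => ?_, hy2.symm⟩
      have yne : y ≠ f b := by
        intro e
        have := hd b hb
        rw [e, dist_self] at this; exact ρ0.ne this
      rw [hrX.lt_iff hN (xne b hb.1), h.lab.lt_iff hN yne, hd b hb, hy2, hxW b hb, hrb b hb]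
  · have hlt : ∀ b ∈ W, dist a b < r := fun b hb' => lt_of_le_of_ne hb'.2 fun e => hb ⟨b, hb', e⟩
    -- The points of `W` are all strictly closer to `a` than `x` is, so any level above their images
    -- and below the images of the other points will do.
    obtain ⟨lo, hi, h0, hlh, hS, hT⟩ := exists_gap_of_finite
      (S := (fun b => dist (f a) (f b)) '' W) (T := (fun b => dist (f a) (f b)) '' (Y \ W))
      ((hY.subset hWY).image _) ((hY.subset Set.sdiff_subset).image _) (by
        rintro _ ⟨b, hb, rfl⟩ _ ⟨c, hc, rfl⟩
        refine (hf.dist_lt_iff ha hb.1 hc.1).1 (hb.2.trans_lt ?_)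
        exact not_le.1 fun h => hc.2 ⟨hc.1, h⟩) (by
        rintro _ ⟨c, hc, rfl⟩
        refine dist_pos.2 fun e => hc.2 ?_
        rw [← hf.injOn ha hc.1 e]; exact aW)
    obtain ⟨y, hy1, hy2, hy3, hy4, hy5⟩ := h.exists_level hrX (xne a ha) (f a) h0 hlh
    have hb1 : ∀ b ∈ W, dist (f b) (f a) < dist (f a) y := fun b hb => by
      rw [dist_comm (f b), dist_comm (f a) y]; exact (hS _ ⟨b, hb, rfl⟩).trans_lt hy1
    have hb2 : ∀ b ∈ W, dist b a < dist a x := fun b hb => by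
      rw [dist_comm b, dist_comm a x]; exact hlt b hb
    have hd : ∀ b ∈ W, dist y (f b) = dist y (f a) := fun b hb => by
      rw [dist_comm y, dist_comm y]; exact hM.dist_eq (hb1 b hb)
    refine ⟨y, fun b hb => ?_, fun b hb => ?_, fun b hb => ?_, fun b hb => ?_,
      fun b hb b' hb' => by rw [hd b hb, hd b' hb'], fun b hb b' hb' => ?_, fun c hc hcW => ?_⟩
    · rintro rfl
      have := hd b hb
      rw [dist_self] at this
      linarith
    · have e1 := hX.lt_iff (hb2 b hb)
      have e2 := hM.lt_iff (hb1 b hb)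
      have yb : y ≠ f b := by
        rintro rfl
        have := hd b hb
        rw [dist_self] at this
        linarith
      have ya : y ≠ f a := by
        rintro rfl
        rw [dist_self] at hy1; linarith
      have l1 : x < b ↔ x < a := by
        have i1 := lt_or_gt_of_ne (xne b hb.1)
        have i2 := lt_or_gt_of_ne (xne a ha)
        constructor
        · exact fun i => i2.resolve_right fun j => i.asymm (e1.2 j)
        · exact fun i => i1.resolve_right fun j => i.asymm (e1.1 j)
      have l2 : y < f b ↔ y < f a := by
        have i1 := lt_or_gt_of_ne yb
        have i2 := lt_or_gt_of_ne ya
        constructor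
        · exact fun i => i2.resolve_right fun j => i.asymm (e2.2 j)
        · exact fun i => i1.resolve_right fun j => i.asymm (e2.1 j)
      rw [l1, l2, hy3]
    · rw [hxW b hb, hd b hb, hy4]
    · rw [hxW b hb, hd b hb, hrX.congr b a r (by rw [dist_comm]; exact hlt b hb), hy5]
      refine (h.lab.congr _ _ _ ?_).symm
      rw [dist_comm]
      exact (hS _ ⟨b, hb, rfl⟩).trans_lt hy1
    · have n1 : dist b b' ≠ dist x b := by
        rw [hxW b hb]
        exact (hX.dist_lt (by rw [dist_comm]; exact hlt b hb) (hlt b' hb')).ne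
      have n2 : dist (f b) (f b') ≠ dist y (f b) := by
        rw [hd b hb]
        refine (hM.dist_lt (y := f a) ?_ ?_).ne
        · rw [dist_comm]; exact (hS _ ⟨b, hb, rfl⟩).trans_lt hy1
        · exact (hS _ ⟨b', hb', rfl⟩).trans_lt hy1
      exact iff_of_false n1 n2
    · exact hy2.trans_le (hT _ ⟨c, ⟨hc, hcW⟩, rfl⟩)

end IsRich

/-! ### Back and forth -/

/-- A pair stands for the restriction of a map to a finite set; its other values are irrelevant.
Both steps are carried out for each point of an enumeration. Every finite set lies in one of the
stages, which is how properties of tuples pass to `e`. -/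
theorem exists_perm_of_backAndForth {M : Type v} [Countable M] (S : Set (Finset M × (M → M)))
    (inj : ∀ p ∈ S, Set.InjOn p.2 p.1)
    (forth : ∀ p ∈ S, ∀ x, ∃ q ∈ S, p.1 ⊆ q.1 ∧ (∀ y ∈ p.1, q.2 y = p.2 y) ∧ x ∈ q.1)
    (back : ∀ p ∈ S, ∀ z, ∃ q ∈ S, p.1 ⊆ q.1 ∧ (∀ y ∈ p.1, q.2 y = p.2 y) ∧ ∃ x ∈ q.1, q.2 x = z)
    {p₀ : Finset M × (M → M)} (hp₀ : p₀ ∈ S) :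
    ∃ e : Equiv.Perm M, (∀ y ∈ p₀.1, e y = p₀.2 y) ∧
      ∀ Y : Finset M, ∃ q ∈ S, Y ⊆ q.1 ∧ ∀ y ∈ q.1, e y = q.2 y := by
  classical
  rcases isEmpty_or_nonempty M with hM | hM
  · refine ⟨1, fun y => isEmptyElim y, fun Y => ⟨p₀, hp₀, fun y => isEmptyElim y,
      fun y => isEmptyElim y⟩⟩
  obtain ⟨en, hen⟩ := exists_surjective_nat M
  have step : ∀ (p : S) (x : M), ∃ q : S, p.1.1 ⊆ q.1.1 ∧ (∀ y ∈ p.1.1, q.1.2 y = p.1.2 y) ∧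
      x ∈ q.1.1 ∧ ∃ z ∈ q.1.1, q.1.2 z = x := by
    rintro ⟨p, hp⟩ x
    obtain ⟨q, hq, h1, h2, h3⟩ := forth p hp x
    obtain ⟨q', hq', h4, h5, h6⟩ := back q hq x
    exact ⟨⟨q', hq'⟩, h1.trans h4, fun y hy => (h5 y (h1 hy)).trans (h2 y hy), h4 h3, h6⟩
  choose nx h1 h2 h3 h4 using step
  let s : ℕ → S := fun n => Nat.rec ⟨p₀, hp₀⟩ (fun k p => nx p (en k)) n
  have s0 : s 0 = ⟨p₀, hp₀⟩ := rfl
  have ss : ∀ k, s (k + 1) = nx (s k) (en k) := fun k => rfl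
  have mono : ∀ m n, m ≤ n → (s m).1.1 ⊆ (s n).1.1 ∧ ∀ y ∈ (s m).1.1, (s n).1.2 y = (s m).1.2 y := by
    intro m n hmn
    induction n, hmn using Nat.le_induction with
    | base => exact ⟨subset_rfl, fun _ _ => rfl⟩
    | succ n _ ih =>
      rw [ss]
      exact ⟨ih.1.trans (h1 _ _), fun y hy => (h2 _ _ y (ih.1 hy)).trans (ih.2 y hy)⟩
  have cov : ∀ x, ∃ n, x ∈ (s n).1.1 := by
    intro x
    obtain ⟨k, rfl⟩ := hen x
    exact ⟨k + 1, by rw [ss]; exact h3 _ _⟩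
  choose ix hix using cov
  let F : M → M := fun x => (s (ix x)).1.2 x
  have hF : ∀ n, ∀ x ∈ (s n).1.1, F x = (s n).1.2 x := by
    intro n x hx
    rcases le_total n (ix x) with h | h
    · exact (mono _ _ h).2 x hx
    · exact ((mono _ _ h).2 x (hix x)).symm
  have Finj : Function.Injective F := by
    intro x y hxy
    have hx := (mono _ _ (le_max_left (ix x) (ix y))).1 (hix x)
    have hy := (mono _ _ (le_max_right (ix x) (ix y))).1 (hix y)
    rw [hF _ x hx, hF _ y hy] at hxy
    exact inj _ (s _).2 hx hy hxy
  have Fsurj : Function.Surjective F := by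
    intro z
    obtain ⟨k, rfl⟩ := hen z
    obtain ⟨x, hx, hx'⟩ := h4 (s k) (en k)
    rw [← ss] at hx hx'
    exact ⟨x, (hF (k + 1) x hx).trans hx'⟩
  refine ⟨Equiv.ofBijective F ⟨Finj, Fsurj⟩, fun y hy => hF 0 y hy, fun Y => ?_⟩
  obtain ⟨n, hn⟩ : ∃ n, Y ⊆ (s n).1.1 := by
    refine ⟨Y.sup ix, fun y hy => ?_⟩
    exact (mono _ _ (Finset.le_sup hy)).1 (hix y)
  exact ⟨(s n).1, (s n).2, hn, fun y hy => hF n y hy⟩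

/-! ### Ball-preserving maps and comparison of distances -/

section BPChar

variable {X : Type u} [MetricSpace X] {Y : Type v} [MetricSpace Y]

/-- The ball about `x` with radius `dist x z` contains `y` but not `z`. Its image is a ball, and in
an ultrametric space `e x` can serve as its centre. -/
theorem dist_lt_of_isBPEquiv (hY : ∀ x y z : Y, dist x z ≤ max (dist x y) (dist y z)) {e : X ≃ Y}
    (he : IsBPEquiv e) {x y z : X} (h : dist x y < dist x z) : dist (e x) (e y) < dist (e x) (e z) := by
  have h0 : 0 < dist x z := dist_nonneg.trans_lt h
  obtain ⟨c, r, hr, hC⟩ := (he (Metric.ball x (dist x z))).2 ⟨x, _, h0, rfl⟩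
  have hx : e x ∈ Metric.ball c r := by
    rw [← hC]; exact ⟨x, Metric.mem_ball_self h0, rfl⟩
  have hy : e y ∈ Metric.ball c r := by
    rw [← hC]; exact ⟨y, by rwa [Metric.mem_ball, dist_comm], rfl⟩
  have hz : e z ∉ Metric.ball c r := by
    rw [← hC]
    rintro ⟨z', hz', h2⟩
    rw [e.injective h2, Metric.mem_ball, dist_comm] at hz'
    exact lt_irrefl _ hz'
  rw [Metric.mem_ball] at hx hy hz
  have h1 : dist (e x) (e y) < r := (hY _ c _).trans_lt (max_lt hx (by rwa [dist_comm]))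
  refine h1.trans_le (not_lt.1 fun h2 => hz ?_)
  exact (hY _ (e x) _).trans_lt (max_lt (by rwa [dist_comm]) hx)

theorem IsBPEquiv.symm {e : X ≃ Y} (he : IsBPEquiv e) : IsBPEquiv e.symm := by
  intro C
  rw [← he (e.symm '' C), ← Set.image_comp]
  simp

theorem dist_le_iff_of_isBPEquiv (hX : ∀ x y z : X, dist x z ≤ max (dist x y) (dist y z))
    (hY : ∀ x y z : Y, dist x z ≤ max (dist x y) (dist y z)) {e : X ≃ Y}
    (he : IsBPEquiv e) (x y z : X) : dist x y ≤ dist x z ↔ dist (e x) (e y) ≤ dist (e x) (e z) := by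
  rw [← not_lt, ← not_lt, not_iff_not]
  refine ⟨dist_lt_of_isBPEquiv hY he, fun h => ?_⟩
  simpa using dist_lt_of_isBPEquiv hX he.symm h

theorem isBall_image {e : X ≃ Y} (hd : ∀ (x : X) (r : ℝ), 0 < r → ∃ ρ, 0 < ρ ∧
    ∀ y, dist x y < r ↔ dist (e x) (e y) < ρ) {C : Set X} (hC : IsBall C) : IsBall (e '' C) := by
  obtain ⟨x, r, hr, rfl⟩ := hC
  obtain ⟨ρ, hρ, h1⟩ := hd x r hr
  refine ⟨e x, ρ, hρ, ?_⟩
  ext y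
  obtain ⟨y, rfl⟩ := e.surjective y
  rw [e.injective.mem_set_image, Metric.mem_ball, Metric.mem_ball, dist_comm, dist_comm (e y)]
  exact h1 y

theorem isBPEquiv_of_isBall_image {e : X ≃ Y} (h1 : ∀ C, IsBall C → IsBall (e '' C))
    (h2 : ∀ C, IsBall C → IsBall (e.symm '' C)) : IsBPEquiv e := by
  refine fun C => ⟨fun h => ?_, h1 C⟩
  have := h2 _ h
  rwa [← Set.image_comp, Equiv.symm_comp_self, Set.image_id] at this

/-- The radius may be raised to the next distance realized from the centre, whose image is the new
radius. If there is none, any number beyond all distances works. -/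
theorem isBall_image_of_finite [Finite X] {e : X ≃ Y}
    (he : ∀ x y z, dist x y ≤ dist x z ↔ dist (e x) (e y) ≤ dist (e x) (e z)) {C : Set X}
    (hC : IsBall C) : IsBall (e '' C) := by
  refine isBall_image (fun x r hr => ?_) hC
  by_cases h : ∃ z, r ≤ dist x z
  · obtain ⟨z, hz, hmin⟩ := Set.exists_min_image {z | r ≤ dist x z} (fun z => dist x z)
      (Set.toFinite _) h
    have hz' : r ≤ dist x z := hz
    refine ⟨dist (e x) (e z), dist_pos.2 fun h0 => ?_, fun y => ?_⟩
    · rw [e.injective h0, dist_self] at hz'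
      linarith
    · rw [← not_le, ← not_le, ← he, not_iff_not]
      exact ⟨fun hy => hmin y hy, fun hy => hz'.trans hy⟩
  · push Not at h
    have := Nonempty.intro x
    obtain ⟨y, hy⟩ := Finite.exists_max (fun y => dist (e x) (e y))
    exact ⟨dist (e x) (e y) + 1, by positivity, fun z =>
      iff_of_true (h z) ((hy z).trans_lt (lt_add_one _))⟩

end BPChar

theorem le_iff_symm {X : Type u} [MetricSpace X] {Y : Type v} [MetricSpace Y] {e : X ≃ Y}
    (he : ∀ x y z, dist x y ≤ dist x z ↔ dist (e x) (e y) ≤ dist (e x) (e z)) (x y z : Y) :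
    dist x y ≤ dist x z ↔ dist (e.symm x) (e.symm y) ≤ dist (e.symm x) (e.symm z) := by
  rw [he]; simp

theorem isBPEquiv_of_finite {X : Type u} [MetricSpace X] {Y : Type v} [MetricSpace Y] [Finite X]
    {e : X ≃ Y} (he : ∀ x y z, dist x y ≤ dist x z ↔ dist (e x) (e y) ≤ dist (e x) (e z)) :
    IsBPEquiv e :=
  have := Finite.of_equiv X e
  isBPEquiv_of_isBall_image (fun _ => isBall_image_of_finite he)
    (fun _ => isBall_image_of_finite (le_iff_symm he))

theorem isOrderedBPEmbedding_iff {X : Type u} [MetricSpace X] [LinearOrder X] {Y : Type v}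
    [MetricSpace Y] [LinearOrder Y] [Finite X] (hX : ∀ x y z : X, dist x z ≤ max (dist x y) (dist y z))
    (hY : ∀ x y z : Y, dist x z ≤ max (dist x y) (dist y z)) {f : X → Y} :
    IsOrderedBPEmbedding f ↔
      StrictMono f ∧ ∀ x y z, dist x y ≤ dist x z ↔ dist (f x) (f y) ≤ dist (f x) (f z) := by
  refine and_congr_right fun hf => ⟨?_, fun h => ⟨hf.injective, isBPEquiv_of_finite h⟩⟩
  rintro ⟨hi, he⟩
  exact dist_le_iff_of_isBPEquiv (Y := Set.range f) hX (fun x y z => hY x y z) he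

/-! ### The group of bp-automorphisms of a rich space -/

namespace IsRich

variable {N : ℕ∞} {M : Type v} [MetricSpace M] [LinearOrder M] {rk : M → ℝ → ℕ}

/-- The new radius is an infimum, possibly attained. The image is nevertheless an open ball: every
positive rational is a distance, so between `dist x y` and `r` another distance is realized, and its
image separates strictly. -/
theorem isBall_image (h : IsRich N rk) {e : M ≃ M}
    (he : ∀ x y z, dist x y ≤ dist x z ↔ dist (e x) (e y) ≤ dist (e x) (e z)) {C : Set M}
    (hC : IsBall C) : IsBall (e '' C) := by
  refine _root_.isBall_image (fun x r hr => ?_) hC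
  have lt : ∀ x y z, dist x y < dist x z ↔ dist (e x) (e y) < dist (e x) (e z) := fun x y z => by
    rw [← not_le, ← not_le, he]
  obtain ⟨q, hq, -⟩ := exists_rat_btwn (lt_add_one r)
  obtain ⟨z, hz⟩ := h.distances x q (by exact_mod_cast hr.trans hq)
  have hz' : r ≤ dist x z := by rw [hz]; exact hq.le
  set A : Set ℝ := {s | ∃ y, r ≤ dist x y ∧ s = dist (e x) (e y)} with hA
  have Ab : BddBelow A := ⟨0, by rintro _ ⟨y, -, rfl⟩; exact dist_nonneg⟩
  have An : A.Nonempty := ⟨_, z, hz', rfl⟩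
  have key : ∀ y, dist x y < r → dist (e x) (e y) < sInf A := by
    intro y hy
    obtain ⟨p, hp1, hp2⟩ := exists_rat_btwn hy
    obtain ⟨y', hy'⟩ := h.distances x p (by exact_mod_cast dist_nonneg.trans_lt hp1)
    rw [← hy'] at hp1 hp2
    refine ((lt _ _ _).1 hp1).trans_le (le_csInf An ?_)
    rintro _ ⟨w, hw, rfl⟩
    exact ((lt _ _ _).1 (hp2.trans_le hw)).le
  refine ⟨sInf A, ?_, fun y => ⟨key y, fun hy => not_le.1 fun hy' => ?_⟩⟩
  · have := key x (by rwa [dist_self])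
    rwa [dist_self] at this
  · exact not_le.2 hy (csInf_le Ab ⟨y, hy', rfl⟩)

theorem mem_BP (h : IsRich N rk) {e : Equiv.Perm M} : e ∈ BP M ↔ (∀ x y, x < y → e x < e y) ∧
    ∀ x y z, dist x y ≤ dist x z ↔ dist (e x) (e y) ≤ dist (e x) (e z) := by
  constructor
  · rintro ⟨h1, h2⟩
    exact ⟨fun x y hxy => h2 hxy, dist_le_iff_of_isBPEquiv h.cu.um h.cu.um h1⟩
  · rintro ⟨h1, h2⟩
    exact ⟨isBPEquiv_of_isBall_image (fun _ => h.isBall_image h2)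
      (fun _ => h.isBall_image (le_iff_symm h2)), fun x y hxy => h1 x y hxy⟩

/-- A full set of children of the node of two points. -/
theorem exists_fullPolygon (h : IsRich N rk) {n : ℕ} (hN : N = n) {a b : M} (hab : a ≠ b) :
    ∃ Q : Finset M, a ∈ Q ∧ b ∈ Q ∧ Q.card = n ∧ IsPolygon (dist a b) Q := by
  classical
  have hNt : N ≠ ⊤ := by simp [hN]
  have hlt : ∀ {k : ℕ}, (k : ℕ∞) < N ↔ k < n := by intro k; rw [hN]; exact Nat.cast_lt
  set r := dist a b with hr
  -- One representative is chosen for each label; `a` and `b` represent their own labels, so that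
  -- both belong to the polygon.
  have ex : ∀ j : ℕ, ∃ y, (j < n → dist a y ≤ r ∧ rk y r = j) ∧ (j = rk a r → y = a) ∧
      (j = rk b r → y = b) := by
    intro j
    by_cases h1 : j = rk a r
    · exact ⟨a, fun _ => ⟨by simp [hr], h1.symm⟩, fun _ => rfl,
        fun h2 => absurd (h1.symm.trans h2) (h.lab.ne hNt hab)⟩
    · by_cases h2 : j = rk b r
      · exact ⟨b, fun _ => ⟨le_rfl, h2.symm⟩, fun h3 => absurd h3 h1, fun _ => rfl⟩
      · by_cases hj : j < n
        · obtain ⟨y, hy⟩ := h.full hNt a b hab j (hlt.2 hj)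
          exact ⟨y, fun _ => hy, fun h3 => absurd h3 h1, fun h3 => absurd h3 h2⟩
        · exact ⟨a, fun h => absurd h hj, fun h3 => absurd h3 h1, fun h3 => absurd h3 h2⟩
  choose y hy1 hya hyb using ex
  have hinj : Set.InjOn y (Finset.range n) := by
    intro i hi j hj hij
    rw [← (hy1 i (by simpa using hi)).2, ← (hy1 j (by simpa using hj)).2, hij]
  refine ⟨(Finset.range n).image y, Finset.mem_image.2 ⟨rk a r, ?_, hya _ rfl⟩,
    Finset.mem_image.2 ⟨rk b r, ?_, hyb _ rfl⟩, ?_, ?_⟩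
  · exact Finset.mem_range.2 (hlt.1 (h.lab.lt_bound hNt _ _))
  · exact Finset.mem_range.2 (hlt.1 (h.lab.lt_bound hNt _ _))
  · rw [Finset.card_image_of_injOn hinj, Finset.card_range]
  · intro u hu v hv huv
    simp only [Finset.coe_image, Set.mem_image, Finset.coe_range, Set.mem_Iio] at hu hv
    obtain ⟨i, hi, rfl⟩ := hu
    obtain ⟨j, hj, rfl⟩ := hv
    refine le_antisymm (h.cu.dist_le (y := a) (by rw [dist_comm]; exact (hy1 i hi).1)
      (hy1 j hj).1) (not_lt.1 fun h1 => huv ?_)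
    have := h.lab.congr _ _ _ h1
    rw [(hy1 i hi).2, (hy1 j hj).2] at this
    rw [this]

end IsRich

theorem image_eq_range_of_strictMono {X : Type u} [LinearOrder X] {n : ℕ} {Q : Finset X}
    (hc : Q.card = n) (g : X → ℕ) (hg1 : ∀ x ∈ Q, g x < n)
    (hg2 : ∀ x ∈ Q, ∀ y ∈ Q, x < y → g x < g y) :
    Set.InjOn g Q ∧ Q.image g = Finset.range n := by
  classical
  have inj : Set.InjOn g Q := by
    intro a ha b hb hab
    rcases lt_trichotomy a b with h | h | h
    · exact absurd hab (hg2 a ha b hb h).ne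
    · exact h
    · exact absurd hab (hg2 b hb a ha h).ne'
  refine ⟨inj, Finset.eq_of_subset_of_card_le ?_ ?_⟩
  · intro k hk
    obtain ⟨a, ha, rfl⟩ := Finset.mem_image.1 hk
    exact Finset.mem_range.2 (hg1 a ha)
  · rw [Finset.card_image_of_injOn inj, hc, Finset.card_range]

/-- A strictly increasing map of `n` points to the numbers below `n` is the enumeration. -/
theorem eq_card_filter_lt {X : Type u} [LinearOrder X] {n : ℕ} {Q : Finset X} (hc : Q.card = n)
    (g : X → ℕ) (hg1 : ∀ x ∈ Q, g x < n) (hg2 : ∀ x ∈ Q, ∀ y ∈ Q, x < y → g x < g y) :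
    ∀ x ∈ Q, g x = (Q.filter (· < x)).card := by
  intro x hx
  obtain ⟨inj, him⟩ := image_eq_range_of_strictMono hc g hg1 hg2
  have : (Q.filter (· < x)).image g = Finset.range (g x) := by
    ext k
    simp only [Finset.mem_image, Finset.mem_filter, Finset.mem_range]
    constructor
    · rintro ⟨a, ⟨ha, hax⟩, rfl⟩
      exact hg2 a ha x hx hax
    · intro hk
      have : k ∈ Q.image g := by
        rw [him]; exact Finset.mem_range.2 (hk.trans (hg1 x hx))
      obtain ⟨a, ha, rfl⟩ := Finset.mem_image.1 this
      refine ⟨a, ⟨ha, ?_⟩, rfl⟩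
      rcases lt_trichotomy a x with h | h | h
      · exact h
      · subst h; exact absurd hk (lt_irrefl _)
      · exact absurd hk (hg2 x hx a ha h).asymm
  have h2 := congrArg Finset.card this
  rw [Finset.card_range, Finset.card_image_of_injOn (inj.mono fun a ha => by
    simp only [Finset.coe_filter, Set.mem_ofPred_eq] at ha; exact ha.1)] at h2
  exact h2.symm

/-- On polygons with `N` points, all labellings agree. -/
theorem IsLabelling.eq_of_fullPolygon {n : ℕ} {X : Type u} [MetricSpace X] [LinearOrder X]
    {M : Type v} [MetricSpace M] [LinearOrder M] {rkX : X → ℝ → ℕ} {rkM : M → ℝ → ℕ}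
    (hX : IsLabelling n rkX) (hM : IsLabelling n rkM) {f : X → M} {Q : Finset X} {r s : ℝ}
    (hr : IsPolygon r Q) (hc : Q.card = n) (hf : ∀ x ∈ Q, ∀ y ∈ Q, x < y → f x < f y)
    (hs : ∀ x ∈ Q, ∀ y ∈ Q, x ≠ y → dist (f x) (f y) = s) :
    ∀ x ∈ Q, rkX x r = rkM (f x) s := by
  classical
  have hNt : (n : ℕ∞) ≠ ⊤ := by simp
  intro x hx
  rw [eq_card_filter_lt hc (fun x => rkX x r) (fun x _ => by exact_mod_cast hX.lt_bound hNt x r)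
      (fun x hx y hy hxy => ?_) x hx, eq_card_filter_lt hc (fun x => rkM (f x) s)
      (fun x _ => by exact_mod_cast hM.lt_bound hNt (f x) s) (fun x hx y hy hxy => ?_) x hx]
  rotate_left
  · have := hX.lt hNt x y hxy
    rwa [hr hx hy hxy.ne] at this
  · have := hM.lt hNt _ _ (hf x hx y hy hxy)
    rwa [hs x hx y hy hxy.ne] at this

namespace IsRich

variable {N : ℕ∞} {M : Type v} [MetricSpace M] [LinearOrder M] {rk : M → ℝ → ℕ}

theorem dist_eq_of_mem_BP (h : IsRich N rk) {e : Equiv.Perm M} (he : e ∈ BP M) {x y z : M} :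
    dist x y = dist x z ↔ dist (e x) (e y) = dist (e x) (e z) := by
  have := (h.mem_BP.1 he).2
  rw [le_antisymm_iff, le_antisymm_iff, this x y z, this x z y]

/-- If comparisons of distances are preserved, polygons go to polygons. -/
theorem _root_.dist_eq_of_isPolygon {X : Type u} [MetricSpace X] {M : Type v} [MetricSpace M]
    {f : X → M} {Q : Finset X} {r : ℝ} (hQ : IsPolygon r Q)
    (hf : ∀ x ∈ Q, ∀ y ∈ Q, ∀ z ∈ Q, dist x y = dist x z → dist (f x) (f y) = dist (f x) (f z))
    {a b x y : X} (ha : a ∈ Q) (hb : b ∈ Q) (hab : a ≠ b) (hx : x ∈ Q) (hy : y ∈ Q) (hxy : x ≠ y) :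
    dist (f x) (f y) = dist (f a) (f b) := by
  have key : ∀ x ∈ Q, ∀ y ∈ Q, ∀ z ∈ Q, x ≠ y → x ≠ z → dist (f x) (f y) = dist (f x) (f z) :=
    fun x hx y hy z hz h1 h2 => hf x hx y hy z hz ((hQ hx hy h1).trans (hQ hx hz h2).symm)
  by_cases h1 : x = a
  · subst h1; exact key x hx y hy b hb hxy hab
  · rw [key x hx y hy a ha hxy h1, dist_comm]
    exact key a ha x hx b hb (Ne.symm h1) hab

/-- Labels do not occur in the definition of `BP M`. They are preserved because a polygon with `N`
points through `x` and `y` goes, in increasing order, to another one, on which the labelling is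
forced. -/
theorem rk_of_mem_BP (h : IsRich N rk) {e : Equiv.Perm M} (he : e ∈ BP M) {x y : M} (hxy : x ≠ y) :
    rk x (dist x y) = rk (e x) (dist (e x) (e y)) := by
  induction hN : N using ENat.recTopCoe with
  | top => rw [h.lab.top hN, h.lab.top hN]
  | coe n =>
    obtain ⟨Q, hx, hy, hc, hQ⟩ := h.exists_fullPolygon hN hxy
    have hl : IsLabelling (n : ℕ∞) rk := hN ▸ h.lab
    have he' := h.mem_BP.1 he
    exact hl.eq_of_fullPolygon hl (f := e) hQ hc (fun x _ y _ => he'.1 x y)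
      (fun a ha b hb hab => dist_eq_of_isPolygon hQ (fun x _ y _ z _ =>
        (h.dist_eq_of_mem_BP he).1) hx hy hxy ha hb hab) x hx

theorem pIso_of_mem_BP (h : IsRich N rk) {e : Equiv.Perm M} (he : e ∈ BP M) (Y : Set M) :
    PIso rk rk e Y :=
  ⟨fun x _ y _ => (h.mem_BP.1 he).1 x y, fun x _ y _ z _ => (h.mem_BP.1 he).2 x y z,
    fun _ _ _ _ hxy => h.rk_of_mem_BP he hxy⟩

/-- Finite partial isomorphisms extend to bp-automorphisms. -/
theorem exists_extension (h : IsRich N rk) {f : M → M} (Y : Finset M) (hf : PIso rk rk f Y) :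
    ∃ e ∈ BP M, ∀ y ∈ Y, e y = f y := by
  classical
  have := h.countable
  obtain ⟨e, he, he'⟩ := exists_perm_of_backAndForth
    {p : Finset M × (M → M) | PIso rk rk p.2 p.1} (fun p hp => hp.injOn) (fun p hp x => by
      by_cases hx : x ∈ p.1
      · exact ⟨p, hp, subset_rfl, fun _ _ => rfl, hx⟩
      · obtain ⟨y, hy⟩ := h.exists_insert h.cu h.lab hp p.1.finite_toSet (x := x) (by simpa using hx)
        refine ⟨(insert x p.1, Function.update p.2 x y), ?_, Finset.subset_insert _ _,
          fun z hz => Function.update_of_ne (by rintro rfl; exact hx hz) _ _,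
          Finset.mem_insert_self _ _⟩
        simpa using hy) (fun p hp z => by
      by_cases hz : ∃ x ∈ p.1, p.2 x = z
      · exact ⟨p, hp, subset_rfl, fun _ _ => rfl, hz⟩
      · rcases isEmpty_or_nonempty M with hM | hM
        · exact isEmptyElim z
        -- The backward step is the forward step for the inverse partial map.
        have hi : ∀ y ∈ (p.1 : Set M), Function.invFunOn p.2 p.1 (p.2 y) = y :=
          hp.injOn.leftInvOn_invFunOn
        have hz' : z ∉ p.2 '' (p.1 : Set M) := by
          rintro ⟨x, hx, rfl⟩; exact hz ⟨x, hx, rfl⟩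
        obtain ⟨x, hx⟩ := h.exists_insert h.cu h.lab (hp.of_inverse hi)
          (p.1.finite_toSet.image _) hz'
        have ne : ∀ y ∈ p.1, p.2 y ≠ z := fun y hy e => hz ⟨y, hy, e⟩
        have hxp : x ∉ p.1 := by
          intro hxp
          have := hx.injOn (Set.mem_insert _ _) (Set.mem_insert_of_mem _ ⟨x, hxp, rfl⟩) (by
            rw [Function.update_self, Function.update_of_ne (ne x hxp), hi x hxp])
          exact ne x hxp this.symm
        have hup : ∀ y ∈ p.1, Function.update p.2 x z y = p.2 y := fun y hy =>
          Function.update_of_ne (by rintro rfl; exact hxp hy) _ _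
        refine ⟨(insert x p.1, Function.update p.2 x z), ?_, Finset.subset_insert _ _, hup,
          x, Finset.mem_insert_self _ _, Function.update_self _ _ _⟩
        have h1 := hx.of_inverse (g := Function.update p.2 x z) (by
          rintro _ (rfl | ⟨y, hy, rfl⟩)
          · rw [Function.update_self, Function.update_self]
          · rw [Function.update_of_ne (ne y hy), hi y hy, hup y hy])
        refine h1.mono ?_
        intro y hy
        rcases Finset.mem_insert.1 (Finset.mem_coe.1 hy) with rfl | hy
        · exact ⟨z, Set.mem_insert _ _, Function.update_self _ _ _⟩
        · exact ⟨p.2 y, Set.mem_insert_of_mem _ ⟨y, hy, rfl⟩, by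
            rw [Function.update_of_ne (ne y hy), hi y hy]⟩)
    (p₀ := (Y, f)) hf
  refine ⟨e, h.mem_BP.2 ⟨fun x y hxy => ?_, fun x y z => ?_⟩, he⟩
  · obtain ⟨q, hq, h1, h2⟩ := he' {x, y}
    have hx : x ∈ q.1 := h1 (by simp)
    have hy : y ∈ q.1 := h1 (by simp)
    rw [h2 x hx, h2 y hy]
    exact hq.lt x hx y hy hxy
  · obtain ⟨q, hq, h1, h2⟩ := he' {x, y, z}
    have hx : x ∈ q.1 := h1 (by simp)
    have hy : y ∈ q.1 := h1 (by simp)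
    have hz : z ∈ q.1 := h1 (by simp)
    rw [h2 x hx, h2 y hy, h2 z hz]
    exact hq.le x hx y hy z hz

end IsRich

/-! ### Amalgamation bases for permutation groups -/

section Amalg

variable {M : Type v} (G : Subgroup (Equiv.Perm M))

/-- The elements of `G` which are the identity outside of `V`. -/
def suppIn (V : Set M) : Subgroup (Equiv.Perm M) where
  carrier := {g | g ∈ G ∧ ∀ x, x ∉ V → g x = x}
  one_mem' := ⟨G.one_mem, fun _ _ => rfl⟩
  mul_mem' := by
    rintro a b ⟨ha, ha'⟩ ⟨hb, hb'⟩
    exact ⟨G.mul_mem ha hb, fun x hx => by rw [Equiv.Perm.mul_apply, hb' x hx, ha' x hx]⟩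
  inv_mem' := by
    rintro a ⟨ha, ha'⟩
    exact ⟨G.inv_mem ha, fun x hx => by rw [Equiv.Perm.inv_eq_iff_eq, ha' x hx]⟩

variable {G} {V W : Set M} {g : Equiv.Perm M}

theorem suppIn_mono (h : V ⊆ W) : suppIn G V ≤ suppIn G W :=
  fun _ hg => ⟨hg.1, fun x hx => hg.2 x fun h' => hx (h h')⟩

theorem suppIn_mem (hg : g ∈ suppIn G V) {x : M} : g x ∈ V ↔ x ∈ V := by
  constructor
  · intro h
    by_contra hx
    rw [hg.2 x hx] at h; exact hx h
  · intro h
    by_contra hx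
    have := g.injective (hg.2 _ hx)
    rw [this] at hx; exact hx h

theorem inv_apply_mem_iff {L : Set M} (h : ∀ x, g x ∈ L ↔ x ∈ L) (x : M) : g⁻¹ x ∈ L ↔ x ∈ L := by
  rw [← h]; simp

variable (G)

/-- Any two elements of `suppIn G V` which agree with `g₀` on `D` can be amalgamated over `D` and
its image. -/
def IsAmalgBase (V : Set M) (D : Finset M) (g₀ : Equiv.Perm M) : Prop :=
  ∀ g₁ ∈ suppIn G V, ∀ g₂ ∈ suppIn G V, (∀ x ∈ D, g₁ x = g₀ x) → (∀ x ∈ D, g₂ x = g₀ x) →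
    ∀ Y₁ Y₂ : Finset M, ∃ g ∈ suppIn G V, ∃ h ∈ suppIn G V,
      (∀ x ∈ D, h x = x ∧ h (g₀ x) = g₀ x) ∧ (∀ y ∈ Y₁, g y = g₁ y) ∧
        ∀ y ∈ Y₂, g (h y) = h (g₂ y)

/-- The restriction of `g` to the points of `Y` in `V` extends to an amalgamation base in `V`. -/
def Resolvable (V : Set M) (g : Equiv.Perm M) (Y : Finset M) : Prop :=
  ∃ g' ∈ suppIn G V, ∃ D : Finset M, (∀ d ∈ D, d ∈ V) ∧ (∀ y ∈ Y, y ∈ V → y ∈ D ∧ g' y = g y) ∧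
    IsAmalgBase G V D g'

variable {G}

theorem Resolvable.congr {Y Y' : Finset M} {g' : Equiv.Perm M} (h : Resolvable G V g Y)
    (hY : ∀ y ∈ Y', y ∈ V → y ∈ Y) (hg : ∀ y ∈ Y', y ∈ V → g' y = g y) : Resolvable G V g' Y' := by
  obtain ⟨k, hk, D, h1, h2, h3⟩ := h
  exact ⟨k, hk, D, h1, fun y hy hyV => ⟨(h2 y (hY y hy hyV) hyV).1,
    by rw [hg y hy hyV]; exact (h2 y (hY y hy hyV) hyV).2⟩, h3⟩

/-- A union of independent amalgamation bases is an amalgamation base. -/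
theorem IsAmalgBase.union [DecidableEq M] {V₁ V₂ : Set M} {D₁ D₂ : Finset M} {k₁ k₂ : Equiv.Perm M}
    (h₁ : IsAmalgBase G V₁ D₁ k₁) (h₂ : IsAmalgBase G V₂ D₂ k₂) (hk₁ : k₁ ∈ suppIn G V₁)
    (hk₂ : k₂ ∈ suppIn G V₂) (hD₁ : ∀ d ∈ D₁, d ∈ V₁) (hD₂ : ∀ d ∈ D₂, d ∈ V₂)
    (hV₁ : V₁ ⊆ V) (hV₂ : V₂ ⊆ V) (disj : ∀ x ∈ V₁, x ∉ V₂)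
    (split : ∀ g ∈ suppIn G V, (∀ x ∈ D₁ ∪ D₂, g x = (k₁ * k₂) x) →
      ∃ a ∈ suppIn G V₁, ∃ b ∈ suppIn G V₂, g = a * b) :
    IsAmalgBase G V (D₁ ∪ D₂) (k₁ * k₂) := by
  have ev₁ : ∀ {a b : Equiv.Perm M}, a ∈ suppIn G V₁ → b ∈ suppIn G V₂ → ∀ x ∈ V₁,
      (a * b) x = a x := fun ha hb x hx => by
    rw [Equiv.Perm.mul_apply, hb.2 x (disj x hx)]
  have ev₂ : ∀ {a b : Equiv.Perm M}, a ∈ suppIn G V₁ → b ∈ suppIn G V₂ → ∀ x, x ∉ V₁ →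
      (a * b) x = b x := fun {a b} ha hb x hx => by
    rw [Equiv.Perm.mul_apply]
    refine ha.2 _ fun h => ?_
    by_cases hx2 : x ∈ V₂
    · exact disj _ h ((suppIn_mem hb).2 hx2)
    · rw [hb.2 x hx2] at h; exact hx h
  have nin : ∀ x ∈ V₂, x ∉ V₁ := fun x hx hx1 => disj x hx1 hx
  intro g₁ hg₁ g₂ hg₂ e₁ e₂ Y₁ Y₂
  obtain ⟨a₁, ha₁, b₁, hb₁, rfl⟩ := split g₁ hg₁ e₁
  obtain ⟨a₂, ha₂, b₂, hb₂, rfl⟩ := split g₂ hg₂ e₂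
  obtain ⟨a, ha, p, hp, c1, c2, c3⟩ := h₁ a₁ ha₁ a₂ ha₂
    (fun x hx => by
      have := e₁ x (Finset.mem_union_left _ hx)
      rwa [ev₁ ha₁ hb₁ x (hD₁ x hx), ev₁ hk₁ hk₂ x (hD₁ x hx)] at this)
    (fun x hx => by
      have := e₂ x (Finset.mem_union_left _ hx)
      rwa [ev₁ ha₂ hb₂ x (hD₁ x hx), ev₁ hk₁ hk₂ x (hD₁ x hx)] at this) Y₁ Y₂
  obtain ⟨b, hb, q, hq, d1, d2, d3⟩ := h₂ b₁ hb₁ b₂ hb₂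
    (fun x hx => by
      have := e₁ x (Finset.mem_union_right _ hx)
      rwa [ev₂ ha₁ hb₁ x (nin x (hD₂ x hx)), ev₂ hk₁ hk₂ x (nin x (hD₂ x hx))] at this)
    (fun x hx => by
      have := e₂ x (Finset.mem_union_right _ hx)
      rwa [ev₂ ha₂ hb₂ x (nin x (hD₂ x hx)), ev₂ hk₁ hk₂ x (nin x (hD₂ x hx))] at this) Y₁ Y₂
  refine ⟨a * b, (suppIn G V).mul_mem (suppIn_mono hV₁ ha) (suppIn_mono hV₂ hb), p * q,
    (suppIn G V).mul_mem (suppIn_mono hV₁ hp) (suppIn_mono hV₂ hq), ?_, ?_, ?_⟩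
  · intro x hx
    rcases Finset.mem_union.1 hx with hx | hx
    · have hx1 := hD₁ x hx
      rw [ev₁ hk₁ hk₂ x hx1, ev₁ hp hq x hx1, ev₁ hp hq _ ((suppIn_mem hk₁).2 hx1)]
      exact c1 x hx
    · have hx1 := hD₂ x hx
      rw [ev₂ hk₁ hk₂ x (nin x hx1), ev₂ hp hq x (nin x hx1),
        ev₂ hp hq _ (nin _ ((suppIn_mem hk₂).2 hx1))]
      exact d1 x hx
  · intro y hy
    by_cases h1 : y ∈ V₁
    · rw [ev₁ ha hb y h1, ev₁ ha₁ hb₁ y h1, c2 y hy]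
    · rw [ev₂ ha hb y h1, ev₂ ha₁ hb₁ y h1, d2 y hy]
  · intro y hy
    by_cases h1 : y ∈ V₁
    · rw [ev₁ hp hq y h1, ev₁ ha₂ hb₂ y h1, ev₁ ha hb _ ((suppIn_mem hp).2 h1),
        ev₁ hp hq _ ((suppIn_mem ha₂).2 h1), c3 y hy]
    · have n : ∀ {c : Equiv.Perm M}, c ∈ suppIn G V₂ → c y ∉ V₁ := fun {c} hc h => by
        by_cases hx2 : y ∈ V₂
        · exact disj _ h ((suppIn_mem hc).2 hx2)
        · rw [hc.2 y hx2] at h; exact h1 h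
      rw [ev₂ hp hq y h1, ev₂ ha₂ hb₂ y h1, ev₂ ha hb _ (n hq), ev₂ hp hq _ (n hb₂), d3 y hy]

/-! ### Lines -/

variable (G) in
/-- `V` is totally preordered by `le`, the elements of `G` supported in `V` are monotone and can
be cut at invariant cuts of `V`, there are enough automorphisms fixing points in given cuts, and
such points in the same position with respect to finite sets are equivalent. -/
structure IsLine (V : Set M) (le : M → M → Prop) (Col : Set M) : Prop where
  total : ∀ x ∈ V, ∀ y ∈ V, le x y ∨ le y x
  trans : ∀ x ∈ V, ∀ y ∈ V, ∀ z ∈ V, le x y → le y z → le x z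
  inv : ∀ g ∈ suppIn G V, ∀ x ∈ V, ∀ y ∈ V, le x y → le (g x) (g y)
  glue : ∀ L ⊆ V, (∀ x ∈ L, ∀ y ∈ V, le y x → y ∈ L) → ∀ g ∈ suppIn G V,
    (∀ x, g x ∈ L ↔ x ∈ L) → ∃ g' ∈ suppIn G L, ∀ x ∈ L, g' x = g x
  insert : ∀ g ∈ suppIn G V, ∀ L ⊆ V, (∀ x ∈ L, ∀ y ∈ V, le y x → y ∈ L) →
    (∀ x, g x ∈ L ↔ x ∈ L) → ∀ Y : Finset M, ∃ g' ∈ suppIn G V, ∃ f ∈ V, f ∈ Col ∧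
      (∀ y ∈ Y, g' y = g y) ∧ g' f = f ∧ (∀ y ∈ Y, y ∈ L → ¬ le f y) ∧
        ∀ y ∈ Y, y ∈ V → y ∉ L → ¬ le y f
  transit : ∀ f ∈ V, ∀ f' ∈ V, f ∈ Col → f' ∈ Col → ∀ A : Finset M,
    (∀ a ∈ A, a ∈ V → (¬ le f a ∧ ¬ le f' a) ∨ (¬ le a f ∧ ¬ le a f')) →
      ∃ h ∈ suppIn G V, (∀ a ∈ A, h a = a) ∧ le (h f) f' ∧ le f' (h f)

namespace IsLine

variable {le : M → M → Prop} {Col : Set M}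

theorem refl (hV : IsLine G V le Col) {x : M} (hx : x ∈ V) : le x x :=
  (hV.total x hx x hx).elim id id

theorem le_of_not (hV : IsLine G V le Col) {x y : M} (hx : x ∈ V) (hy : y ∈ V) (h : ¬ le x y) :
    le y x := (hV.total x hx y hy).resolve_left h

theorem not_le_of_not_of_le (hV : IsLine G V le Col) {x y z : M} (hx : x ∈ V) (hy : y ∈ V)
    (hz : z ∈ V) (h1 : ¬ le y x) (h2 : le y z) : ¬ le z x := fun h =>
  h1 (hV.trans y hy z hz x hx h2 h)

theorem inv_iff (hV : IsLine G V le Col) (hg : g ∈ suppIn G V) {x y : M} (hx : x ∈ V)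
    (hy : y ∈ V) : le (g x) (g y) ↔ le x y := by
  refine ⟨fun h => ?_, hV.inv g hg x hx y hy⟩
  have := hV.inv g⁻¹ ((suppIn G V).inv_mem hg) _ ((suppIn_mem hg).2 hx) _ ((suppIn_mem hg).2 hy) h
  simpa using this

/-- Final segments are complements of initial ones, and the restriction of `g` to one of them is `g`
times the inverse of its restriction to the other. -/
theorem dual (hV : IsLine G V le Col) : IsLine G V (fun x y => le y x) Col where
  total x hx y hy := hV.total y hy x hx
  trans x hx y hy z hz h1 h2 := hV.trans z hz y hy x hx h2 h1
  inv g hg x hx y hy h := hV.inv g hg y hy x hx h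
  glue L hL hlow g hg hgL := by
    obtain ⟨k, hk, hk'⟩ := hV.glue (V \ L) Set.sdiff_subset (fun x hx y hy hyx =>
      ⟨hy, fun hyL => hx.2 (hlow y hyL x hx.1 hyx)⟩) g hg (fun x => by
        rw [Set.mem_sdiff, Set.mem_sdiff, hgL, suppIn_mem hg])
    have hk1 := (suppIn (G := G) (V \ L)).inv_mem hk
    refine ⟨g * k⁻¹, ⟨G.mul_mem hg.1 hk1.1, fun x hx => ?_⟩, fun x hx => ?_⟩
    · by_cases hxV : x ∈ V
      · have : k⁻¹ x ∈ V \ L := (suppIn_mem hk1).2 ⟨hxV, hx⟩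
        rw [Equiv.Perm.mul_apply, ← hk' _ this, ← Equiv.Perm.mul_apply, mul_inv_cancel, Equiv.Perm.one_apply]
      · rw [Equiv.Perm.mul_apply, hk1.2 x (fun h => hxV h.1), hg.2 x hxV]
    · rw [Equiv.Perm.mul_apply, hk1.2 x (fun h => h.2 hx)]
  insert g hg L hL hlow hgL Y := by
    obtain ⟨g', hg', f, hf, hc, h1, h2, h3, h4⟩ := hV.insert g hg (V \ L) Set.sdiff_subset
      (fun x hx y hy hyx => ⟨hy, fun hyL => hx.2 (hlow y hyL x hx.1 hyx)⟩) (fun x => by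
        rw [Set.mem_sdiff, Set.mem_sdiff, hgL, suppIn_mem hg]) Y
    exact ⟨g', hg', f, hf, hc, h1, h2, fun y hy hyL => h4 y hy (hL hyL) (fun h => h.2 hyL),
      fun y hy hyV hyL => h3 y hy ⟨hyV, hyL⟩⟩
  transit f hf f' hf' hc hc' A hA := by
    obtain ⟨h, hh, h1, h2, h3⟩ := hV.transit f hf f' hf' hc hc' A (fun a ha haV =>
      (hA a ha haV).symm)
    exact ⟨h, hh, h1, h3, h2⟩

/-- A cut at `f` is invariant as soon as `g f` is equivalent to `f`; it need not be equal to `f`. -/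
theorem invariant_lt (hV : IsLine G V le Col) (hg : g ∈ suppIn G V) {f : M} (hf : f ∈ V)
    (h1 : le (g f) f) (h2 : le f (g f)) (x : M) :
    g x ∈ {x | x ∈ V ∧ ¬ le f x} ↔ x ∈ {x | x ∈ V ∧ ¬ le f x} := by
  simp only [Set.mem_ofPred_eq, suppIn_mem hg]
  refine and_congr_right fun hx => not_congr ?_
  have hgx := (suppIn_mem hg).2 hx
  have hgf := (suppIn_mem hg).2 hf
  rw [← hV.inv_iff hg hf hx]
  exact ⟨hV.trans _ hgf _ hf _ hgx h1, hV.trans _ hf _ hgf _ hgx h2⟩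

theorem lower_lt (hV : IsLine G V le Col) {f : M} (hf : f ∈ V) :
    ∀ x ∈ {x | x ∈ V ∧ ¬ le f x}, ∀ y ∈ V, le y x → y ∈ {x | x ∈ V ∧ ¬ le f x} :=
  fun x hx y hy hyx => ⟨hy, fun h => hx.2 (hV.trans f hf y hy x hx.1 h hyx)⟩

theorem restrict_lt (hV : IsLine G V le Col) {f : M} (hf : f ∈ V) (hg : g ∈ suppIn G V)
    (h1 : le (g f) f) (h2 : le f (g f)) :
    ∃ g' ∈ suppIn G {x | x ∈ V ∧ ¬ le f x}, ∀ x ∈ {x | x ∈ V ∧ ¬ le f x}, g' x = g x :=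
  hV.glue _ (fun _ hx => hx.1) (hV.lower_lt hf) g hg (hV.invariant_lt hg hf h1 h2)

/-- Initial segments of lines are lines. -/
theorem sub (hV : IsLine G V le Col) {f : M} (hf : f ∈ V) :
    IsLine G {x | x ∈ V ∧ ¬ le f x} le Col := by
  classical
  have hsub : {x | x ∈ V ∧ ¬ le f x} ⊆ V := fun _ hx => hx.1
  have low : ∀ L ⊆ {x | x ∈ V ∧ ¬ le f x}, (∀ x ∈ L, ∀ y ∈ {x | x ∈ V ∧ ¬ le f x}, le y x → y ∈ L) →
      ∀ x ∈ L, ∀ y ∈ V, le y x → y ∈ L := fun L hL hlow x hx y hy hyx =>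
    hlow x hx y (hV.lower_lt hf x (hL hx) y hy hyx) hyx
  have ffix : ∀ g ∈ suppIn G {x | x ∈ V ∧ ¬ le f x}, g f = f := fun g hg =>
    hg.2 f fun h => h.2 (hV.refl hf)
  refine ⟨fun x hx y hy => hV.total x hx.1 y hy.1,
    fun x hx y hy z hz => hV.trans x hx.1 y hy.1 z hz.1,
    fun g hg x hx y hy => hV.inv g (suppIn_mono hsub hg) x hx.1 y hy.1,
    fun L hL hlow g hg => hV.glue L (hL.trans hsub) (low L hL hlow) g (suppIn_mono hsub hg), ?_, ?_⟩
  · intro g hg L hL hlow hgL Y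
    -- With `f` in the finite set, the marker falls below `f` and the new element still fixes `f`,
    -- so it can be cut off at `f`.
    obtain ⟨k, hk, m, hm, hc, h1, h2, h3, h4⟩ := hV.insert g (suppIn_mono hsub hg) L (hL.trans hsub)
      (low L hL hlow) hgL (Insert.insert f Y)
    have kf : k f = f := by rw [h1 f (by simp), ffix g hg]
    have hmV : m ∈ {x | x ∈ V ∧ ¬ le f x} :=
      ⟨hm, h4 f (by simp) hf fun h => (hL h).2 (hV.refl hf)⟩
    obtain ⟨k', hk', e⟩ := hV.restrict_lt hf hk (by rw [kf]; exact hV.refl hf)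
      (by rw [kf]; exact hV.refl hf)
    refine ⟨k', hk', m, hmV, hc, fun y hy => ?_, by rw [e m hmV, h2],
      fun y hy => h3 y (by simp [hy]), fun y hy hyV => h4 y (by simp [hy]) hyV.1⟩
    by_cases hyV : y ∈ {x | x ∈ V ∧ ¬ le f x}
    · rw [e y hyV, h1 y (by simp [hy])]
    · rw [hk'.2 y hyV, hg.2 y hyV]
  · intro m hm m' hm' hc hc' A hA
    obtain ⟨h, hh, h1, h2⟩ := hV.transit m hm.1 m' hm'.1 hc hc' (Insert.insert f A) (fun a ha haV => by
      by_cases haf : le f a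
      · exact Or.inr ⟨hV.not_le_of_not_of_le hm.1 hf haV hm.2 haf,
          hV.not_le_of_not_of_le hm'.1 hf haV hm'.2 haf⟩
      · rcases Finset.mem_insert.1 ha with rfl | ha
        · exact absurd (hV.refl hf) haf
        · exact hA a ha ⟨haV, haf⟩)
    have kf : h f = f := h1 f (by simp)
    obtain ⟨k', hk', e⟩ := hV.restrict_lt hf hh (by rw [kf]; exact hV.refl hf)
      (by rw [kf]; exact hV.refl hf)
    refine ⟨k', hk', fun a ha => ?_, by rwa [e m hm]⟩
    by_cases haV : a ∈ {x | x ∈ V ∧ ¬ le f x}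
    · rw [e a haV, h1 a (by simp [ha])]
    · rw [hk'.2 a haV]

/-- Amalgamation below `L` of `g₁` and a conjugate of `g₂`. -/
theorem absorb (hV : IsLine G V le Col) {g₁ g₂ : Equiv.Perm M} (hg₁ : g₁ ∈ suppIn G V)
    (hg₂ : g₂ ∈ suppIn G V) {Z : Finset M} (hZ : ∀ z ∈ Z, g₁ z = g₂ z) {L : Set M} (hL : L ⊆ V)
    (hlow : ∀ x ∈ L, ∀ y ∈ V, le y x → y ∈ L) (hgL : ∀ x, g₁ x ∈ L ↔ x ∈ L) (hZL : ∀ z ∈ Z, z ∉ L)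
    (Y₁ Y₂ : Finset M) : ∃ g ∈ suppIn G V, ∃ h ∈ suppIn G V,
      (∀ z ∈ Z, h z = z ∧ h (g₁ z) = g₁ z) ∧ (∀ z ∈ Z, g z = g₁ z) ∧
        (∀ y ∈ Y₁, y ∈ L → g y = g₁ y) ∧ ∀ y ∈ Y₂, g (h y) = h (g₂ y) := by
  classical
  -- The marker `f₁` of `g₁` sits at the cut `L`, hence above the part of `Y₁` in `L` and below `Z`.
  -- The marker `f₂` of `g₂`, inserted at the empty cut, lies below the points of `Y₂` and `Z` on
  -- the line. So the two markers have the same position relative to `Z` and its image.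
  obtain ⟨k₁, hk₁, f₁, hf₁, hc₁, a1, a2, a3, a4⟩ := hV.insert g₁ hg₁ L hL hlow hgL
    (Y₁ ∪ (Z ∪ Z.image g₁))
  obtain ⟨k₂, hk₂, f₂, hf₂, hc₂, b1, b2, b3, b4⟩ := hV.insert g₂ hg₂ ∅ (Set.empty_subset _)
    (fun x hx => absurd hx (Set.notMem_empty _)) (fun x => by simp) (Y₂ ∪ (Z ∪ Z.image g₁))
  obtain ⟨h, hh, h1, h2, h3⟩ := hV.transit f₂ hf₂ f₁ hf₁ hc₂ hc₁ (Z ∪ Z.image g₁)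
    (fun a ha haV => by
      refine Or.inr ⟨b4 a (Finset.mem_union_right _ ha) haV (Set.notMem_empty _),
        a4 a (Finset.mem_union_right _ ha) haV ?_⟩
      rcases Finset.mem_union.1 ha with ha | ha
      · exact hZL a ha
      · obtain ⟨z, hz, rfl⟩ := Finset.mem_image.1 ha
        rw [hgL]; exact hZL z hz)
  have hz1 : ∀ z ∈ Z, h z = z := fun z hz => h1 z (by simp [hz])
  have hz2 : ∀ z ∈ Z, h (g₁ z) = g₁ z := fun z hz =>
    h1 _ (Finset.mem_union_right _ (Finset.mem_image_of_mem _ hz))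
  -- This conjugate moves `f₁` only within its class, because `h f₂` is equivalent to `f₁`; hence it
  -- can be cut at `f₁`.
  set k := h * k₂ * h⁻¹ with hk
  have hkV : k ∈ suppIn G V := (suppIn G V).mul_mem ((suppIn G V).mul_mem hh hk₂)
    ((suppIn G V).inv_mem hh)
  have hkh : ∀ x, k (h x) = h (k₂ x) := fun x => by simp [hk]
  have hhf := (suppIn_mem hh).2 hf₂
  have khf : k (h f₂) = h f₂ := by rw [hkh, b2]
  have kf : le (k f₁) f₁ ∧ le f₁ (k f₁) := by
    have hkf := (suppIn_mem hkV).2 hf₁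
    have e1 := (hV.inv_iff hkV hhf hf₁).2 h2
    have e2 := (hV.inv_iff hkV hf₁ hhf).2 h3
    rw [khf] at e1 e2
    exact ⟨hV.trans _ hkf _ hhf _ hf₁ e2 h2, hV.trans _ hf₁ _ hhf _ hkf h3 e1⟩
  obtain ⟨a, ha, ea⟩ := hV.restrict_lt hf₁ hk₁ (by rw [a2]; exact hV.refl hf₁)
    (by rw [a2]; exact hV.refl hf₁)
  obtain ⟨b, hb, eb⟩ := hV.restrict_lt hf₁ hkV kf.1 kf.2
  have hsub : {x | x ∈ V ∧ ¬ le f₁ x} ⊆ V := fun _ hx => hx.1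
  have hb' := (suppIn G _).inv_mem hb
  -- The result acts as `k₁` below `f₁` and as `k` elsewhere: `b⁻¹` cancels `k` below `f₁`, and `a`
  -- inserts `k₁`.
  have gin : ∀ x ∈ {x | x ∈ V ∧ ¬ le f₁ x}, (k * (b⁻¹ * a)) x = k₁ x := fun x hx => by
    have h1 : b⁻¹ (a x) ∈ {x | x ∈ V ∧ ¬ le f₁ x} :=
      (suppIn_mem hb').2 ((suppIn_mem ha).2 hx)
    change k (b⁻¹ (a x)) = _
    rw [← eb _ h1, ← Equiv.Perm.mul_apply, mul_inv_cancel, Equiv.Perm.one_apply, ea x hx]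
  have gout : ∀ x, x ∉ {x | x ∈ V ∧ ¬ le f₁ x} → (k * (b⁻¹ * a)) x = k x := fun x hx => by
    change k (b⁻¹ (a x)) = _
    rw [ha.2 x hx, hb'.2 x hx]
  refine ⟨k * (b⁻¹ * a), (suppIn G V).mul_mem hkV ((suppIn G V).mul_mem (suppIn_mono hsub hb')
    (suppIn_mono hsub ha)), h, hh, fun z hz => ⟨hz1 z hz, hz2 z hz⟩, fun z hz => ?_,
    fun y hy hyL => ?_, fun y hy => ?_⟩
  · have hz' : z ∉ {x | x ∈ V ∧ ¬ le f₁ x} := fun hzV =>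
      hzV.2 (hV.le_of_not hzV.1 hf₁ (a4 z (by simp [hz]) hzV.1 (hZL z hz)))
    rw [gout z hz']
    conv_lhs => rw [← hz1 z hz]
    rw [hkh, b1 z (by simp [hz]), ← hZ z hz, hz2 z hz]
  · rw [gin y ⟨hL hyL, a3 y (by simp [hy]) hyL⟩, a1 y (by simp [hy])]
  · rw [gout, hkh, b1 y (by simp [hy])]
    rintro ⟨hyV, hy'⟩
    rw [suppIn_mem hh] at hyV
    have h4 := hV.le_of_not hyV hf₂ (b4 y (by simp [hy]) hyV (Set.notMem_empty _))
    exact hy' (hV.trans _ hf₁ _ hhf _ ((suppIn_mem hh).2 hyV) h3 ((hV.inv_iff hh hf₂ hyV).2 h4))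

/-- Any two automorphisms of a line can be amalgamated. -/
theorem isAmalgBase_empty (hV : IsLine G V le Col) (g₀ : Equiv.Perm M) :
    IsAmalgBase G V ∅ g₀ := by
  intro g₁ hg₁ g₂ hg₂ _ _ Y₁ Y₂
  obtain ⟨g, hg, h, hh, -, -, h1, h2⟩ := hV.absorb hg₁ hg₂ (Z := ∅) (by simp) subset_rfl
    (fun x _ y hy _ => hy) (fun x => suppIn_mem hg₁) (by simp) Y₁ Y₂
  refine ⟨g, hg, h, hh, by simp, fun y hy => ?_, h2⟩
  by_cases hyV : y ∈ V
  · exact h1 y hy hyV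
  · rw [hg.2 y hyV, hg₁.2 y hyV]

end IsLine

end Amalg

/-! ### Splitting of supports, and conjugation along an orbit. -/

section Amalg

variable {M : Type v} {G : Subgroup (Equiv.Perm M)} {V : Set M} {g : Equiv.Perm M}

theorem inv_apply_apply (g : Equiv.Perm M) (x : M) : g⁻¹ (g x) = x := by simp

theorem apply_inv_apply (g : Equiv.Perm M) (x : M) : g (g⁻¹ x) = x := by simp

theorem mul_apply_of_mem_left {V₁ V₂ : Set M} (disj : ∀ x ∈ V₁, x ∉ V₂) {b : Equiv.Perm M}
    (a : Equiv.Perm M) (hb : b ∈ suppIn G V₂) {x : M} (hx : x ∈ V₁) : (a * b) x = a x := by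
  rw [Equiv.Perm.mul_apply, hb.2 x (disj x hx)]

theorem mul_apply_of_notMem_left {V₁ V₂ : Set M} (disj : ∀ x ∈ V₁, x ∉ V₂) {a b : Equiv.Perm M}
    (ha : a ∈ suppIn G V₁) (hb : b ∈ suppIn G V₂) {x : M} (hx : x ∉ V₁) : (a * b) x = b x := by
  rw [Equiv.Perm.mul_apply]
  refine ha.2 _ fun h => ?_
  by_cases hx2 : x ∈ V₂
  · exact disj _ h ((suppIn_mem hb).2 hx2)
  · rw [hb.2 x hx2] at h; exact hx h

theorem exists_mul_of_restrict {V₁ V₂ : Set M} (hV : ∀ x ∈ V, x ∈ V₁ ∨ x ∈ V₂)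
    {a : Equiv.Perm M} (hg : g ∈ suppIn G V) (ha : a ∈ suppIn G V₁)
    (hag : ∀ x ∈ V₁, a x = g x) : ∃ a ∈ suppIn G V₁, ∃ b ∈ suppIn G V₂, g = a * b := by
  refine ⟨a, ha, a⁻¹ * g, ⟨G.mul_mem (G.inv_mem ha.1) hg.1, fun x hx => ?_⟩, by group⟩
  rw [Equiv.Perm.mul_apply, Equiv.Perm.inv_eq_iff_eq]
  by_cases h1 : x ∈ V₁
  · exact (hag x h1).symm
  · rw [ha.2 x h1, hg.2 x fun h => (hV x h).elim h1 hx]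

theorem Resolvable.union {V₁ V₂ : Set M} {Y : Finset M} (h₁ : Resolvable G V₁ g Y)
    (h₂ : Resolvable G V₂ g Y) (hV₁ : V₁ ⊆ V) (hV₂ : V₂ ⊆ V) (hV : ∀ x ∈ V, x ∈ V₁ ∨ x ∈ V₂)
    (disj : ∀ x ∈ V₁, x ∉ V₂)
    (split : ∀ u ∈ suppIn G V, (∀ y ∈ Y, y ∈ V → u y = g y) →
      ∃ a ∈ suppIn G V₁, ∃ b ∈ suppIn G V₂, u = a * b) : Resolvable G V g Y := by
  classical
  obtain ⟨k₁, hk₁, D₁, hD₁, e₁, b₁⟩ := h₁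
  obtain ⟨k₂, hk₂, D₂, hD₂, e₂, b₂⟩ := h₂
  have key : ∀ y ∈ Y, y ∈ V → y ∈ D₁ ∪ D₂ ∧ (k₁ * k₂) y = g y := fun y hy hyV => by
    by_cases h1 : y ∈ V₁
    · rw [mul_apply_of_mem_left disj k₁ hk₂ h1]
      exact ⟨Finset.mem_union_left _ (e₁ y hy h1).1, (e₁ y hy h1).2⟩
    · rw [mul_apply_of_notMem_left disj hk₁ hk₂ h1]
      have h2 := (hV y hyV).resolve_left h1
      exact ⟨Finset.mem_union_right _ (e₂ y hy h2).1, (e₂ y hy h2).2⟩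
  refine ⟨k₁ * k₂, (suppIn G V).mul_mem (suppIn_mono hV₁ hk₁) (suppIn_mono hV₂ hk₂), D₁ ∪ D₂,
    fun d hd => (Finset.mem_union.1 hd).elim (fun h => hV₁ (hD₁ d h)) fun h => hV₂ (hD₂ d h),
    key, b₁.union b₂ hk₁ hk₂ hD₁ hD₂ hV₁ hV₂ disj fun u hu hux => split u hu fun y hy hyV => ?_⟩
  rw [hux y (key y hy hyV).1, (key y hy hyV).2]

namespace IsLine

variable {le : M → M → Prop} {Col : Set M}

theorem pow_le (hV : IsLine G V le Col) (hg : g ∈ suppIn G V) {y : M} (hy : y ∈ V)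
    (h : le y (g y)) (n k : ℕ) : le ((g ^ n) y) ((g ^ (n + k)) y) := by
  have hp : ∀ n : ℕ, g ^ n ∈ suppIn G V := fun n => (suppIn G V).pow_mem hg n
  have hpy : ∀ n : ℕ, (g ^ n) y ∈ V := fun n => (suppIn_mem (hp n)).2 hy
  induction k with
  | zero => exact hV.refl (hpy n)
  | succ k ih =>
    refine hV.trans _ (hpy _) _ (hpy _) _ (hpy _) ih ?_
    rw [← add_assoc, pow_succ, Equiv.Perm.mul_apply]
    exact hV.inv _ (hp _) _ hy _ ((suppIn_mem hg).2 hy) h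

theorem le_inv (hV : IsLine G V le Col) (hg : g ∈ suppIn G V) {x y : M} (hx : x ∈ V) (hy : y ∈ V) :
    le (g x) y ↔ le x (g⁻¹ y) := by
  have hg' := (suppIn G V).inv_mem hg
  rw [← hV.inv_iff hg' ((suppIn_mem hg).2 hx) hy]
  simp

/-- The images of a cut under two elements which agree on a final segment below the cut. -/
theorem le_map_iff (hV : IsLine G V le Col) {g₁ g₂ : Equiv.Perm M} (hg₁ : g₁ ∈ suppIn G V)
    (hg₂ : g₂ ∈ suppIn G V) {l m : M} (hl : l ∈ V) (hm : m ∈ V) (hlm : le l m) (e : g₂ l = g₁ l)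
    (ag : ∀ x ∈ V, le l x → ¬ le m x → g₂ x = g₁ x) {x : M} (hx : x ∈ V) :
    le (g₁ m) (g₂ x) ↔ le m x := by
  have h1 := (suppIn_mem hg₁).2 hm
  have h2 := (suppIn_mem hg₂).2 hx
  have h3 := (suppIn_mem hg₁).2 hl
  constructor
  · intro h
    by_contra hn
    by_cases hlx : le l x
    · rw [ag x hx hlx hn, hV.inv_iff hg₁ hm hx] at h
      exact hn h
    · have h4 : le (g₁ l) (g₂ x) := hV.trans _ h3 _ h1 _ h2 ((hV.inv_iff hg₁ hl hm).2 hlm) h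
      rw [← e, hV.inv_iff hg₂ hl hx] at h4
      exact hlx h4
  · intro h
    by_contra hn
    have hg₁' := (suppIn G V).inv_mem hg₁
    set z := g₁⁻¹ (g₂ x) with hz
    have hzV : z ∈ V := (suppIn_mem hg₁').2 h2
    have hgz : g₁ z = g₂ x := by simp [hz]
    rw [← hgz, hV.inv_iff hg₁ hm hzV] at hn
    have hlz : le l z := by
      rw [← hV.inv_iff hg₁ hl hzV, hgz, ← e, hV.inv_iff hg₂ hl hx]
      exact hV.trans _ hl _ hm _ hx hlm h
    rw [← ag z hzV hlz hn] at hgz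
    rw [g₂.injective hgz] at hn
    exact hn h

/-- A conjugate of `g₂` agrees with `g₁` on a long segment above a point. -/
theorem exists_conj_above (hV : IsLine G V le Col) {g₁ g₂ : Equiv.Perm M} (hg₁ : g₁ ∈ suppIn G V)
    (hg₂ : g₂ ∈ suppIn G V) {D : Finset M} (hD : ∀ d ∈ D, d ∈ V) (e : ∀ d ∈ D, g₂ d = g₁ d)
    {l : M} (hl : l ∈ D) (hlg : ¬ le (g₁ l) l)
    (hT : ∀ a ∈ D, le (g₁ l) a → ∃ d ∈ D, g₁ d = a) (K : ℕ) :
    ∃ h ∈ suppIn G V, (∀ x ∈ V, ¬ le (g₁ l) x → h x = x) ∧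
      (∀ d ∈ D, h d = d ∧ h (g₁ d) = g₁ d) ∧
      ∀ x ∈ V, le l x → ¬ le ((g₁ ^ K) l) x → (h * g₂ * h⁻¹) x = g₁ x := by
  have hlV := hD l hl
  have hgl := (suppIn_mem hg₁).2 hlV
  have hll := hV.le_of_not hgl hlV hlg
  induction K with
  | zero => exact ⟨1, one_mem _, fun _ _ _ => rfl, fun _ _ => ⟨rfl, rfl⟩, fun x _ h1 h2 => absurd h1 h2⟩
  | succ K ih =>
    obtain ⟨h, hh, i1, i2, i3⟩ := ih
    have hpl : (g₁ ^ K) l ∈ V := (suppIn_mem ((suppIn G V).pow_mem hg₁ K)).2 hlV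
    have hpl' : (g₁ ^ (K + 1)) l ∈ V := (suppIn_mem ((suppIn G V).pow_mem hg₁ (K + 1))).2 hlV
    have hps : (g₁ ^ (K + 1)) l = g₁ ((g₁ ^ K) l) := by rw [pow_succ', Equiv.Perm.mul_apply]
    set c := h * g₂ * h⁻¹ with hc
    have hcV : c ∈ suppIn G V := mul_mem (mul_mem hh hg₂) (inv_mem hh)
    have hcD : ∀ d ∈ D, c d = g₁ d := fun d hd => by
      have h1 : h⁻¹ d = d := by rw [Equiv.Perm.inv_eq_iff_eq, (i2 d hd).1]
      change h (g₂ (h⁻¹ d)) = _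
      rw [h1, e d hd, (i2 d hd).2]
    have hmono : le l ((g₁ ^ K) l) := by simpa using hV.pow_le hg₁ hlV hll 0 K
    have hcut := fun x hx => hV.le_map_iff hg₁ hcV hlV hpl hmono (hcD l hl) i3 (x := x) hx
    have hci := (suppIn G V).inv_mem hcV
    -- Agreement is prolonged by one fundamental segment. Both `c` and `g₁` carry the cut at `(g₁ ^
    -- K) l` to the cut at `(g₁ ^ (K + 1)) l`, so `g₁ * c⁻¹` preserves the latter. Its restriction
    -- `k` to the upper part corrects the values of `c` between the two cuts and leaves the
    -- arguments there alone.
    obtain ⟨k, hk, hk'⟩ := hV.dual.glue {x | x ∈ V ∧ le ((g₁ ^ (K + 1)) l) x} (fun _ hx => hx.1)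
      (fun x hx y hy hxy => ⟨hy, hV.trans _ hpl' _ hx.1 _ hy hx.2 hxy⟩) (g₁ * c⁻¹)
      (mul_mem hg₁ hci) (fun x => by
        simp only [Set.mem_ofPred_eq, suppIn_mem (mul_mem hg₁ hci)]
        refine and_congr_right fun hx => ?_
        have hx' := (suppIn_mem hci).2 hx
        rw [hps, Equiv.Perm.mul_apply, hV.inv_iff hg₁ hpl hx', ← hcut _ hx',
          ← Equiv.Perm.mul_apply c, mul_inv_cancel, Equiv.Perm.one_apply])
    have hkV : k ∈ suppIn G V := suppIn_mono (fun _ hx => hx.1) hk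
    have hgpl : le (g₁ l) ((g₁ ^ (K + 1)) l) := by
      have := hV.pow_le hg₁ hlV hll 1 K
      rwa [add_comm 1 K, pow_one] at this
    have hkfix : ∀ d ∈ D, k (g₁ d) = g₁ d := fun d hd => by
      by_cases hU : g₁ d ∈ {x | x ∈ V ∧ le ((g₁ ^ (K + 1)) l) x}
      · rw [hk' _ hU, Equiv.Perm.mul_apply]
        congr 1
        rw [Equiv.Perm.inv_eq_iff_eq, hcD d hd]
      · exact hk.2 _ hU
    refine ⟨k * h, mul_mem hkV hh, fun x hx hxl => ?_, fun d hd => ⟨?_, ?_⟩, fun x hx h1 h2 => ?_⟩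
    · rw [Equiv.Perm.mul_apply, i1 x hx hxl]
      exact hk.2 x fun h => hxl (hV.trans _ hgl _ hpl' _ hx hgpl h.2)
    · rw [Equiv.Perm.mul_apply, (i2 d hd).1]
      by_cases hU : d ∈ {x | x ∈ V ∧ le ((g₁ ^ (K + 1)) l) x}
      · obtain ⟨d', hd', rfl⟩ := hT d hd (hV.trans _ hgl _ hpl' _ hU.1 hgpl hU.2)
        exact hkfix d' hd'
      · exact hk.2 _ hU
    · rw [Equiv.Perm.mul_apply, (i2 d hd).2, hkfix d hd]
    · have h3 : k⁻¹ x = x := by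
        rw [Equiv.Perm.inv_eq_iff_eq]
        exact (hk.2 x fun h => h2 h.2).symm
      have h4 : (k * h * g₂ * (k * h)⁻¹) x = k (c (k⁻¹ x)) := by
        simp [hc, mul_inv_rev]
      rw [h4, h3]
      by_cases h5 : le ((g₁ ^ K) l) x
      · have hU : c x ∈ {x | x ∈ V ∧ le ((g₁ ^ (K + 1)) l) x} := by
          refine ⟨(suppIn_mem hcV).2 hx, ?_⟩
          rw [hps, hcut x hx]; exact h5
        rw [hk' _ hU]; simp
      · rw [i3 x hx h1 h5]
        refine hk.2 _ fun h => h5 ?_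
        rw [← hV.inv_iff hg₁ hpl hx, ← hps]; exact h.2

/-- A conjugate of `g₂` agrees with `g₁` on a long segment around a point. -/
theorem exists_conj_around (hV : IsLine G V le Col) {g₁ g₂ : Equiv.Perm M} (hg₁ : g₁ ∈ suppIn G V)
    (hg₂ : g₂ ∈ suppIn G V) {D : Finset M} (hD : ∀ d ∈ D, d ∈ V) (e : ∀ d ∈ D, g₂ d = g₁ d)
    {l : M} (hl : l ∈ D) (hlg : ¬ le (g₁ l) l)
    (hT : ∀ a ∈ D, le (g₁ l) a → ∃ d ∈ D, g₁ d = a) (hB : ∀ d ∈ D, le (g₁ d) l → g₁ d ∈ D) (K : ℕ) :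
    ∃ h ∈ suppIn G V, (∀ d ∈ D, h d = d ∧ h (g₁ d) = g₁ d) ∧
      ∀ x ∈ V, ¬ le x ((g₁⁻¹ ^ K) l) → ¬ le ((g₁ ^ K) l) x → (h * g₂ * h⁻¹) x = g₁ x := by
  classical
  have hlV := hD l hl
  have hgl := (suppIn_mem hg₁).2 hlV
  obtain ⟨h, hh, i1, i2, i3⟩ := hV.exists_conj_above hg₁ hg₂ hD e hl hlg hT K
  set c := h * g₂ * h⁻¹ with hc
  have hcV : c ∈ suppIn G V := mul_mem (mul_mem hh hg₂) (inv_mem hh)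
  have hcD : ∀ d ∈ D, c d = g₁ d := fun d hd => by
    have h1 : h⁻¹ d = d := by rw [Equiv.Perm.inv_eq_iff_eq, (i2 d hd).1]
    change h (g₂ (h⁻¹ d)) = _
    rw [h1, e d hd, (i2 d hd).2]
  -- The downward half is the upward half for the inverses in the reversed order, starting at `g₁ l`
  -- with `D` replaced by its image. The resulting `k` fixes all points of the line above the class
  -- of `l`, so the agreement already gained there is kept.
  have hdual := hV.dual.exists_conj_above (D := D.image g₁) (l := g₁ l)
    (inv_mem hg₁) (inv_mem hcV) (fun a ha => by
      obtain ⟨d, hd, rfl⟩ := Finset.mem_image.1 ha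
      exact (suppIn_mem hg₁).2 (hD d hd)) (fun a ha => by
      obtain ⟨d, hd, rfl⟩ := Finset.mem_image.1 ha
      rw [Equiv.Perm.inv_eq_iff_eq, inv_apply_apply, hcD d hd])
    (Finset.mem_image_of_mem _ hl) (by simpa using hlg) (fun a ha hal => by
      obtain ⟨d, hd, rfl⟩ := Finset.mem_image.1 ha
      rw [inv_apply_apply] at hal
      exact ⟨_, Finset.mem_image_of_mem _ (hB d hd hal), by simp⟩) K
  obtain ⟨k, hk, j1, j2, j3⟩ := hdual
  rw [inv_apply_apply] at j1
  refine ⟨k * h, mul_mem hk hh, fun d hd => ?_, fun x hx h1 h2 => ?_⟩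
  · have := j2 _ (Finset.mem_image_of_mem _ hd)
    rw [inv_apply_apply] at this
    rw [Equiv.Perm.mul_apply, Equiv.Perm.mul_apply, (i2 d hd).1, (i2 d hd).2]
    exact this.symm
  · have h4 : k * h * g₂ * (k * h)⁻¹ = k * c * k⁻¹ := by
      simp [hc, mul_inv_rev, mul_assoc]
    rw [h4]
    by_cases hxl : le x l
    · have := j3 (g₁ x) ((suppIn_mem hg₁).2 hx) ((hV.inv_iff hg₁ hx hlV).2 hxl) (by
        rw [← Equiv.Perm.mul_apply, (Commute.inv_left_iff.2 (Commute.refl g₁)).pow_left K,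
          Equiv.Perm.mul_apply, hV.inv_iff hg₁ hx]
        · exact h1
        · exact (suppIn_mem ((suppIn G V).pow_mem (inv_mem hg₁) K)).2 hlV)
      rw [inv_apply_apply] at this
      have h5 : k * c⁻¹ * k⁻¹ = (k * c * k⁻¹)⁻¹ := by group
      rw [h5, Equiv.Perm.inv_eq_iff_eq] at this
      exact this.symm
    · have h5 : k⁻¹ x = x := by
        rw [Equiv.Perm.inv_eq_iff_eq, j1 x hx hxl]
      change k (c (k⁻¹ x)) = _
      have hlx := hV.le_of_not hx hlV hxl
      rw [h5, i3 x hx hlx h2]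
      refine j1 _ ((suppIn_mem hg₁).2 hx) fun h => ?_
      exact hlg (hV.trans _ hgl _ ((suppIn_mem hg₁).2 hx) _ hlV ((hV.inv_iff hg₁ hlV hx).2 hlx) h)

/-- The points of a line which are below the orbit of `y`. -/
def below (V : Set M) (le : M → M → Prop) (g : Equiv.Perm M) (y : M) : Set M :=
  {x | x ∈ V ∧ ∀ k : ℕ, le x ((g⁻¹ ^ k) y)}

theorem inv_pow_mem (hg : g ∈ suppIn G V) {y : M} (hy : y ∈ V) (k : ℕ) : (g⁻¹ ^ k) y ∈ V :=
  (suppIn_mem ((suppIn G V).pow_mem (inv_mem hg) k)).2 hy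

theorem below_lower (hV : IsLine G V le Col) (hg : g ∈ suppIn G V) {y : M} (hy : y ∈ V) :
    ∀ x ∈ below V le g y, ∀ z ∈ V, le z x → z ∈ below V le g y :=
  fun _ hx _ hz hzx => ⟨hz, fun k => hV.trans _ hz _ hx.1 _ (inv_pow_mem hg hy k) hzx (hx.2 k)⟩

theorem inv_pow_le (hV : IsLine G V le Col) (hg : g ∈ suppIn G V) {y : M} (hy : y ∈ V)
    (h : le y (g y)) (n k : ℕ) : le ((g⁻¹ ^ (n + k)) y) ((g⁻¹ ^ n) y) := by
  refine hV.dual.pow_le (inv_mem hg) hy ?_ n k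
  rwa [← hV.inv_iff hg ((suppIn_mem (inv_mem hg)).2 hy) hy, apply_inv_apply]

theorem below_invariant (hV : IsLine G V le Col) (hg : g ∈ suppIn G V) {y : M} (hy : y ∈ V)
    (h : le y (g y)) (x : M) : g x ∈ below V le g y ↔ x ∈ below V le g y := by
  simp only [below, Set.mem_ofPred_eq, suppIn_mem hg]
  refine and_congr_right fun hx => ?_
  have key : ∀ k : ℕ, le (g x) ((g⁻¹ ^ k) y) ↔ le x ((g⁻¹ ^ (k + 1)) y) := fun k => by
    rw [hV.le_inv hg hx (inv_pow_mem hg hy k), pow_succ', Equiv.Perm.mul_apply]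
  simp only [key]
  refine ⟨fun h' k => ?_, fun h' k => h' _⟩
  exact hV.trans _ hx _ (inv_pow_mem hg hy _) _ (inv_pow_mem hg hy _) (h' k)
    (hV.inv_pow_le hg hy h k 1)

end IsLine

end Amalg

/-! ### Bases consisting of pieces of moving orbits. -/

section Amalg

variable {M : Type v} {G : Subgroup (Equiv.Perm M)} {V : Set M} {g : Equiv.Perm M}

namespace IsLine

variable {le : M → M → Prop} {Col : Set M}

/-- Descent inside a finite set, measured by the number of its points below `d`. -/
theorem no_descent (hV : IsLine G V le Col) {D : Finset M} (hD : ∀ d ∈ D, d ∈ V) {P : M → Prop}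
    (h : ∀ d ∈ D, P d → ∃ d' ∈ D, P d' ∧ ¬ le d d') : ∀ d ∈ D, ¬ P d := by
  classical
  intro d hd hP
  obtain ⟨m, hm, hm'⟩ := Finset.exists_min_image (D.filter P)
    (fun d => (D.filter fun x => le x d).card) ⟨d, by simp [hd, hP]⟩
  rw [Finset.mem_filter] at hm
  obtain ⟨d', hd', hP', hlt⟩ := h m hm.1 hm.2
  have h1 := hm' d' (by simp [hd', hP'])
  refine absurd h1 (not_le.2 (Finset.card_lt_card ⟨fun x hx => ?_, fun hsub => ?_⟩))
  · rw [Finset.mem_filter] at hx ⊢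
    exact ⟨hx.1, hV.trans _ (hD x hx.1) _ (hD d' hd') _ (hD m hm.1) hx.2
      (hV.le_of_not (hD m hm.1) (hD d' hd') hlt)⟩
  · have := hsub (Finset.mem_filter.2 ⟨hm.1, hV.refl (hD m hm.1)⟩)
    exact hlt (Finset.mem_filter.1 this).2

/-- A point of `D` below the whole orbit of `l` has its image in `D`, strictly higher and again
below the orbit; it would climb for ever. -/
theorem notMem_below (hV : IsLine G V le Col) (hg : g ∈ suppIn G V) {D : Finset M}
    (hD : ∀ d ∈ D, d ∈ V) {l : M} (hl : l ∈ D) (hlg : le l (g l))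
    (hB : ∀ d ∈ D, le (g d) l → g d ∈ D) (hmv : ∀ d ∈ D, ¬ le (g d) d) :
    ∀ d ∈ D, d ∉ below V le g l := by
  refine hV.dual.no_descent hD fun d hd hdL => ?_
  have h1 := (hV.below_invariant hg (hD l hl) hlg d).2 hdL
  exact ⟨g d, hB d hd (by simpa using h1.2 0), h1, hmv d hd⟩

theorem eventually_notMem (hV : IsLine G V le Col) (hg : g ∈ suppIn G V) {l : M} (hl : l ∈ V)
    (hlg : le l (g l)) {x : M} (hx : x ∈ V) (h : x ∉ below V le g l) :
    ∀ᶠ K : ℕ in Filter.atTop, ¬ le x ((g⁻¹ ^ K) l) := by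
  have : ∃ k : ℕ, ¬ le x ((g⁻¹ ^ k) l) := by
    by_contra! h'
    exact h ⟨hx, h'⟩
  obtain ⟨k, hk⟩ := this
  filter_upwards [Filter.eventually_ge_atTop k] with K hK h'
  obtain ⟨j, rfl⟩ := Nat.exists_eq_add_of_le hK
  exact hk (hV.trans _ hx _ (inv_pow_mem hg hl _) _ (inv_pow_mem hg hl _) h'
    (hV.inv_pow_le hg hl hlg k j))

/-- Finite pieces of orbits which move up everywhere are amalgamation bases. -/
theorem isAmalgBase_of_moving (hV : IsLine G V le Col) {g₀ : Equiv.Perm M}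
    {D : Finset M} (hD : ∀ d ∈ D, d ∈ V) {l : M} (hl : l ∈ D)
    (hT : ∀ a ∈ D, le (g₀ l) a → ∃ d ∈ D, g₀ d = a) (hB : ∀ d ∈ D, le (g₀ d) l → g₀ d ∈ D)
    (hmv : ∀ d ∈ D, ¬ le (g₀ d) d) : IsAmalgBase G V D g₀ := by
  classical
  intro g₁ hg₁ g₂ hg₂ e₁ e₂ Y₁ Y₂
  have hT' : ∀ a ∈ D, le (g₁ l) a → ∃ d ∈ D, g₁ d = a := fun a ha hla => by
    rw [e₁ l hl] at hla
    obtain ⟨d, hd, h⟩ := hT a ha hla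
    exact ⟨d, hd, by rw [e₁ d hd, h]⟩
  have hB' : ∀ d ∈ D, le (g₁ d) l → g₁ d ∈ D := fun d hd => by rw [e₁ d hd]; exact hB d hd
  have hmv' : ∀ d ∈ D, ¬ le (g₁ d) d := fun d hd => by rw [e₁ d hd]; exact hmv d hd
  have hlV := hD l hl
  have hgl := (suppIn_mem hg₁).2 hlV
  have hll := hV.le_of_not hgl hlV (hmv' l hl)
  have hg₁' : g₁⁻¹ ∈ suppIn G V := inv_mem hg₁
  have hll' : (fun x y => le y x) l (g₁⁻¹ l) := by
    change le (g₁⁻¹ l) l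
    rwa [← hV.inv_iff hg₁ ((suppIn_mem hg₁').2 hlV) hlV, apply_inv_apply]
  -- `L` and `U` lie below and above the whole orbit of `l`, and neither meets `D`. On the points of
  -- `Y₁` between them a conjugate of `g₂` can be made to agree with `g₁`, as a long segment of the
  -- orbit covers them. The points in `L` and `U` are dealt with by `absorb`.
  set L := below V le g₁ l with hL
  set U := below V (fun x y => le y x) g₁⁻¹ l with hU
  have hDL : ∀ d ∈ D, d ∉ L := hV.notMem_below hg₁ hD hl hll hB' hmv'
  have hU1 : ∀ x, g₁⁻¹ x ∈ U ↔ x ∈ U := hV.dual.below_invariant hg₁' hlV hll'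
  have hU2 : ∀ x, g₁ x ∈ U ↔ x ∈ U := fun x => by rw [← hU1, inv_apply_apply]
  have hUg : ∀ x ∈ U, le (g₁ l) x := fun x hx => by simpa using hx.2 1
  have hDU : ∀ d ∈ D, d ∉ U := by
    refine hV.no_descent hD fun a ha haU => ?_
    obtain ⟨d, hd, rfl⟩ := hT' a ha (hUg a haU)
    exact ⟨d, hd, (hU2 d).1 haU, hmv' d hd⟩
  set Z := D ∪ Y₁.filter fun y => y ∈ V ∧ y ∉ L ∧ y ∉ U with hZ
  have hZV : ∀ z ∈ Z, z ∈ V ∧ z ∉ L ∧ z ∉ U := fun z hz => by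
    rcases Finset.mem_union.1 hz with hz | hz
    · exact ⟨hD z hz, hDL z hz, hDU z hz⟩
    · exact (Finset.mem_filter.1 hz).2
  have ev : ∀ᶠ K : ℕ in Filter.atTop, ∀ z ∈ Z, ¬ le z ((g₁⁻¹ ^ K) l) ∧ ¬ le ((g₁ ^ K) l) z := by
    rw [Filter.eventually_all_finset]
    intro z hz
    obtain ⟨h1, h2, h3⟩ := hZV z hz
    have := hV.dual.eventually_notMem hg₁' hlV hll' h1 h3
    rw [inv_inv] at this
    exact (hV.eventually_notMem hg₁ hlV hll h1 h2).and this
  obtain ⟨K, hK⟩ := ev.exists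
  obtain ⟨h, hh, i1, i2⟩ := hV.exists_conj_around hg₁ hg₂ hD
    (fun d hd => by rw [e₁ d hd, e₂ d hd]) hl (hmv' l hl) hT' hB' K
  have hcV : h * g₂ * h⁻¹ ∈ suppIn G V := mul_mem (mul_mem hh hg₂) (inv_mem hh)
  obtain ⟨a, ha, p, hp, a1, a2, a3, a4⟩ := hV.absorb hg₁ hcV (Z := Z)
    (fun z hz => (i2 z (hZV z hz).1 (hK z hz).1 (hK z hz).2).symm) (L := L) (fun _ hx => hx.1)
    (hV.below_lower hg₁ hlV) (hV.below_invariant hg₁ hlV hll) (fun z hz => (hZV z hz).2.1) Y₁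
    (Y₂.image h)
  -- The second absorption takes place above; the points of `Y₁` in `L` join the protected set, so
  -- what was achieved there is kept.
  obtain ⟨b, hb, q, hq, b1, b2, b3, b4⟩ := hV.dual.absorb hg₁ ha
    (Z := Z ∪ Y₁.filter fun y => y ∈ L) (fun z hz => by
      rcases Finset.mem_union.1 hz with hz | hz
      · exact (a2 z hz).symm
      · exact (a3 z (Finset.mem_filter.1 hz).1 (Finset.mem_filter.1 hz).2).symm)
    (L := U) (fun _ hx => hx.1) (hV.dual.below_lower hg₁' hlV) hU2 (fun z hz => by
      rcases Finset.mem_union.1 hz with hz | hz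
      · exact (hZV z hz).2.2
      · intro hzU
        have hzL := (Finset.mem_filter.1 hz).2
        have h1 : le z l := by simpa using hzL.2 0
        exact hmv' l hl (hV.trans _ hgl _ hzL.1 _ hlV (hUg z hzU) h1)) Y₁ ((Y₂.image h).image p)
  refine ⟨b, hb, q * p * h, mul_mem (mul_mem hq hp) hh, fun d hd => ?_, fun y hy => ?_,
    fun y hy => ?_⟩
  · have hdZ : d ∈ Z := Finset.mem_union_left _ hd
    rw [← e₁ d hd]
    simp only [Equiv.Perm.mul_apply]
    rw [(i1 d hd).1, (i1 d hd).2, (a1 d hdZ).1, (a1 d hdZ).2]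
    exact b1 d (Finset.mem_union_left _ hdZ)
  · by_cases hyV : y ∈ V
    · by_cases hyL : y ∈ L
      · exact b2 y (Finset.mem_union_right _ (Finset.mem_filter.2 ⟨hy, hyL⟩))
      · by_cases hyU : y ∈ U
        · exact b3 y hy hyU
        · exact b2 y (Finset.mem_union_left _ (Finset.mem_union_right _
            (Finset.mem_filter.2 ⟨hy, hyV, hyL, hyU⟩)))
    · rw [hb.2 y hyV, hg₁.2 y hyV]
  · simp only [Equiv.Perm.mul_apply]
    have h1 := Finset.mem_image_of_mem h hy
    rw [b4 _ (Finset.mem_image_of_mem p h1), a4 _ h1]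
    simp

/-- The base consists of the points `(g ^ j) s` with `|j| ≤ n`, for `y` and the points `s` of `Y` in
`V`. As each `s` lies between `(g⁻¹ ^ n) y` and `(g ^ n) y`, its piece of orbit reaches from `y` or
below to `y` or above. This gives the closure conditions of `isAmalgBase_of_moving` with `l = y`. -/
theorem resolvable_of_hull (hV : IsLine G V le Col) (hg : g ∈ suppIn G V) {y : M} (hy : y ∈ V)
    (hyg : ¬ le (g y) y) (n : ℕ) {Y : Finset M}
    (hY : ∀ z ∈ Y, z ∈ V → ¬ le z ((g⁻¹ ^ n) y) ∧ ¬ le ((g ^ n) y) z) : Resolvable G V g Y := by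
  classical
  have hgy := (suppIn_mem hg).2 hy
  have hyy := hV.le_of_not hgy hy hyg
  set S : Finset M := Insert.insert y (Y.filter (· ∈ V)) with hS
  set D := (Finset.Icc (-(n : ℤ)) n ×ˢ S).image (fun p => (g ^ p.1) p.2) with hDdef
  have hzm : ∀ j : ℤ, g ^ j ∈ suppIn G V := fun j => zpow_mem hg j
  have hSV : ∀ s ∈ S, s ∈ V := fun s hs => by
    rcases Finset.mem_insert.1 hs with rfl | hs
    · exact hy
    · exact (Finset.mem_filter.1 hs).2
  have hzs : ∀ j : ℤ, ∀ x, g ((g ^ j) x) = (g ^ (j + 1)) x := fun j x => by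
    rw [add_comm, zpow_one_add, Equiv.Perm.mul_apply]
  have hmem : ∀ j : ℤ, -(n : ℤ) ≤ j → j ≤ n → ∀ s ∈ S, (g ^ j) s ∈ D := fun j h1 h2 s hs =>
    Finset.mem_image.2 ⟨(j, s), by simp [h1, h2, hs], rfl⟩
  have hmem' : ∀ d ∈ D, ∃ j : ℤ, -(n : ℤ) ≤ j ∧ j ≤ n ∧ ∃ s ∈ S, (g ^ j) s = d := fun d hd => by
    obtain ⟨⟨j, s⟩, h1, h2⟩ := Finset.mem_image.1 hd
    simp only [Finset.mem_product, Finset.mem_Icc] at h1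
    exact ⟨j, h1.1.1, h1.1.2, s, h1.2, h2⟩
  have hD : ∀ d ∈ D, d ∈ V := fun d hd => by
    obtain ⟨j, -, -, s, hs, rfl⟩ := hmem' d hd
    exact (suppIn_mem (hzm j)).2 (hSV s hs)
  have hnn : (g ^ n) ((g⁻¹ ^ n) y) = y := by rw [← Equiv.Perm.mul_apply, inv_pow]; simp
  have hnn' : (g⁻¹ ^ n) ((g ^ n) y) = y := by rw [← Equiv.Perm.mul_apply, inv_pow]; simp
  have hpn : g ^ n ∈ suppIn G V := pow_mem hg n
  have hpn' : g⁻¹ ^ n ∈ suppIn G V := pow_mem (inv_mem hg) n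
  have hSl : ∀ s ∈ S, le y ((g ^ n) s) ∧ le ((g⁻¹ ^ n) s) y := fun s hs => by
    rcases Finset.mem_insert.1 hs with rfl | hs
    · have h1 := hV.pow_le hg hy hyy 0 n
      have h2 := hV.inv_pow_le hg hy hyy 0 n
      rw [zero_add] at h1 h2
      exact ⟨h1, h2⟩
    · obtain ⟨h1, h2⟩ := Finset.mem_filter.1 hs
      obtain ⟨h3, h4⟩ := hY s h1 h2
      constructor
      · rw [← hnn, hV.inv_iff hpn ((suppIn_mem hpn').2 hy) h2]
        exact hV.le_of_not h2 ((suppIn_mem hpn').2 hy) h3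
      · rw [← hnn', hV.inv_iff hpn' h2 ((suppIn_mem hpn).2 hy)]
        exact hV.le_of_not ((suppIn_mem hpn).2 hy) h2 h4
  -- If `s` did not move up, then `g^n y ≤ g^(2n) s ≤ g^n s ≤ s`, although `s` does not lie above
  -- `g^n y`.
  have hSmv : ∀ s ∈ S, ¬ le (g s) s := fun s hs hsg => by
    rcases Finset.mem_insert.1 hs with rfl | hs'
    · exact hyg hsg
    · obtain ⟨h1, h2⟩ := Finset.mem_filter.1 hs'
      obtain ⟨h3, h4⟩ := hY s h1 h2
      have h5 : le ((g ^ n) s) s := by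
        have := hV.dual.pow_le hg h2 hsg 0 n
        simpa using this
      have h6 : le ((g ^ n) ((g ^ n) s)) ((g ^ n) s) := (hV.inv_iff hpn ((suppIn_mem hpn).2 h2) h2).2 h5
      have h7 := (hV.inv_iff hpn hy ((suppIn_mem hpn).2 h2)).2 (hSl s hs).1
      have ms := (suppIn_mem hpn).2 h2
      exact h4 (hV.trans _ ((suppIn_mem hpn).2 hy) _ ms _ h2
        (hV.trans _ ((suppIn_mem hpn).2 hy) _ ((suppIn_mem hpn).2 ms) _ ms h7 h6) h5)
  refine ⟨g, hg, D, hD, fun z hz hzV => ⟨?_, rfl⟩, hV.isAmalgBase_of_moving hD (l := y) ?_ ?_ ?_ ?_⟩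
  · exact hmem 0 (by simp) (by simp) z (by simp [hS, hz, hzV])
  · exact hmem 0 (by simp) (by simp) y (by simp [hS])
  · intro a ha hya
    obtain ⟨j, j1, j2, s, hs, rfl⟩ := hmem' a ha
    rcases j1.eq_or_lt with rfl | j1
    · exfalso
      have := (hSl s hs).2
      rw [zpow_neg, zpow_natCast, ← inv_pow] at hya
      exact hyg (hV.trans _ hgy _ ((suppIn_mem hpn').2 (hSV s hs)) _ hy hya this)
    · exact ⟨(g ^ (j - 1)) s, hmem _ (by omega) (by omega) s hs, by rw [hzs]; simp⟩
  · intro d hd hdy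
    obtain ⟨j, j1, j2, s, hs, rfl⟩ := hmem' d hd
    rw [hzs]
    rcases j2.eq_or_lt with rfl | j2
    · exfalso
      rw [zpow_natCast] at hdy
      have h1 := (hSl s hs).1
      have ms := (suppIn_mem hpn).2 (hSV s hs)
      exact hyg (hV.trans _ hgy _ ((suppIn_mem hg).2 ms) _ hy ((hV.inv_iff hg hy ms).2 h1) hdy)
    · exact hmem _ (by omega) (by omega) s hs
  · intro d hd
    obtain ⟨j, j1, j2, s, hs, rfl⟩ := hmem' d hd
    have : g ((g ^ j) s) = (g ^ j) (g s) := by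
      rw [hzs, zpow_add_one, Equiv.Perm.mul_apply]
    rw [this, hV.inv_iff (hzm j) ((suppIn_mem hg).2 (hSV s hs)) (hSV s hs)]
    exact hSmv s hs

/-- Since `f ∈ Y`, elements agreeing with `g` on `Y` send `f` to an equivalent point. They preserve
the three pieces and split into factors supported in them. -/
theorem resolvable_split (hV : IsLine G V le Col) {f : M} (hf : f ∈ V)
    (h1 : le (g f) f) (h2 : le f (g f)) {Y : Finset M} (hfY : f ∈ Y)
    (rl : Resolvable G {x | x ∈ V ∧ ¬ le f x} g Y)
    (re : Resolvable G {x | x ∈ V ∧ le x f ∧ le f x} g Y)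
    (ru : Resolvable G {x | x ∈ V ∧ ¬ le x f} g Y) : Resolvable G V g Y := by
  have low : Resolvable G {x | x ∈ V ∧ le x f} g Y := by
    refine rl.union re (fun x hx => ⟨hx.1, hV.le_of_not hf hx.1 hx.2⟩) (fun x hx => ⟨hx.1, hx.2.1⟩)
      (fun x hx => ?_) (fun x hx hx' => hx.2 hx'.2.2) fun u hu huY => ?_
    · by_cases h : le f x
      · exact Or.inr ⟨hx.1, hx.2, h⟩
      · exact Or.inl ⟨hx.1, h⟩
    · have huf := huY f hfY ⟨hf, hV.refl hf⟩
      have huV : u ∈ suppIn G V := suppIn_mono (fun _ hx => hx.1) hu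
      obtain ⟨a, ha, ha'⟩ := hV.restrict_lt hf huV (by rwa [huf]) (by rwa [huf])
      refine exists_mul_of_restrict (fun x hx => ?_) hu ha ha'
      by_cases h : le f x
      · exact Or.inr ⟨hx.1, hx.2, h⟩
      · exact Or.inl ⟨hx.1, h⟩
  refine ru.union low (fun x hx => hx.1) (fun x hx => hx.1) (fun x hx => ?_)
    (fun x hx hx' => hx.2 hx'.2) fun u hu huY => ?_
  · by_cases h : le x f
    · exact Or.inr ⟨hx, h⟩
    · exact Or.inl ⟨hx, h⟩
  · have huf := huY f hfY hf
    obtain ⟨a, ha, ha'⟩ := hV.dual.restrict_lt hf hu (by rwa [huf]) (by rwa [huf])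
    refine exists_mul_of_restrict (fun x hx => ?_) hu ha ha'
    by_cases h : le x f
    · exact Or.inr ⟨hx, h⟩
    · exact Or.inl ⟨hx, h⟩

/-- A fixed point whose class contains no point of `Y` may be added to `Y`. In its class only this
one fixed point has to be resolved. -/
theorem resolvable_split_marker [DecidableEq M] (hV : IsLine G V le Col)
    {f : M} (hf : f ∈ V) (hgf : g f = f) {Y : Finset M} (hfY : ∀ z ∈ Y, z ∈ V → ¬ le z f ∨ ¬ le f z)
    (rl : Resolvable G {x | x ∈ V ∧ ¬ le f x} g Y)
    (re : Resolvable G {x | x ∈ V ∧ le x f ∧ le f x} 1 {f})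
    (ru : Resolvable G {x | x ∈ V ∧ ¬ le x f} g Y) : Resolvable G V g Y := by
  have key : ∀ z ∈ Insert.insert f Y, z ∈ {x | x ∈ V ∧ le x f ∧ le f x} → z = f := fun z hz hzV => by
    rcases Finset.mem_insert.1 hz with rfl | hz
    · rfl
    · exact absurd (hfY z hz hzV.1) (by simp [hzV.2])
  refine (hV.resolvable_split hf (by rw [hgf]; exact hV.refl hf) (by rw [hgf]; exact hV.refl hf)
    (Y := Insert.insert f Y) (by simp) (rl.congr (fun z hz hzV => ?_) fun _ _ _ => rfl)
    (re.congr (fun z hz hzV => by simp [key z hz hzV]) fun z hz hzV => by simp [key z hz hzV, hgf])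
    (ru.congr (fun z hz hzV => ?_) fun _ _ _ => rfl)).congr (fun z hz _ => by simp [hz])
    fun _ _ _ => rfl
  · rcases Finset.mem_insert.1 hz with rfl | hz
    · exact absurd (hV.refl hf) hzV.2
    · exact hz
  · rcases Finset.mem_insert.1 hz with rfl | hz
    · exact absurd (hV.refl hf) hzV.2
    · exact hz

end IsLine

end Amalg

/-! ### Markers around moving orbits, and resolution in lines. -/

section Amalg

variable {M : Type v} {G : Subgroup (Equiv.Perm M)} {V : Set M} {g : Equiv.Perm M}

namespace IsLine

variable {le : M → M → Prop} {Col : Set M}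

/-- A fixed marker just below the orbit of a moving point, with respect to a finite set. -/
theorem exists_marker (hV : IsLine G V le Col) (hg : g ∈ suppIn G V) {y : M} (hy : y ∈ V)
    (hyg : ¬ le (g y) y) (Y : Finset M) : ∃ g' ∈ suppIn G V, ∃ f ∈ V, f ∈ Col ∧
      (∀ z ∈ Y, g' z = g z) ∧ g' f = f ∧ ¬ le y f ∧ (∀ z ∈ Y, z ∈ V → ¬ le z f ∨ ¬ le f z) ∧
      ∃ K : ℕ, ∀ z ∈ Y, z ∈ V → ¬ le z f → ∀ n ≥ K, ¬ le z ((g'⁻¹ ^ n) y) := by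
  classical
  have hgy := (suppIn_mem hg).2 hy
  have hyy := hV.le_of_not hgy hy hyg
  have ev : ∀ᶠ K : ℕ in Filter.atTop, ∀ z ∈ Insert.insert y Y, z ∈ V → z ∉ below V le g y →
      ¬ le z ((g⁻¹ ^ K) y) := by
    rw [Filter.eventually_all_finset]
    intro z _
    by_cases h : z ∈ V ∧ z ∉ below V le g y
    · exact (hV.eventually_notMem hg hy hyy h.1 h.2).mono fun _ h _ _ => h
    · exact Filter.Eventually.of_forall fun _ h1 h2 => absurd ⟨h1, h2⟩ h
  obtain ⟨K, hK⟩ := ev.exists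
  -- Prescribing `g'` along a piece of the backward orbit of `y` ensures that the new orbit still
  -- passes below the points of `Y` that lie above the marker.
  set Y' : Finset M := Y ∪ (Finset.range (K + 2)).image fun j => (g⁻¹ ^ j) y with hY'
  obtain ⟨k, hk, f, hf, hc, a1, a2, a3, a4⟩ := hV.insert g hg (below V le g y) (fun _ hx => hx.1)
    (hV.below_lower hg hy) (hV.below_invariant hg hy hyy) Y'
  have hmem : ∀ j < K + 2, (g⁻¹ ^ j) y ∈ Y' := fun j hj =>
    Finset.mem_union_right _ (Finset.mem_image.2 ⟨j, Finset.mem_range.2 hj, rfl⟩)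
  have hyB : y ∉ below V le g y := fun h => by
    have := h.2 1
    rw [pow_one, ← hV.le_inv hg hy hy] at this
    exact hyg this
  have hchain : ∀ j < K + 2, (k⁻¹ ^ j) y = (g⁻¹ ^ j) y := by
    intro j
    induction j with
    | zero => intro _; rfl
    | succ j ih =>
      intro hj
      rw [pow_succ', Equiv.Perm.mul_apply, ih (by omega), Equiv.Perm.inv_eq_iff_eq, a1 _ (hmem _ hj),
        pow_succ', Equiv.Perm.mul_apply, apply_inv_apply]
  have hkY : ∀ z ∈ Y, k z = g z := fun z hz => a1 z (Finset.mem_union_left _ hz)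
  refine ⟨k, hk, f, hf, hc, hkY, a2, a4 y (hmem 0 (by omega)) hy hyB, fun z hz hzV => ?_,
    K, fun z hz hzV hzf n hn => ?_⟩
  · by_cases h : z ∈ below V le g y
    · exact Or.inr (a3 z (Finset.mem_union_left _ hz) h)
    · exact Or.inl (a4 z (Finset.mem_union_left _ hz) hzV h)
  · have hzB : z ∉ below V le g y := fun h =>
      a3 z (Finset.mem_union_left _ hz) h (hV.le_of_not hzV hf hzf)
    have h1 := hK z (Finset.mem_insert_of_mem hz) hzV hzB
    rw [← hchain K (by omega)] at h1
    obtain ⟨j, rfl⟩ := Nat.exists_eq_add_of_le hn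
    have hky : k y = g y := by simpa using a1 _ (hmem 0 (by omega))
    intro h
    exact h1 (hV.trans _ hzV _ (inv_pow_mem hk hy _) _ (inv_pow_mem hk hy _) h
      (hV.inv_pow_le hk hy (by rwa [hky]) K j))

/-- In a line, each partial map restricting an automorphism extends to an amalgamation base if
this holds in the invariant classes. -/
theorem resolvable_of_moving [DecidableEq M] (hV : IsLine G V le Col) (hg : g ∈ suppIn G V) {y : M}
    (hy : y ∈ V) (hyg : ¬ le (g y) y) {Y : Finset M} (hyY : y ∈ Y)
    (hM : ∀ f ∈ V, f ∈ Col → Resolvable G {x | x ∈ V ∧ le x f ∧ le f x} 1 {f})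
    (lo : ∀ f ∈ V, ¬ le y f → ∀ k ∈ suppIn G V, k f = f → (∀ z ∈ Y, k z = g z) →
      Resolvable G {x | x ∈ V ∧ ¬ le f x} k Y)
    (up : ∀ f ∈ V, ¬ le y f → ∀ f' ∈ V, ¬ le f' y → ¬ le f' f →
      ∀ k ∈ suppIn G {x | x ∈ V ∧ ¬ le x f}, k f' = f' →
      (∀ z ∈ Y, z ∈ {x | x ∈ V ∧ ¬ le x f} → k z = g z) →
      Resolvable G {x | x ∈ {x | x ∈ V ∧ ¬ le x f} ∧ ¬ le x f'} k Y) :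
    Resolvable G V g Y := by
  obtain ⟨g₁, hg₁, f₁, hf₁, hc₁, a1, a2, a3, a4, K₁, a5⟩ := hV.exists_marker hg hy hyg Y
  refine Resolvable.congr (Y := Y) (g := g₁) ?_ (fun z hz _ => hz) fun z hz _ => (a1 z hz).symm
  refine hV.resolvable_split_marker hf₁ a2 a4 (lo f₁ hf₁ a3 g₁ hg₁ a2 a1) (hM f₁ hf₁ hc₁) ?_
  -- the part above the first marker
  set V₁ := {x | x ∈ V ∧ ¬ le x f₁} with hV₁
  have hl₁ : IsLine G V₁ le Col := (hV.dual.sub hf₁).dual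
  have hy₁ : y ∈ V₁ := ⟨hy, a3⟩
  obtain ⟨r, hr, er⟩ := hV.dual.restrict_lt hf₁ hg₁ (by rw [a2]; exact hV.refl hf₁)
    (by rw [a2]; exact hV.refl hf₁)
  change r ∈ suppIn G V₁ at hr
  change ∀ x ∈ V₁, r x = g₁ x at er
  have hry : r y = g y := by rw [er y hy₁, a1 y hyY]
  set n := K₁ + 1 with hn
  set C : Finset M := Y ∪ (Finset.range (K₁ + 1)).image fun j => (r⁻¹ ^ j) y with hC
  have hri : r⁻¹ ∈ suppIn G V₁ := inv_mem hr
  -- The upper marker is a lower marker in the reversed order, where `r⁻¹` moves `y` up. The set `C`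
  -- preserves the piece of the backward orbit on which the estimate for the first marker depends.
  obtain ⟨q, hq, f₂, hf₂, hc₂, b1, b2, b3, b4, K₂, b5⟩ := hl₁.dual.exists_marker hri hy₁ (by
    rwa [← hl₁.le_inv hr hy₁ hy₁, hry]) (C ∪ C.image r)
  have hqi : q⁻¹ ∈ suppIn G V₁ := inv_mem hq
  have hqr : ∀ z ∈ C, q⁻¹ z = r z := fun z hz => by
    rw [Equiv.Perm.inv_eq_iff_eq, b1 _ (Finset.mem_union_right _ (Finset.mem_image_of_mem _ hz)),
      inv_apply_apply]
  have hYC : ∀ z ∈ Y, z ∈ C := fun z hz => Finset.mem_union_left _ hz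
  have hqf : q⁻¹ f₂ = f₂ := by rw [Equiv.Perm.inv_eq_iff_eq, b2]
  refine Resolvable.congr (Y := Y) (g := q⁻¹) ?_ (fun z hz _ => hz) fun z hz hzV => by
    rw [hqr z (hYC z hz), er z hzV]
  have c4 : ∀ z ∈ Y, z ∈ V₁ → ¬ le z f₂ ∨ ¬ le f₂ z := fun z hz hzV =>
    (b4 z (Finset.mem_union_left _ (hYC z hz)) hzV).symm
  have hcl : {x | x ∈ V₁ ∧ le x f₂ ∧ le f₂ x} = {x | x ∈ V ∧ le x f₂ ∧ le f₂ x} := by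
    ext x
    refine ⟨fun hx => ⟨hx.1.1, hx.2⟩, fun hx => ⟨⟨hx.1, fun h => hf₂.2 ?_⟩, hx.2⟩⟩
    exact hV.trans _ hf₂.1 _ hx.1 _ hf₁ hx.2.2 h
  refine hl₁.resolvable_split_marker hf₂ hqf c4 ?_ (by rw [hcl]; exact hM f₂ hf₂.1 hc₂)
    (up f₁ hf₁ a3 f₂ hf₂.1 b3 hf₂.2 q⁻¹ hqi hqf fun z hz hzV => by
      rw [hqr z (hYC z hz), er z hzV, a1 z hz])
  -- the part between the markers
  set V₂ := {x | x ∈ V₁ ∧ ¬ le f₂ x} with hV₂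
  have hl₂ : IsLine G V₂ le Col := hl₁.sub hf₂
  have hy₂ : y ∈ V₂ := ⟨hy₁, b3⟩
  obtain ⟨s, hs, es⟩ := hl₁.restrict_lt hf₂ hqi (by rw [hqf]; exact hl₁.refl hf₂)
    (by rw [hqf]; exact hl₁.refl hf₂)
  change s ∈ suppIn G V₂ at hs
  change ∀ x ∈ V₂, s x = q⁻¹ x at es
  have spow : ∀ j : ℕ, (s ^ j) y = (q⁻¹ ^ j) y := fun j => by
    induction j with
    | zero => rfl
    | succ j ih =>
      rw [pow_succ', Equiv.Perm.mul_apply, es _ ((suppIn_mem (pow_mem hs j)).2 hy₂), ih, pow_succ',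
        Equiv.Perm.mul_apply]
  have sipow : ∀ j < K₁ + 1, (s⁻¹ ^ j) y = (g₁⁻¹ ^ j) y ∧ (r⁻¹ ^ j) y = (g₁⁻¹ ^ j) y := fun j => by
    induction j with
    | zero => exact fun _ => ⟨rfl, rfl⟩
    | succ j ih =>
      intro hj
      obtain ⟨i1, i2⟩ := ih (by omega)
      have h1 : (r⁻¹ ^ (j + 1)) y = (g₁⁻¹ ^ (j + 1)) y := by
        rw [pow_succ', Equiv.Perm.mul_apply, pow_succ', Equiv.Perm.mul_apply, ← i2,
          Equiv.Perm.eq_inv_iff_eq, ← er _ ((suppIn_mem hri).2 (inv_pow_mem hr hy₁ j)),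
          apply_inv_apply]
      refine ⟨?_, h1⟩
      have hm : (s⁻¹ ^ (j + 1)) y ∈ V₂ := inv_pow_mem hs hy₂ _
      have h3 : (r⁻¹ ^ (j + 1)) y ∈ C := Finset.mem_union_right _
        (Finset.mem_image.2 ⟨j + 1, Finset.mem_range.2 hj, rfl⟩)
      have h2 : q⁻¹ ((s⁻¹ ^ (j + 1)) y) = q⁻¹ ((r⁻¹ ^ (j + 1)) y) := by
        rw [hqr _ h3, ← es _ hm, pow_succ', Equiv.Perm.mul_apply, apply_inv_apply, i1, pow_succ' r⁻¹,
          Equiv.Perm.mul_apply, apply_inv_apply, i2]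
      rw [q⁻¹.injective h2, h1]
  refine Resolvable.congr (Y := Y) (g := s) ?_ (fun z hz _ => hz) fun z hz hzV => (es z hzV).symm
  have hsy : s y = g y := by rw [es y hy₂, hqr y (hYC y hyY), hry]
  -- The two estimates together enclose `Y` between the iterates of `y` of order `-(K₁ + K₂)` and
  -- `K₁ + K₂`.
  refine hl₂.resolvable_of_hull hs hy₂ (by rwa [hsy]) (K₁ + K₂) fun z hz hzV => ⟨?_, ?_⟩
  · intro h
    have h1 := a5 z hz hzV.1.1 hzV.1.2 K₁ le_rfl
    rw [← (sipow K₁ (by omega)).1] at h1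
    have hsyy : le y (s y) := hl₂.le_of_not ((suppIn_mem hs).2 hy₂) hy₂ (by rwa [hsy])
    exact h1 (hl₂.trans _ hzV _ (inv_pow_mem hs hy₂ _) _ (inv_pow_mem hs hy₂ _) h
      (hl₂.inv_pow_le hs hy₂ hsyy K₁ K₂))
  · rw [spow]
    exact b5 z (Finset.mem_union_left _ (hYC z hz)) hzV.1 hzV.2 _ (by omega)

/-- Induction on the number of points of `Y` in `V`. A point of `Y` sent to an equivalent one splits
the line at its class. A point moving up is enclosed between two markers; moving down is moving up
in the reversed order. In either case the outer pieces lose this point. The preorder is generalized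
in the induction since upper pieces are initial segments of the reversed line. -/
theorem resolvable (hV : IsLine G V le Col) (hg : g ∈ suppIn G V) (Y : Finset M)
    (hC : ∀ y ∈ Y, y ∈ V → le (g y) y → le y (g y) →
      Resolvable G {x | x ∈ V ∧ le x y ∧ le y x} g Y)
    (hM : ∀ f ∈ V, f ∈ Col → Resolvable G {x | x ∈ V ∧ le x f ∧ le f x} 1 {f}) :
    Resolvable G V g Y := by
  classical
  induction n : (Y.filter (· ∈ V)).card using Nat.strong_induction_on generalizing V g le with
  | _ n ih =>
  subst n
  have card_lt : ∀ W ⊆ V, ∀ y ∈ Y, y ∈ V → y ∉ W →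
      (Y.filter (· ∈ W)).card < (Y.filter (· ∈ V)).card := fun W hW y hy hyV hyW =>
    Finset.card_lt_card ⟨fun x hx => by
      rw [Finset.mem_filter] at hx ⊢; exact ⟨hx.1, hW hx.2⟩, fun hs =>
      hyW (Finset.mem_filter.1 (hs (Finset.mem_filter.2 ⟨hy, hyV⟩))).2⟩
  -- the induction hypothesis for initial segments, in both directions
  have low : ∀ (le' : M → M → Prop), IsLine G V le' Col →
      (∀ x y, (le' x y ∧ le' y x) ↔ (le x y ∧ le y x)) →
      ∀ f ∈ V, ∀ k ∈ suppIn G V, le' (k f) f → le' f (k f) →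
      (∀ z ∈ Y, z ∈ {x | x ∈ V ∧ ¬ le' f x} → k z = g z) →
      (∃ y ∈ Y, y ∈ V ∧ le' f y) → Resolvable G {x | x ∈ V ∧ ¬ le' f x} k Y := by
    rintro le' hl' hiff f hf k hk h1 h2 hkY ⟨y, hy, hyV, hfy⟩
    obtain ⟨r, hr, er⟩ := hl'.restrict_lt hf hk h1 h2
    have hcl : ∀ y ∈ {x | x ∈ V ∧ ¬ le' f x}, {x | x ∈ {x | x ∈ V ∧ ¬ le' f x} ∧ le' x y ∧ le' y x} =
        {x | x ∈ V ∧ le x y ∧ le y x} := fun y hy => by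
      ext x
      simp only [Set.mem_ofPred_eq, hiff]
      refine ⟨fun hx => ⟨hx.1.1, hx.2⟩, fun hx => ⟨⟨hx.1, fun h => hy.2 ?_⟩, hx.2⟩⟩
      exact hl'.trans _ hf _ hx.1 _ hy.1 h ((hiff x y).2 hx.2).1
    refine (ih _ (card_lt {x | x ∈ V ∧ ¬ le' f x} (fun _ hx => hx.1) y hy hyV fun h => h.2 hfy)
      (hl'.sub hf) hr (fun y hy hyV h3 h4 => ?_) (fun m hm hmc => ?_) rfl).congr (fun z hz _ => hz)
      fun z hz hzV => (er z hzV).symm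
    · rw [hcl y hyV]
      rw [er y hyV, hkY y hy hyV] at h3 h4
      have := (hiff _ _).1 ⟨h3, h4⟩
      refine (hC y hy hyV.1 this.1 this.2).congr (fun z hz _ => hz) fun z hz hzV => ?_
      rw [← hcl y hyV] at hzV
      rw [er z hzV.1, hkY z hz hzV.1]
    · rw [hcl m hm]
      exact hM m hm.1 hmc
  have moving : ∀ (le' : M → M → Prop), IsLine G V le' Col →
      (∀ x y, (le' x y ∧ le' y x) ↔ (le x y ∧ le y x)) → ∀ y ∈ Y, y ∈ V → ¬ le' (g y) y →
      Resolvable G V g Y := by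
    intro le' hl' hiff y hy hyV h1
    refine hl'.resolvable_of_moving hg hyV h1 hy (fun f hf hc => ?_) (fun f hf hyf k hk hkf hkY => ?_)
      (fun f hf hyf f' hf' hyf' hff' k hk hkf hkY => ?_)
    · simp only [hiff]; exact hM f hf hc
    · exact low le' hl' hiff f hf k hk (by rw [hkf]; exact hl'.refl hf)
        (by rw [hkf]; exact hl'.refl hf) (fun z hz _ => hkY z hz)
        ⟨y, hy, hyV, hl'.le_of_not hyV hf hyf⟩
    · have hVV : ({x | x ∈ {x | x ∈ V ∧ ¬ le' x f} ∧ ¬ le' x f'} : Set M) =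
          {x | x ∈ V ∧ ¬ le' x f'} := by
        ext x
        refine ⟨fun hx => ⟨hx.1.1, hx.2⟩, fun hx => ⟨⟨hx.1, fun h => hx.2 ?_⟩, hx.2⟩⟩
        exact hl'.trans _ hx.1 _ hf _ hf' h (hl'.le_of_not hf' hf hff')
      rw [hVV]
      refine low _ hl'.dual (fun x y => and_comm.trans (hiff x y)) f' hf' k
        (suppIn_mono (fun _ hx => hx.1) hk)
        (by rw [hkf]; exact hl'.refl hf') (by rw [hkf]; exact hl'.refl hf') (fun z hz hzV => ?_)
        ⟨y, hy, hyV, hl'.le_of_not hf' hyV hyf'⟩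
      rw [← hVV] at hzV
      exact hkY z hz hzV.1
  by_cases hne : ∃ y ∈ Y, y ∈ V
  · obtain ⟨y, hy, hyV⟩ := hne
    by_cases h1 : le (g y) y
    · by_cases h2 : le y (g y)
      · exact hV.resolvable_split hyV h1 h2 hy
          (low le hV (fun _ _ => Iff.rfl) y hyV g hg h1 h2 (fun _ _ _ => rfl)
            ⟨y, hy, hyV, hV.refl hyV⟩)
          (hC y hy hyV h1 h2)
          (low _ hV.dual (fun _ _ => and_comm) y hyV g hg h2 h1 (fun _ _ _ => rfl)
            ⟨y, hy, hyV, hV.refl hyV⟩)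
      · exact moving _ hV.dual (fun _ _ => and_comm) y hy hyV h2
    · exact moving le hV (fun _ _ => Iff.rfl) y hy hyV h1
  · refine ⟨g, hg, ∅, by simp, fun y hy hyV => absurd ⟨y, hy, hyV⟩ hne, hV.isAmalgBase_empty g⟩

end IsLine

end Amalg

/-! ### Gluing bp-automorphisms -/

namespace IsRich

variable {N : ℕ∞} {M : Type v} [MetricSpace M] [LinearOrder M] {rk : M → ℝ → ℕ}

theorem dist_lt_of_mem_BP (h : IsRich N rk) {e : Equiv.Perm M} (he : e ∈ BP M) {x y z : M} :
    dist x y < dist x z ↔ dist (e x) (e y) < dist (e x) (e z) := by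
  rw [← not_le, ← not_le, (h.mem_BP.1 he).2]

theorem dist_le_of_mem_BP (h : IsRich N rk) {e : Equiv.Perm M} (he : e ∈ BP M) {x y z : M} :
    dist x y ≤ dist x z ↔ dist (e x) (e y) ≤ dist (e x) (e z) := (h.mem_BP.1 he).2 x y z

/-- A bp-automorphism can be replaced by the identity outside of an invariant set `L`, if the
points outside of `L` do not separate `v` and `e v`. -/
theorem exists_glue (h : IsRich N rk) {L : Set M} {e : Equiv.Perm M} (he : e ∈ BP M)
    (hL : ∀ x, e x ∈ L ↔ x ∈ L)
    (hlt : ∀ x, x ∉ L → ∀ v ∈ L, (x < v ↔ x < e v) ∧ dist x v = dist x (e v))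
    (hle : ∀ x, x ∉ L → ∀ v ∈ L, ∀ v' ∈ L, (dist v v' ≤ dist v x ↔ dist (e v) (e v') ≤ dist (e v) x) ∧
      (dist v x ≤ dist v v' ↔ dist (e v) x ≤ dist (e v) (e v'))) :
    ∃ e' ∈ suppIn (BP M) L, ∀ x ∈ L, e' x = e x := by
  classical
  have hL' : ∀ x, e⁻¹ x ∈ L ↔ x ∈ L := inv_apply_mem_iff hL
  let e' : Equiv.Perm M :=
    { toFun := fun x => if x ∈ L then e x else x
      invFun := fun x => if x ∈ L then e⁻¹ x else x
      left_inv := fun x => by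
        by_cases hx : x ∈ L
        · simp [hx, hL]
        · simp [hx]
      right_inv := fun x => by
        by_cases hx : x ∈ L
        · have := (hL' x).2 hx
          simp only [hx, if_true, this]
          simp
        · simp [hx] }
  have i : ∀ x ∈ L, e' x = e x := fun x hx => if_pos hx
  have o : ∀ x, x ∉ L → e' x = x := fun x hx => if_neg hx
  refine ⟨e', ⟨h.mem_BP.2 ⟨fun x y hxy => ?_, fun x y z => ?_⟩, o⟩, i⟩
  · by_cases hx : x ∈ L <;> by_cases hy : y ∈ L
    · rw [i x hx, i y hy]; exact he.2 hxy
    · rw [i x hx, o y hy]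
      refine lt_of_le_of_ne (not_lt.1 fun h1 => hxy.asymm (((hlt y hy x hx).1).2 h1)) ?_
      rintro rfl
      exact hy ((hL x).2 hx)
    · rw [o x hx, i y hy]
      exact ((hlt x hx y hy).1).1 hxy
    · rwa [o x hx, o y hy]
  · by_cases hx : x ∈ L <;> by_cases hy : y ∈ L <;> by_cases hz : z ∈ L
    · rw [i x hx, i y hy, i z hz]; exact h.dist_le_of_mem_BP he
    · rw [i x hx, i y hy, o z hz]; exact (hle z hz x hx y hy).1
    · rw [i x hx, o y hy, i z hz]; exact (hle y hy x hx z hz).2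
    · rw [i x hx, o y hy, o z hz, dist_comm x, dist_comm x, (hlt y hy x hx).2, (hlt z hz x hx).2,
        dist_comm y, dist_comm z]
    · rw [o x hx, i y hy, i z hz, (hlt x hx y hy).2, (hlt x hx z hz).2]
    · rw [o x hx, i y hy, o z hz, (hlt x hx y hy).2]
    · rw [o x hx, o y hy, i z hz, (hlt x hx z hz).2]
    · rw [o x hx, o y hy, o z hz]

end IsRich

/-- A set whose points have the same distance from each point outside, larger than all distances
inside. -/
def IsClan {M : Type v} [MetricSpace M] (L : Set M) : Prop :=
  ∀ x ∈ L, ∀ y ∈ L, ∀ c, c ∉ L → dist x y < dist x c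

/-- A clan which is cut out by finitely many points. -/
structure IsCell {M : Type v} [MetricSpace M] (V : Set M) (B : Finset M) : Prop where
  nonempty : V.Nonempty
  mem_iff : ∀ x ∈ V, ∀ y, y ∈ V ↔ ∀ v ∈ B, dist x y < dist x v

namespace IsCell

variable {M : Type v} [MetricSpace M] {V : Set M} {B : Finset M}

theorem notMem (hV : IsCell V B) {v : M} (hv : v ∈ B) : v ∉ V := fun h =>
  lt_irrefl _ ((hV.mem_iff v h v).1 h v hv)

theorem isClan (hV : IsCell V B) : IsClan V := by
  intro x hx y hy c hc
  by_contra! h1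
  exact hc ((hV.mem_iff x hx c).2 fun v hv => h1.trans_lt ((hV.mem_iff x hx y).1 hy v hv))

end IsCell

namespace IsRich

variable {N : ℕ∞} {M : Type v} [MetricSpace M] [LinearOrder M] {rk : M → ℝ → ℕ}

/-- A point outside a clan has the same distance and order relation to `v` and to `e v`, and is
farther away than all points of the clan. -/
theorem exists_glue_clan (h : IsRich N rk) {L : Set M} (hc : IsClan L) {e : Equiv.Perm M}
    (he : e ∈ BP M) (hL : ∀ x, e x ∈ L ↔ x ∈ L) : ∃ e' ∈ suppIn (BP M) L, ∀ x ∈ L, e' x = e x := by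
  have hu := h.cu
  refine h.exists_glue he hL (fun x hx v hv => ?_) fun x hx v hv v' hv' => ?_
  · have hev := (hL v).2 hv
    have h1 := hc v hv _ hev x hx
    rw [dist_comm v] at h1
    have h2 : dist (e v) v < dist v x := h1
    refine ⟨?_, by rw [dist_comm x, dist_comm x, hu.dist_eq h2]⟩
    have h3 := hu.lt_iff h2
    have xv : x ≠ v := by rintro rfl; exact hx hv
    have xev : x ≠ e v := by rintro rfl; exact hx hev
    rw [← not_le, ← not_le, not_iff_not, le_iff_lt_or_eq, le_iff_lt_or_eq, h3]
    simp [xv.symm, xev.symm]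
  · have h1 := hc v hv v' hv' x hx
    have h2 := hc (e v) ((hL v).2 hv) (e v') ((hL v').2 hv') x hx
    simp [h1.le, h2.le, not_le.2 h1, not_le.2 h2]

theorem isCell_univ (h : IsRich N rk) : IsCell (Set.univ : Set M) ∅ :=
  ⟨by have := h.nonempty; exact Set.univ_nonempty, by simp⟩

theorem isCell_ball (h : IsRich N rk) {y p : M} (hyp : y ≠ p) :
    IsCell {x | dist y x < dist y p} {p} := by
  have hu := h.cu
  refine ⟨⟨y, by simpa using hyp⟩, fun x hx z => ?_⟩
  have hx' : dist x y < dist y p := by rw [dist_comm]; exact hx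
  have h1 := hu.dist_eq hx'
  simp only [Finset.mem_singleton, forall_eq, Set.mem_ofPred_eq, h1]
  exact ⟨fun h2 => hu.dist_lt hx' h2, fun h2 => hu.dist_lt hx h2⟩

variable {V : Set M} {B : Finset M}

/-- An automorphism fixing the points that cut out a cell preserves the cell once it keeps one of
its points inside. -/
theorem exists_suppIn_cell (h : IsRich N rk) (hV : IsCell V B) {e : Equiv.Perm M} (he : e ∈ BP M)
    (hB : ∀ v ∈ B, e v = v) {p : M} (hp : p ∈ V) (hep : e p ∈ V) :
    ∃ e' ∈ suppIn (BP M) V, ∀ x ∈ V, e' x = e x := by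
  refine h.exists_glue_clan (hV.isClan) he fun y => ?_
  rw [hV.mem_iff _ hep, hV.mem_iff _ hp]
  refine forall₂_congr fun v hv => ?_
  rw [h.dist_lt_of_mem_BP he (x := p), hB v hv]

variable (N rk) in
/-- The points above `p` with the first possible pair of labels. -/
def _root_.markers (p : M) : Set M :=
  {f | p < f ∧ (N ≠ ⊤ → rk p (dist p f) = 0 ∧ rk f (dist p f) = 1)}

/-- The side and the two labels being prescribed, all markers look alike from `p`; this makes them
interchangeable in `isLine_cell`. The labels `0` and `1` exist because `2 ≤ N`. -/
theorem exists_marker (h : IsRich N rk) (p : M) {lo hi : ℝ} (h0 : 0 ≤ lo) (hlh : lo < hi) :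
    ∃ f ∈ markers N rk p, lo < dist p f ∧ dist p f < hi := by
  by_cases hN : N = ⊤
  · obtain ⟨y, h1, h2, h3⟩ := h.level_gt hN p lo hi h0 hlh
    exact ⟨y, ⟨h3, fun h => absurd hN h⟩, h1, h2⟩
  · have h2 : (1 : ℕ∞) < N := lt_of_lt_of_le (by norm_num) h.two_le
    obtain ⟨y, h1, h2, h3, h4⟩ := h.level_fin hN p lo hi h0 hlh 0 1 (by norm_num)
      (lt_of_le_of_lt (by norm_num) h2) (by simpa using h2)
    refine ⟨y, ⟨?_, fun _ => ⟨h3, h4⟩⟩, h1, h2⟩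
    rw [h.lab.lt_iff hN, h3, h4]
    · norm_num
    · rintro rfl; rw [dist_self] at h1; linarith

/-- Insertion of a fixed point just above a set `W`. -/
theorem exists_just_above (h : IsRich N rk) {g : Equiv.Perm M} (hg : g ∈ BP M) (Y : Finset M)
    {W : Set M} (hW : IsClan W) (hgW : ∀ y ∈ Y, g y ∈ W ↔ y ∈ W) {w : M} (hwY : w ∈ Y)
    (hw : w ∈ W) : ∃ p ∈ markers N rk w, ∃ g' ∈ BP M, (∀ y ∈ Y, g' y = g y) ∧ g' p = p ∧
      (∀ y ∈ Y, y ∈ W → dist w y < dist w p) ∧ ∀ y ∈ Y, y ∉ W → dist w p < dist w y := by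
  classical
  have hu := h.cu
  set Z := Y ∪ Y.image g with hZ
  have hYZ : ∀ y ∈ Y, y ∈ Z := fun y hy => Finset.mem_union_left _ hy
  have hgZ : ∀ y ∈ Y, g y ∈ Z := fun y hy =>
    Finset.mem_union_right _ (Finset.mem_image_of_mem _ hy)
  -- The new point leaves the branch of `w` above all points of `W` among `Y` and its image, and
  -- below all the others. It is therefore related to `y` as to `g y` and can be declared fixed.
  obtain ⟨lo, hi, h0, hlh, hS, hT⟩ := exists_gap_of_finite
    (S := (fun y => dist w y) '' {y | y ∈ Z ∧ y ∈ W}) (T := (fun y => dist w y) '' {y | y ∈ Z ∧ y ∉ W})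
    ((Z.finite_toSet.subset fun y hy => hy.1).image _)
    ((Z.finite_toSet.subset fun y hy => hy.1).image _) (by
      rintro _ ⟨y, hy, rfl⟩ _ ⟨c, hc, rfl⟩
      exact hW w hw y hy.2 c hc.2) (by
      rintro _ ⟨c, hc, rfl⟩
      refine dist_pos.2 ?_
      rintro rfl
      exact hc.2 hw)
  obtain ⟨p, hp, hlo, hhi⟩ := h.exists_marker w h0 hlh
  have hin : ∀ y ∈ Z, y ∈ W → dist w y < dist w p := fun y hy hyW =>
    (hS _ ⟨y, ⟨hy, hyW⟩, rfl⟩).trans_lt hlo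
  have hout : ∀ y ∈ Z, y ∉ W → dist w p < dist w y := fun y hy hyW =>
    hhi.trans_le (hT _ ⟨y, ⟨hy, hyW⟩, rfl⟩)
  have hwp : w ≠ p := hp.1.ne
  have hpY : p ∉ Y := fun hpY => by
    by_cases hpW : p ∈ W
    · exact lt_irrefl _ (hin p (hYZ p hpY) hpW)
    · exact lt_irrefl _ (hout p (hYZ p hpY) hpW)
  have key : ∀ b ∈ Z, b ∈ W → dist b w < dist w p := fun b hb hbW => by
    rw [dist_comm]; exact hin b hb hbW
  have dp : ∀ b ∈ Z, b ∈ W → dist p b = dist w p := fun b hb hbW => by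
    rw [dist_comm]; exact hu.dist_eq (key b hb hbW)
  have lp : ∀ b ∈ Z, b ∈ W → b < p := fun b hb hbW => (hu.lt_iff (key b hb hbW)).2 hp.1
  have rb : ∀ b ∈ Z, b ∈ W → rk b (dist w p) = rk w (dist w p) := fun b hb hbW =>
    h.lab.congr _ _ _ (key b hb hbW)
  have db : ∀ b ∈ Z, b ∈ W → ∀ b' ∈ Z, b' ∈ W → dist b b' < dist w p := fun b hb hbW b' hb' hbW' =>
    hu.dist_lt (key b hb hbW) (hin b' hb' hbW')
  have hf := (h.pIso_of_mem_BP hg (Insert.insert w (Y : Set M))).insert h.cu h.cu h.lab h.lab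
    (x := p) (y := p) (W := {y | y ∈ Y ∧ y ∈ W}) hpY (fun y hy => hy.1) (Or.inl ⟨hwY, hw⟩)
    (fun b hb => (lp _ (hgZ b hb.1) ((hgW b hb.1).2 hb.2)).ne')
    (fun b hb => iff_of_false (lp b (hYZ b hb.1) hb.2).asymm
      (lp _ (hgZ b hb.1) ((hgW b hb.1).2 hb.2)).asymm)
    (fun b hb => by rw [dp b (hYZ b hb.1) hb.2, dp _ (hgZ b hb.1) ((hgW b hb.1).2 hb.2)])
    (fun b hb => by
      rw [dp b (hYZ b hb.1) hb.2, dp _ (hgZ b hb.1) ((hgW b hb.1).2 hb.2), rb b (hYZ b hb.1) hb.2,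
        rb _ (hgZ b hb.1) ((hgW b hb.1).2 hb.2)])
    (fun b hb b' hb' => by rw [dp b (hYZ b hb.1) hb.2, dp b' (hYZ b' hb'.1) hb'.2])
    (fun b hb b' hb' => by
      rw [dp _ (hgZ b hb.1) ((hgW b hb.1).2 hb.2), dp _ (hgZ b' hb'.1) ((hgW b' hb'.1).2 hb'.2)])
    (fun b hb b' hb' => by
      rw [dp b (hYZ b hb.1) hb.2, dp _ (hgZ b hb.1) ((hgW b hb.1).2 hb.2)]
      exact iff_of_false (db b (hYZ b hb.1) hb.2 b' (hYZ b' hb'.1) hb'.2).ne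
        (db _ (hgZ b hb.1) ((hgW b hb.1).2 hb.2) _ (hgZ b' hb'.1) ((hgW b' hb'.1).2 hb'.2)).ne)
    (fun c hc hcW => by
      rw [dist_comm p]
      exact hout c (hYZ c hc) fun h => hcW ⟨hc, h⟩)
    (fun c hc hcW => by
      have hcW' : g c ∉ W := fun h => hcW ⟨hc, (hgW c hc).1 h⟩
      have hgw := (hgW w hwY).2 hw
      rw [dp _ (hgZ w hwY) hgw]
      have h1 := hout _ (hgZ c hc) hcW'
      rwa [hu.dist_eq ((key _ (hgZ w hwY) hgw).trans h1)])
  obtain ⟨e, he, he'⟩ := h.exists_extension (Insert.insert p Y) (by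
    rw [Finset.coe_insert]; exact hf)
  refine ⟨p, hp, e, he, fun y hy => ?_, ?_, fun y hy => hin y (hYZ y hy), fun y hy => hout y (hYZ y hy)⟩
  · rw [he' y (Finset.mem_insert_of_mem hy), Function.update_of_ne]
    rintro rfl; exact hpY hy
  · rw [he' p (Finset.mem_insert_self _ _), Function.update_self]

end IsRich

/-! ### Cells as lines -/

namespace IsRich

variable {N : ℕ∞} {M : Type v} [MetricSpace M] [LinearOrder M] {rk : M → ℝ → ℕ} {V : Set M}
  {B : Finset M}

/-- Together with `p`, an initial segment behaves like a ball about `p`: everything outside is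
farther from `p` than everything inside. -/
theorem isClan_insert (h : IsRich N rk) (hV : IsCell V B) {p : M} (hp : p ∈ V) {L : Set M}
    (hL : L ⊆ V \ {p})
    (hlow : ∀ x ∈ L, ∀ y ∈ V \ {p}, dist p y ≤ dist p x → y ∈ L) : IsClan (insert p L) := by
  have hu := h.cu
  have key : ∀ v ∈ insert p L, ∀ c, c ∉ insert p L → dist p v < dist p c := by
    intro v hv c hc
    rw [Set.mem_insert_iff, not_or] at hc
    rcases hv with rfl | hv
    · rw [dist_self]; exact dist_pos.2 (Ne.symm hc.1)
    · by_cases hcV : c ∈ V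
      · by_contra! h1
        exact hc.2 (hlow v hv c ⟨hcV, hc.1⟩ h1)
      · exact hV.isClan p hp v (hL hv).1 c hcV
  intro x hx y hy c hc
  have hx' := key x hx c hc
  rw [dist_comm p x] at hx'
  rw [hu.dist_eq hx']
  exact hu.dist_lt hx' (key y hy c hc)

/-- Elements supported in `V \ {p}` fix `p`, hence respect the comparison of distances from `p`.
Initial segments are clans up to `p`, so gluing and insertion come from `exists_glue_clan` and
`exists_just_above`. Two markers in the same position relative to a finite set have the same labels,
so some automorphism takes one to the other over this set. -/
theorem isLine_cell (h : IsRich N rk) (hV : IsCell V B) {p : M} (hp : p ∈ V) :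
    IsLine (BP M) (V \ {p}) (fun x y => dist p x ≤ dist p y) (markers N rk p) := by
  classical
  have hu := h.cu
  have pfix : ∀ {g : Equiv.Perm M}, g ∈ suppIn (BP M) (V \ {p}) → g p = p := fun hg =>
    hg.2 p fun h => h.2 rfl
  -- elements fixing `p`, restricted to the line
  have restr : ∀ {e : Equiv.Perm M}, e ∈ BP M → (∀ v ∈ B, e v = v) → e p = p →
      ∃ e' ∈ suppIn (BP M) (V \ {p}), ∀ x ∈ V, e' x = e x := by
    intro e he hB hep
    obtain ⟨e', he', h1⟩ := h.exists_suppIn_cell hV he hB hp (by rwa [hep])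
    refine ⟨e', ⟨he'.1, fun x hx => ?_⟩, h1⟩
    by_cases hxV : x ∈ V
    · have : x = p := by
        by_contra hne
        exact hx ⟨hxV, hne⟩
      rw [this, h1 p hp, hep]
    · exact he'.2 x hxV
  refine ⟨fun x _ y _ => le_total _ _, fun x _ y _ z _ => le_trans, fun g hg x _ y _ hxy => ?_,
    fun L hL hlow g hg hgL => ?_, fun g hg L hL hlow hgL Y => ?_, fun f hf f' hf' hc hc' A hA => ?_⟩
  · have := (h.dist_le_of_mem_BP hg.1).1 hxy
    rwa [pfix hg] at this
  · have hpL : p ∉ L := fun hpL => (hL hpL).2 rfl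
    obtain ⟨e, he, he'⟩ := h.exists_glue_clan (h.isClan_insert hV hp hL hlow) hg.1 (fun x => by
      rw [Set.mem_insert_iff, Set.mem_insert_iff, hgL]
      refine or_congr_left ?_
      conv_lhs => rw [← pfix hg]
      exact g.injective.eq_iff)
    refine ⟨e, ⟨he.1, fun x hx => ?_⟩, fun x hx => he' x (Or.inr hx)⟩
    by_cases hxp : x = p
    · rw [hxp, he' p (Or.inl rfl), pfix hg]
    · exact he.2 x (by simp [hxp, hx])
  · obtain ⟨f, hf, e, he, h1, h2, h3, h4⟩ := h.exists_just_above hg.1 (insert p (Y ∪ B))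
      (h.isClan_insert hV hp hL hlow) (fun y _ => by
        rw [Set.mem_insert_iff, Set.mem_insert_iff, hgL]
        refine or_congr_left ?_
        conv_lhs => rw [← pfix hg]
        exact g.injective.eq_iff) (w := p) (by simp) (Or.inl rfl)
    have hep : e p = p := by rw [h1 p (by simp), pfix hg]
    have hBL : ∀ v ∈ B, v ∉ insert p L := by
      rintro v hv (rfl | hvL)
      · exact hV.notMem hv hp
      · exact hV.notMem hv (hL hvL).1
    have hfV : f ∈ V := (hV.mem_iff p hp f).2 fun v hv => h4 v (by simp [hv]) (hBL v hv)
    obtain ⟨e', he', h5⟩ := restr he (fun v hv => by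
      rw [h1 v (by simp [hv]), hg.2 v fun h => hV.notMem hv h.1]) hep
    refine ⟨e', he', f, ⟨hfV, hf.1.ne'⟩, hf, fun y hy => ?_, by rw [h5 f hfV, h2], fun y hy hyL => ?_,
      fun y hy hyV hyL => ?_⟩
    · by_cases hyV : y ∈ V
      · rw [h5 y hyV, h1 y (by simp [hy])]
      · rw [he'.2 y fun h => hyV h.1, hg.2 y fun h => hyV h.1]
    · exact not_le.2 (h3 y (by simp [hy]) (Or.inr hyL))
    · refine not_le.2 (h4 y (by simp [hy]) ?_)
      rintro (rfl | h6)
      · exact hyV.2 rfl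
      · exact hyL h6
  -- The points of `B` are included so that the extension preserves the cell.
  · set Y : Finset M := insert p (A ∪ B) with hY
    have hpf : p ≠ f := hc.1.ne
    have side : ∀ c ∈ Y, (dist p c < dist p f ∧ dist p c < dist p f') ∨
        (dist p f < dist p c ∧ dist p f' < dist p c) := by
      intro c hcY
      by_cases hcV : c ∈ V
      · rcases Finset.mem_insert.1 hcY with rfl | hcY
        · rw [dist_self]
          exact Or.inl ⟨dist_pos.2 hpf, dist_pos.2 hc'.1.ne⟩
        · by_cases hcp : c = p
          · rw [hcp, dist_self]
            exact Or.inl ⟨dist_pos.2 hpf, dist_pos.2 hc'.1.ne⟩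
          · rcases Finset.mem_union.1 hcY with hcA | hcB
            · simpa [not_le] using hA c hcA ⟨hcV, hcp⟩
            · exact absurd hcV (hV.notMem hcB)
      · exact Or.inr ⟨hV.isClan p hp f hf.1 c hcV, hV.isClan p hp f' hf'.1 c hcV⟩
    set W : Set M := {y | y ∈ Y ∧ dist p y < dist p f} with hW
    have hW' : ∀ b ∈ W, dist b p < dist p f ∧ dist b p < dist p f' := fun b hb => by
      rw [dist_comm b]
      exact ⟨hb.2, ((side b hb.1).resolve_right fun h => h.1.asymm hb.2).2⟩
    have hO : ∀ c ∈ Y, c ∉ W → dist f p < dist p c ∧ dist f' p < dist p c := fun c hcY hcW => by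
      rw [dist_comm f, dist_comm f']
      exact (side c hcY).resolve_left fun h => hcW ⟨hcY, h.1⟩
    have d1 : ∀ b ∈ W, dist f b = dist p f := fun b hb => by
      rw [dist_comm]; exact hu.dist_eq (hW' b hb).1
    have d2 : ∀ b ∈ W, dist f' b = dist p f' := fun b hb => by
      rw [dist_comm]; exact hu.dist_eq (hW' b hb).2
    have l1 : ∀ b ∈ W, b < f := fun b hb => (hu.lt_iff (hW' b hb).1).2 hc.1
    have l2 : ∀ b ∈ W, b < f' := fun b hb => (hu.lt_iff (hW' b hb).2).2 hc'.1
    have hfY : f ∉ Y := fun hfY => (side f hfY).elim (fun h => lt_irrefl _ h.1) fun h => lt_irrefl _ h.1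
    have rkf : rk f (dist p f) = rk f' (dist p f') := by
      by_cases hN : N = ⊤
      · rw [h.lab.top hN, h.lab.top hN]
      · rw [(hc.2 hN).2, (hc'.2 hN).2]
    have rkp : rk p (dist p f) = rk p (dist p f') := by
      by_cases hN : N = ⊤
      · rw [h.lab.top hN, h.lab.top hN]
      · rw [(hc.2 hN).1, (hc'.2 hN).1]
    have hf := (h.pIso_of_mem_BP (BP M).one_mem (insert p (Y : Set M))).insert h.cu h.cu h.lab h.lab
      (x := f) (y := f') (W := W) hfY (fun y hy => hy.1)
      (Or.inl ⟨by simp [hY], by simpa using hpf⟩)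
      (fun b hb => (l2 b hb).ne') (fun b hb => iff_of_false (l1 b hb).asymm (l2 b hb).asymm)
      (fun b hb => by
        rw [Equiv.Perm.one_apply, d1 b hb, d2 b hb, rkf])
      (fun b hb => by
        rw [Equiv.Perm.one_apply, d1 b hb, d2 b hb, h.lab.congr b p _ (hW' b hb).1,
          h.lab.congr b p _ (hW' b hb).2, rkp])
      (fun b hb b' hb' => by rw [d1 b hb, d1 b' hb'])
      (fun b hb b' hb' => by
        rw [Equiv.Perm.one_apply, Equiv.Perm.one_apply, d2 b hb, d2 b' hb'])
      (fun b hb b' hb' => by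
        rw [Equiv.Perm.one_apply, Equiv.Perm.one_apply, d1 b hb, d2 b hb]
        refine iff_of_false (hu.dist_lt (hW' b hb).1 ?_).ne (hu.dist_lt (hW' b hb).2 ?_).ne
        · rw [dist_comm]; exact (hW' b' hb').1
        · rw [dist_comm]; exact (hW' b' hb').2)
      (fun c hc hcW => (hO c hc hcW).1) (fun c hc hcW => (hO c hc hcW).2)
    obtain ⟨e, he, he'⟩ := h.exists_extension (insert f Y) (by
      rw [Finset.coe_insert]; exact hf)
    have heY : ∀ y ∈ Y, e y = y := fun y hy => by
      rw [he' y (Finset.mem_insert_of_mem hy), Function.update_of_ne, Equiv.Perm.one_apply]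
      rintro rfl; exact hfY hy
    obtain ⟨k, hk, hk'⟩ := restr he (fun v hv => heY v (by simp [hY, hv])) (heY p (by simp [hY]))
    refine ⟨k, hk, fun a ha => ?_, ?_⟩
    · by_cases haV : a ∈ V
      · rw [hk' a haV, heY a (by simp [hY, ha])]
      · exact hk.2 a fun h => haV h.1
    · rw [hk' f (by assumption : f ∈ V \ {p}).1, he' f (Finset.mem_insert_self _ _),
        Function.update_self]
      exact ⟨le_rfl, le_rfl⟩

theorem suppIn_fixing {g : Equiv.Perm M} {p : M} (hg : g ∈ suppIn (BP M) V) (hgp : g p = p) :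
    g ∈ suppIn (BP M) (V \ {p}) := by
  refine ⟨hg.1, fun x hx => ?_⟩
  by_cases hxp : x = p
  · rw [hxp, hgp]
  · exact hg.2 x fun hxV => hx ⟨hxV, hxp⟩

theorem _root_.IsAmalgBase.insert_fixed [DecidableEq M] {D : Finset M} {k : Equiv.Perm M} {p : M}
    (hk : IsAmalgBase (BP M) (V \ {p}) D k) (hkp : k p = p) :
    IsAmalgBase (BP M) V (insert p D) k := by
  intro g₁ hg₁ g₂ hg₂ e₁ e₂ Y₁ Y₂
  obtain ⟨g, hg, e, he, h1, h2, h3⟩ := hk g₁ (suppIn_fixing hg₁ (by rw [e₁ p (by simp), hkp])) g₂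
    (suppIn_fixing hg₂ (by rw [e₂ p (by simp), hkp])) (fun x hx => e₁ x (by simp [hx]))
    (fun x hx => e₂ x (by simp [hx])) Y₁ Y₂
  refine ⟨g, suppIn_mono Set.sdiff_subset hg, e, suppIn_mono Set.sdiff_subset he, fun x hx => ?_,
    h2, h3⟩
  rcases Finset.mem_insert.1 hx with rfl | hx
  · have := he.2 x fun h => h.2 rfl
    rw [hkp, this]; exact ⟨rfl, rfl⟩
  · exact h1 x hx

/-- The identity on a point of a cell extends to an amalgamation base. -/
theorem resolvable_singleton (h : IsRich N rk) (hV : IsCell V B) {f : M} (hf : f ∈ V) :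
    Resolvable (BP M) V 1 {f} := by
  classical
  refine ⟨1, one_mem _, insert f ∅, by simp [hf], by simp, ?_⟩
  exact ((h.isLine_cell hV hf).isAmalgBase_empty 1).insert_fixed rfl

/-- Used to change or prescribe an element at a single point `x` of the cell. As `B` stays fixed,
the extension can be restricted to the cell. -/
theorem exists_suppIn_of_pIso (h : IsRich N rk) (hV : IsCell V B) {g : Equiv.Perm M}
    (hg : g ∈ suppIn (BP M) V) {Y : Finset M} (hBY : B ⊆ Y) {x : M} {f : M → M}
    (hf : PIso rk rk f Y) (hfg : ∀ y ∈ Y, y ≠ x → f y = g y) (hxV : x ∈ V) (hfx : f x ∈ V)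
    (hxY : x ∈ Y) : ∃ e ∈ suppIn (BP M) V, ∀ y ∈ Y, e y = f y := by
  obtain ⟨e, he, he'⟩ := h.exists_extension Y hf
  have hex := he' x hxY
  have ne : ∀ v, v ∉ V → v ≠ x := by rintro v hv rfl; exact hv hxV
  obtain ⟨k, hk, hk'⟩ := h.exists_suppIn_cell hV he (fun v hv => by
    have := hV.notMem hv
    rw [he' v (hBY hv), hfg v (hBY hv) (ne v this), hg.2 v this]) hxV (by rwa [hex])
  refine ⟨k, hk, fun y hy => ?_⟩
  by_cases hyV : y ∈ V
  · rw [hk' y hyV, he' y hy]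
  · rw [hk.2 y hyV, hfg y hy (ne y hyV), hg.2 y hyV]

end IsRich

/-! ### Fixed points in cells -/

namespace IsRich

variable {N : ℕ∞} {M : Type v} [MetricSpace M] [LinearOrder M] {rk : M → ℝ → ℕ} {V : Set M}
  {B : Finset M} {g : Equiv.Perm M}

/-- Here `x` and `g x` are different children of one node, which `g` preserves. For finite `N` they
would have the same label, so `N = ⊤`. A new child to the left of all relevant ones then has the
same relations to the points as to their images, and can be fixed. -/
theorem exists_fixed_of_dist_eq (h : IsRich N rk) (hV : IsCell V B) (hg : g ∈ suppIn (BP M) V)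
    {Y : Finset M} {x : M} (hx : x ∈ Y) (hxV : x ∈ V) (hgx : x ≠ g x)
    (hd : dist (g x) (g (g x)) = dist x (g x)) : ∃ p ∈ V, ∃ g' ∈ suppIn (BP M) V,
      (∀ y ∈ Y, g' y = g y) ∧ g' p = p ∧ dist p x ≤ dist x (g x) := by
  classical
  have hu := h.cu
  have hN : N = ⊤ := by
    by_contra hN
    have h1 := h.rk_of_mem_BP hg.1 hgx
    rw [hd] at h1
    exact h.lab.ne hN hgx h1
  set r := dist x (g x) with hr
  have r0 : 0 < r := dist_pos.2 hgx
  set Y' := Y ∪ B with hY'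
  set P : Set M := {c | c ∈ Y' ∪ Y'.image g ∧ dist x c ≤ r} with hP
  have hxP : x ∈ P := ⟨by simp [hY', hx], by simp [r0.le]⟩
  obtain ⟨m, hm⟩ := h.exists_in_gap hN (P := P) ((Finset.finite_toSet _).subset fun c hc => hc.1)
    ⟨x, hxP⟩ hgx (fun c hc d hd => hu.dist_le (by rw [dist_comm]; exact hc.2) hd.2)
    (L := fun _ => False) (by simp)
  have hmP : ∀ c ∈ P, dist m c = r ∧ m < c := fun c hc => ⟨(hm c hc).1, (hm c hc).2.2 id⟩
  set W : Set M := {c | c ∈ Y' ∧ dist x c ≤ r} with hW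
  have hWP : ∀ c ∈ W, c ∈ P := fun c hc => ⟨Finset.mem_union_left _ hc.1, hc.2⟩
  have hgWP : ∀ c ∈ W, g c ∈ P := fun c hc => by
    refine ⟨Finset.mem_union_right _ (Finset.mem_image_of_mem _ hc.1), hu.dist_le (y := g x) le_rfl ?_⟩
    rw [← hd]
    exact (h.dist_le_of_mem_BP hg.1).1 hc.2
  have hmY : m ∉ Y' := fun hmY => by
    have h1 : m ∈ P := ⟨Finset.mem_union_left _ hmY, by rw [dist_comm, (hmP x hxP).1]⟩
    exact lt_irrefl _ (hmP m h1).2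
  have hex : ∀ b ∈ W, ∃ e, dist b e = r ∧ dist (g b) (g e) = r := by
    intro b hb
    rcases hb.2.lt_or_eq with h1 | h1
    · refine ⟨g x, ?_, ?_⟩
      · rw [hr]; exact hu.dist_eq (by rwa [dist_comm])
      · rw [← hd]
        refine hu.dist_eq ?_
        rw [dist_comm]
        exact (h.dist_lt_of_mem_BP hg.1).1 h1
    · refine ⟨x, by rwa [dist_comm], ?_⟩
      rw [dist_comm, ← hd]
      exact (h.dist_eq_of_mem_BP hg.1).1 h1
  have hout : ∀ c ∈ Y', c ∉ W → r < dist x c := fun c hc hcW => not_le.1 fun h => hcW ⟨hc, h⟩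
  have hf := (h.pIso_of_mem_BP hg.1 (insert x (Y' : Set M))).insert hu hu h.lab h.lab (x := m) (y := m)
    (W := W) hmY (fun y hy => hy.1) (Or.inl ⟨by simp [hY', hx], by simp [r0.le]⟩)
    (fun b hb => (hmP _ (hgWP b hb)).2.ne)
    (fun b hb => iff_of_true (hmP b (hWP b hb)).2 (hmP _ (hgWP b hb)).2)
    (fun b hb => by rw [h.lab.top hN, h.lab.top hN])
    (fun b hb => by rw [h.lab.top hN, h.lab.top hN])
    (fun b hb b' hb' => by rw [(hmP b (hWP b hb)).1, (hmP b' (hWP b' hb')).1])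
    (fun b hb b' hb' => by rw [(hmP _ (hgWP b hb)).1, (hmP _ (hgWP b' hb')).1])
    (fun b hb b' hb' => by
      rw [(hmP b (hWP b hb)).1, (hmP _ (hgWP b hb)).1]
      obtain ⟨e, h1, h2⟩ := hex b hb
      rw [← h1, h.dist_eq_of_mem_BP hg.1, h2, h1])
    (fun c hc hcW => by rw [(hmP x hxP).1]; exact hout c hc hcW)
    (fun c hc hcW => by
      rw [(hmP _ (hgWP x ⟨by simp [hY', hx], by simp [r0.le]⟩)).1, ← hd]
      exact (h.dist_lt_of_mem_BP hg.1).1 (hout c hc hcW))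
  have hmV : m ∈ V := (hV.mem_iff x hxV m).2 fun v hv => by
    rw [dist_comm, (hmP x hxP).1]
    exact hV.isClan x hxV (g x) ((suppIn_mem hg).2 hxV) v (hV.notMem hv)
  obtain ⟨e, he, he'⟩ := h.exists_suppIn_of_pIso hV hg (Y := insert m Y') (x := m)
    (by intro v hv; simp [hY', hv]) (by rw [Finset.coe_insert]; exact hf)
    (fun y hy hne => Function.update_of_ne hne _ _) hmV (by rwa [Function.update_self]) (by simp)
  refine ⟨m, hmV, e, he, fun y hy => ?_, by rw [he' m (by simp), Function.update_self],
    (hmP x hxP).1.le⟩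
  rw [he' y (by simp [hY', hy]), Function.update_of_ne]
  rintro rfl
  exact hmY (by simp [hY', hy])

/-- Let `W` be the set of points whose forward orbit stays within `r = dist x (g x)` of `x`. It is
an invariant clan without `x`. If it contains a given point, a fixed point is inserted just above
it. Otherwise a power `g ^ K` carries all given points farther than `r` from `x`, and the preimage
of `x` under `g ^ K` can be declared fixed. -/
theorem exists_fixed_of_dist_lt (h : IsRich N rk) (hV : IsCell V B) (hg : g ∈ suppIn (BP M) V)
    {Y : Finset M} {x : M} (hx : x ∈ Y) (hxV : x ∈ V)
    (hd : dist x (g x) < dist (g x) (g (g x))) : ∃ p ∈ V, ∃ g' ∈ suppIn (BP M) V,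
      (∀ y ∈ Y, g' y = g y) ∧ g' p = p ∧ dist p x ≤ dist x (g x) := by
  classical
  have hu := h.cu
  set r := dist x (g x) with hr
  set Y' := Y ∪ B with hY'
  have hpow : ∀ k : ℕ, g ^ k ∈ BP M := fun k => pow_mem hg.1 k
  have close : ∀ y, dist x y ≤ r → y ∈ V := fun y hy => (hV.mem_iff x hxV y).2 fun v hv =>
    hy.trans_lt (hV.isClan x hxV (g x) ((suppIn_mem hg).2 hxV) v (hV.notMem hv))
  have step : ∀ y, dist x (g y) ≤ r → dist x y ≤ r := fun y hy => by
    rw [h.dist_le_of_mem_BP hg.1]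
    exact (hu.dist_le (y := x) (by rw [dist_comm]) hy).trans hd.le
  have step' : ∀ k y, dist x ((g ^ k) y) ≤ r → dist x y ≤ r := fun k => by
    induction k with
    | zero => exact fun y hy => hy
    | succ k ih =>
      intro y hy
      rw [pow_succ, Equiv.Perm.mul_apply] at hy
      exact step y (ih _ hy)
  set W : Set M := {y | ∀ k : ℕ, dist x ((g ^ k) y) ≤ r} with hW
  have hgW : ∀ y, g y ∈ W ↔ y ∈ W := fun y => by
    simp only [hW, Set.mem_ofPred_eq]
    have e : ∀ k : ℕ, (g ^ k) (g y) = (g ^ (k + 1)) y := fun k => by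
      rw [pow_succ, Equiv.Perm.mul_apply]
    simp only [e]
    refine ⟨fun h k => step _ ?_, fun h k => h _⟩
    rw [← Equiv.Perm.mul_apply, ← pow_succ']
    exact h k
  have hWc : IsClan W := by
    intro w hw w' hw' c hc
    simp only [hW, Set.mem_ofPred_eq, not_forall, not_le] at hc
    obtain ⟨k, hk⟩ := hc
    rw [h.dist_lt_of_mem_BP (hpow k)]
    refine (hu.dist_le (y := x) (by rw [dist_comm]; exact hw k) (hw' k)).trans_lt ?_
    by_contra! h1
    exact not_le.2 hk (hu.dist_le (hw k) h1)
  have hxW : x ∉ W := fun hxW => by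
    have h1 := hxW 2
    rw [pow_two, Equiv.Perm.mul_apply] at h1
    exact not_le.2 hd (hu.dist_le (y := x) (by rw [dist_comm]) h1)
  by_cases hne : ∃ w ∈ Y', w ∈ W
  · obtain ⟨w, hwY, hw⟩ := hne
    obtain ⟨p, hp, e, he, h1, h2, h3, h4⟩ := h.exists_just_above hg.1 Y' hWc (fun y _ => hgW y) hwY hw
    have hwx : dist x w ≤ r := hw 0
    have hxp : dist x p ≤ r := by
      have := h4 x (by simp [hY', hx]) hxW
      exact hu.dist_le hwx (this.le.trans (by rwa [dist_comm]))
    have hpV := close p hxp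
    obtain ⟨k, hk, hk'⟩ := h.exists_suppIn_cell hV he (fun v hv => by
      rw [h1 v (by simp [hY', hv]), hg.2 v (hV.notMem hv)]) hpV (by rwa [h2])
    refine ⟨p, hpV, k, hk, fun y hy => ?_, by rw [hk' p hpV, h2], by rwa [dist_comm]⟩
    by_cases hyV : y ∈ V
    · rw [hk' y hyV, h1 y (by simp [hY', hy])]
    · rw [hk.2 y hyV, hg.2 y hyV]
  · have ev : ∀ᶠ K : ℕ in Filter.atTop, ∀ y ∈ Y', r < dist x ((g ^ K) y) := by
      rw [Filter.eventually_all_finset]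
      intro y hy
      have hyW : y ∉ W := fun hyW => hne ⟨y, hy, hyW⟩
      simp only [hW, Set.mem_ofPred_eq, not_forall, not_le] at hyW
      obtain ⟨k, hk⟩ := hyW
      filter_upwards [Filter.eventually_ge_atTop k] with K hK
      obtain ⟨j, rfl⟩ := Nat.exists_eq_add_of_le' hK
      by_contra! h1
      rw [pow_add, Equiv.Perm.mul_apply] at h1
      exact not_le.2 hk (step' j _ h1)
    obtain ⟨K, hK⟩ := ev.exists
    set p := (g ^ K)⁻¹ x with hp
    have hKp : (g ^ K) p = x := by rw [hp, apply_inv_apply]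
    have hxp : dist x p ≤ r := step' K p (by rw [hKp, dist_self]; exact dist_nonneg)
    have hpV := close p hxp
    have hpY : p ∉ Y' := fun hpY => by
      have := hK p hpY
      rw [hKp, dist_self] at this
      exact not_lt.2 dist_nonneg this
    -- Here `u = p` and `W` is empty. After transport by `g ^ K`, the points `p` and `g p` become
    -- `x` and `g x`, which are closer to each other than to the transported images, so from the
    -- images of `Y'` the value `p` looks like `g p`.
    have hf := (h.pIso_of_mem_BP hg.1 (insert p (Y' : Set M))).insert hu hu h.lab h.lab (x := p)
      (y := p) (W := ∅) hpY (Set.empty_subset _) (Or.inr rfl) (by simp) (by simp) (by simp) (by simp)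
      (by simp) (by simp) (by simp)
      (fun c hc _ => by
        rw [dist_self, dist_pos]
        rintro rfl; exact hpY hc)
      (fun c hc _ => by
        have comm : ∀ y, (g ^ K) (g y) = g ((g ^ K) y) := fun y => by
          rw [← Equiv.Perm.mul_apply, ← Equiv.Perm.mul_apply, ← pow_succ, pow_succ']
        rw [dist_comm, h.dist_lt_of_mem_BP (hpow K), comm, comm, hKp, dist_comm]
        exact hd.trans ((h.dist_lt_of_mem_BP hg.1).1 (hK c hc)))
    obtain ⟨e, he, he'⟩ := h.exists_suppIn_of_pIso hV hg (Y := insert p Y') (x := p)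
      (by intro v hv; simp [hY', hv]) (by rw [Finset.coe_insert]; exact hf)
      (fun y hy hne => Function.update_of_ne hne _ _) hpV (by rwa [Function.update_self]) (by simp)
    refine ⟨p, hpV, e, he, fun y hy => ?_, by rw [he' p (by simp), Function.update_self],
      by rwa [dist_comm]⟩
    rw [he' y (by simp [hY', hy]), Function.update_of_ne]
    rintro rfl
    exact hpY (by simp [hY', hy])

/-- Comparing the first two steps of the orbit shows whether it spreads under `g`, under `g⁻¹`, or
stays at one node. The bound on `dist p x` is what makes `resolvable_cell` inductive: it keeps `x`
out of the smaller cells. -/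
theorem exists_fixed (h : IsRich N rk) (hV : IsCell V B) (hg : g ∈ suppIn (BP M) V)
    {Y : Finset M} {x : M} (hx : x ∈ Y) (hxV : x ∈ V) : ∃ p ∈ V, ∃ g' ∈ suppIn (BP M) V,
      (∀ y ∈ Y, g' y = g y) ∧ g' p = p ∧ (p = x ∨ dist p x ≤ dist x (g x)) := by
  classical
  by_cases hgx : x = g x
  · exact ⟨x, hxV, g, hg, fun _ _ => rfl, hgx.symm, Or.inl rfl⟩
  have conv : (∃ p ∈ V, ∃ g' ∈ suppIn (BP M) V,
      (∀ y ∈ Y, g' y = g y) ∧ g' p = p ∧ dist p x ≤ dist x (g x)) → ∃ p ∈ V, ∃ g' ∈ suppIn (BP M) V,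
      (∀ y ∈ Y, g' y = g y) ∧ g' p = p ∧ (p = x ∨ dist p x ≤ dist x (g x)) := by
    rintro ⟨p, hp, g', hg', h1, h2, h3⟩
    exact ⟨p, hp, g', hg', h1, h2, Or.inr h3⟩
  apply conv
  rcases lt_trichotomy (dist (g x) (g (g x))) (dist x (g x)) with h1 | h1 | h1
  · have hgi := inv_mem hg
    obtain ⟨p, hp, k, hk, k1, k2, k3⟩ := h.exists_fixed_of_dist_lt hV hgi
      (Finset.mem_image_of_mem g hx) ((suppIn_mem hg).2 hxV) (by
        rw [inv_apply_apply, dist_comm, h.dist_lt_of_mem_BP hg.1, apply_inv_apply, dist_comm (g x) x]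
        exact h1)
    rw [inv_apply_apply] at k3
    refine ⟨p, hp, k⁻¹, inv_mem hk, fun y hy => ?_, ?_, ?_⟩
    · rw [Equiv.Perm.inv_eq_iff_eq, k1 _ (Finset.mem_image_of_mem g hy), inv_apply_apply]
    · rw [Equiv.Perm.inv_eq_iff_eq, k2]
    · rw [dist_comm x]
      exact h.cu.dist_le k3 le_rfl
  · exact h.exists_fixed_of_dist_eq hV hg hx hxV hgx h1
  · exact h.exists_fixed_of_dist_lt hV hg hx hxV h1

/-- Any two automorphisms of a cell can be amalgamated. -/
theorem isAmalgBase_cell (h : IsRich N rk) (hV : IsCell V B) (g₀ : Equiv.Perm M) :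
    IsAmalgBase (BP M) V ∅ g₀ := by
  classical
  intro g₁ hg₁ g₂ hg₂ _ _ Y₁ Y₂
  obtain ⟨x, hx⟩ := hV.nonempty
  -- Once both automorphisms fix a point, and the same one after conjugation, they act on one line,
  -- where amalgamation is free.
  obtain ⟨p, hp, k₁, hk₁, a1, a2, -⟩ := h.exists_fixed hV hg₁ (Y := insert x Y₁) (by simp) hx
  obtain ⟨q, hq, k₂, hk₂, b1, b2, -⟩ := h.exists_fixed hV hg₂ (Y := insert x Y₂) (by simp) hx
  -- move `q` to `p`
  obtain ⟨e, he, heq⟩ : ∃ e ∈ suppIn (BP M) V, e q = p := by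
    have hf := (h.pIso_of_mem_BP (BP M).one_mem (insert p (B : Set M))).insert h.cu h.cu h.lab h.lab
      (x := q) (y := p) (W := ∅) (fun hqB => hV.notMem hqB hq) (Set.empty_subset _) (Or.inr rfl)
      (by simp) (by simp) (by simp) (by simp) (by simp) (by simp) (by simp)
      (fun c hc _ => by
        rw [dist_comm]
        exact hV.isClan p hp q hq c (hV.notMem hc))
      (fun c hc _ => by
        simpa using hV.isClan p hp p hp c (hV.notMem hc))
    obtain ⟨e, he, he'⟩ := h.exists_suppIn_of_pIso hV (one_mem _) (Y := insert q B) (x := q)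
      (by intro v hv; simp [hv]) (by rw [Finset.coe_insert]; exact hf)
      (fun y hy hne => Function.update_of_ne hne _ _) hq (by rwa [Function.update_self]) (by simp)
    exact ⟨e, he, by rw [he' q (by simp), Function.update_self]⟩
  have hc : e * k₂ * e⁻¹ ∈ suppIn (BP M) V := mul_mem (mul_mem he hk₂) (inv_mem he)
  have hcp : (e * k₂ * e⁻¹) p = p := by
    have : e⁻¹ p = q := by rw [Equiv.Perm.inv_eq_iff_eq, heq]
    simp only [Equiv.Perm.mul_apply]
    rw [this, b2, heq]
  obtain ⟨u, hu, t, ht, -, c1, c2⟩ := (h.isLine_cell hV hp).isAmalgBase_empty 1 k₁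
    (suppIn_fixing hk₁ a2) _ (suppIn_fixing hc hcp) (by simp) (by simp) Y₁ (Y₂.image e)
  refine ⟨u, suppIn_mono Set.sdiff_subset hu, t * e, mul_mem (suppIn_mono Set.sdiff_subset ht) he,
    by simp, fun y hy => by rw [c1 y hy, a1 y (by simp [hy])], fun y hy => ?_⟩
  have := c2 _ (Finset.mem_image_of_mem e hy)
  simp only [Equiv.Perm.mul_apply, inv_apply_apply] at this ⊢
  rw [this, b1 y (by simp [hy])]

end IsRich

/-! ### Spheres -/

/-- The points at distance `r` from `p` on one side of `p`. -/
def sphereSide {M : Type v} [MetricSpace M] [LinearOrder M] (p : M) (r : ℝ) (b : Prop) : Set M :=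
  {x | dist p x = r ∧ (p < x ↔ b)}

namespace IsRich

variable {N : ℕ∞} {M : Type v} [MetricSpace M] [LinearOrder M] {rk : M → ℝ → ℕ} {V : Set M}
  {B : Finset M} {g : Equiv.Perm M} {p : M} {r : ℝ} {b : Prop}

/-- Either `c` is in the open ball of `p` and looks like `p` from `d`, or `p` lies between `c` and
`d` and convexity gives the distance. -/
theorem sphereSide_of_notMem (h : IsRich N rk) (hr : 0 < r) {c d : M} (hc : c ∉ sphereSide p r b)
    (hcr : dist p c ≤ r) (hd : d ∈ sphereSide p r b) : dist c d = r ∧ (c < d ↔ b) := by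
  have hu := h.cu
  rcases hcr.lt_or_eq with h1 | h1
  · have h2 : dist c p < dist p d := by rw [dist_comm, hd.1]; exact h1
    rw [hu.dist_eq h2, hu.lt_iff h2]
    exact hd
  · have hpc : p ≠ c := dist_pos.1 (h1 ▸ hr)
    have hpd : p ≠ d := dist_pos.1 (hd.1 ▸ hr)
    have hle : dist c d ≤ r := hu.dist_le (y := p) (by rw [dist_comm, h1]) hd.1.le
    have hcs : ¬ (p < c ↔ b) := fun h2 => hc ⟨h1, h2⟩
    by_cases hb : b
    · have h2 : c < p := lt_of_le_of_ne (not_lt.1 fun h3 => hcs (iff_of_true h3 hb)) hpc.symm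
      have h3 : p < d := hd.2.2 hb
      refine ⟨le_antisymm hle ?_, iff_of_true (h2.trans h3) hb⟩
      rw [← h1, dist_comm p]
      exact hu.cv _ _ _ h2 h3
    · have h2 : p < c := by
        by_contra h3
        exact hcs (iff_of_false h3 hb)
      have h3 : d < p := lt_of_le_of_ne (not_lt.1 fun h4 => hb (hd.2.1 h4)) hpd.symm
      refine ⟨le_antisymm hle ?_, iff_of_false (h3.trans h2).asymm hb⟩
      rw [← hd.1, dist_comm p, dist_comm c]
      exact hu.cv _ _ _ h3 h2

theorem mem_sphereSide_iff (h : IsRich N rk) (hg : g ∈ BP M) (hgp : g p = p) {q : M}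
    (hq : dist p q = r) (hgq : dist p (g q) = r) (x : M) :
    g x ∈ sphereSide p r b ↔ x ∈ sphereSide p r b := by
  simp only [sphereSide, Set.mem_ofPred_eq]
  have h1 : dist p (g x) = r ↔ dist p x = r := by
    have := h.dist_eq_of_mem_BP hg (x := p) (y := x) (z := q)
    rw [hgp, hq, hgq] at this
    exact this.symm
  have h2 : p < g x ↔ p < x := by
    conv_lhs => rw [← hgp]
    exact hg.2.lt_iff_lt
  rw [h1, h2]

/-- `L` need not be a clan, since the distance `r` occurs both inside it and towards the outside.
Gluing still works: each outside point has one order relation to all of `L` and one distance, at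
least `r`, while distances inside `L` are at most `r`, and the value `r` is preserved. -/
theorem exists_glue_sphereSide (h : IsRich N rk) (hr : 0 < r) (hg : g ∈ BP M) (hgp : g p = p)
    {L : Set M} (hL : L ⊆ sphereSide p r b)
    (hlow : ∀ x ∈ L, ∀ y ∈ sphereSide p r b, (y ≤ x ∨ dist y x < r) → y ∈ L)
    (hgL : ∀ x, g x ∈ L ↔ x ∈ L) : ∃ g' ∈ suppIn (BP M) L, ∀ x ∈ L, g' x = g x := by
  have hu := h.cu
  have dpv : ∀ v ∈ L, dist v p = r := fun v hv => by rw [dist_comm]; exact (hL hv).1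
  have dvv : ∀ v ∈ L, ∀ v' ∈ L, dist v v' ≤ r := fun v hv v' hv' =>
    hu.dist_le (dpv v hv).le (hL hv').1.le
  have key : ∀ x, x ∉ L → ∀ v ∈ L, ∀ v' ∈ L, r ≤ dist x v ∧ dist x v = dist x v' ∧ (x < v ↔ x < v') := by
    intro x hx v hv v' hv'
    by_cases hxV : x ∈ sphereSide p r b
    · have aux : ∀ v ∈ L, dist x v = r ∧ v < x := fun v hv => by
        have h1 : ¬ (x ≤ v ∨ dist x v < r) := fun h1 => hx (hlow v hv x hxV h1)
        rw [not_or, not_le, not_lt] at h1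
        exact ⟨le_antisymm (hu.dist_le (y := p) (by rw [dist_comm, hxV.1]) (hL hv).1.le) h1.2, h1.1⟩
      obtain ⟨a1, a2⟩ := aux v hv
      obtain ⟨b1, b2⟩ := aux v' hv'
      exact ⟨a1.ge, by rw [a1, b1], iff_of_false a2.asymm b2.asymm⟩
    · by_cases hxr : dist p x ≤ r
      · obtain ⟨a1, a2⟩ := h.sphereSide_of_notMem hr hxV hxr (hL hv)
        obtain ⟨b1, b2⟩ := h.sphereSide_of_notMem hr hxV hxr (hL hv')
        exact ⟨a1.ge, by rw [a1, b1], by rw [a2, b2]⟩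
      · rw [not_le] at hxr
        have aux : ∀ v ∈ L, dist x v = dist p x ∧ (x < v ↔ ¬ p < x) := fun v hv => by
          have h1 : dist v p < dist p x := by rwa [dpv v hv]
          refine ⟨by rw [dist_comm x]; exact hu.dist_eq h1, ?_⟩
          rw [← hu.lt_iff h1, not_lt]
          have : x ≠ v := by rintro rfl; exact hx hv
          exact ⟨le_of_lt, fun h => lt_of_le_of_ne h this⟩
        obtain ⟨a1, a2⟩ := aux v hv
        obtain ⟨b1, b2⟩ := aux v' hv'
        exact ⟨by rw [a1]; exact hxr.le, by rw [a1, b1], by rw [a2, b2]⟩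
  refine h.exists_glue hg hgL (fun x hx v hv => ?_) fun x hx v hv v' hv' => ?_
  · obtain ⟨-, h1, h2⟩ := key x hx v hv (g v) ((hgL v).2 hv)
    exact ⟨h2, h1⟩
  · have hgv := (hgL v).2 hv
    obtain ⟨h0, h1, -⟩ := key x hx v hv (g v) hgv
    rw [dist_comm v x, dist_comm (g v) x, ← h1]
    have i1 := dvv v hv v' hv'
    have i2 := dvv _ hgv _ ((hgL v').2 hv')
    refine ⟨iff_of_true (i1.trans h0) (i2.trans h0), ?_⟩
    have e : dist v v' = r ↔ dist (g v) (g v') = r := by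
      have := h.dist_eq_of_mem_BP hg (x := v) (y := v') (z := p)
      rwa [hgp, dpv v hv, dpv _ hgv] at this
    constructor
    · intro h2
      have h3 : dist v v' = r := le_antisymm i1 (h0.trans h2)
      rw [e.1 h3]; exact h2.trans i1
    · intro h2
      have h3 : dist (g v) (g v') = r := le_antisymm i2 (h0.trans h2)
      rw [e.2 h3]; exact h2.trans i2

/-- The preorder compares the open `r`-balls on one side of `p`, that is, the children of a node.
Elements supported there fix `p`, hence preserve both `r` and closeness below `r`. Labels are
trivial for `N = ⊤`, so any point can be a marker. -/
theorem isLine_sphereSide (h : IsRich N rk) (hN : N = ⊤) {q : M} (hpq : p ≠ q) (hq : dist p q = r) :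
    IsLine (BP M) (sphereSide p r b) (fun x y => x ≤ y ∨ dist x y < r) Set.univ := by
  classical
  have hu := h.cu
  have hr : 0 < r := by rw [← hq]; exact dist_pos.2 hpq
  have hp : p ∉ sphereSide p r b := fun hp => by
    have := hp.1
    rw [dist_self] at this; exact hr.ne this
  have dV : ∀ x ∈ sphereSide p r b, ∀ y ∈ sphereSide p r b, dist x y ≤ r := fun x hx y hy =>
    hu.dist_le (y := p) (by rw [dist_comm, hx.1]) hy.1.le
  have nle : ∀ x ∈ sphereSide p r b, ∀ y ∈ sphereSide p r b, ¬ (y ≤ x ∨ dist y x < r) →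
      x < y ∧ dist x y = r := fun x hx y hy hxy => by
    rw [not_or, not_le, not_lt] at hxy
    exact ⟨hxy.1, le_antisymm (dV x hx y hy) (by rw [dist_comm]; exact hxy.2)⟩
  have nle' : ∀ x y : M, x < y → dist x y = r → ¬ (y ≤ x ∨ dist y x < r) := fun x y h1 h2 => by
    rw [not_or, not_le, not_lt, dist_comm]
    exact ⟨h1, h2.ge⟩
  -- elements fixing `p` and preserving the radius, restricted to the line
  have restr : ∀ {e : Equiv.Perm M}, e ∈ BP M → e p = p → (∃ x, dist p x = r ∧ dist p (e x) = r) →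
      ∃ e' ∈ suppIn (BP M) (sphereSide p r b), ∀ x ∈ sphereSide p r b, e' x = e x := by
    rintro e he hep ⟨x, hx, hx'⟩
    exact h.exists_glue_sphereSide hr he hep subset_rfl (fun _ _ y hy _ => hy)
      (h.mem_sphereSide_iff he hep hx hx')
  refine ⟨fun x _ y _ => ?_, fun x _ y _ z _ hxy hyz => ?_, fun g hg x hx y _ hxy => ?_,
    fun L hL hlow g hg hgL => h.exists_glue_sphereSide hr hg.1 (hg.2 p hp) hL hlow hgL,
    fun g hg L hL hlow hgL Y => ?_, fun f hf f' hf' _ _ A hA => ?_⟩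
  · exact (le_total x y).imp Or.inl Or.inl
  · rcases le_or_gt x z with h1 | h1
    · exact Or.inl h1
    · refine Or.inr ?_
      rcases hxy with hxy | hxy <;> rcases hyz with hyz | hyz
      · exact absurd (hxy.trans hyz) (not_le.2 h1)
      · rcases hxy.eq_or_lt with rfl | hxy
        · exact hyz
        · rw [dist_comm x]
          refine (hu.cv z x y h1 hxy).trans_lt ?_
          rwa [dist_comm]
      · rcases hyz.eq_or_lt with rfl | hyz
        · exact hxy
        · rw [dist_comm x]
          refine (hu.cv' hyz h1).trans_lt ?_
          rwa [dist_comm]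
      · exact hu.dist_lt hxy hyz
  · rcases hxy with hxy | hxy
    · exact Or.inl (hg.1.2.monotone hxy)
    · have hgx := (suppIn_mem hg).2 hx
      have h1 : dist x y < dist x p := by rwa [dist_comm x p, hx.1]
      rw [h.dist_lt_of_mem_BP hg.1, hg.2 p hp, dist_comm _ p, hgx.1] at h1
      exact Or.inr h1
  · have hgp := hg.2 p hp
    set Y' := insert p Y with hY'
    set P : Set M := {c | c ∈ Y' ∪ Y'.image g ∧ dist p c ≤ r} with hP
    have hpP : p ∈ P := ⟨by simp [hY'], by simp [hr.le]⟩
    -- The marker goes above `L`. It also goes above the points of the closed ball off this side if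
    -- the side is the upper one, and below them otherwise.
    obtain ⟨m, hm⟩ := h.exists_in_gap hN (P := P) ((Finset.finite_toSet _).subset fun c hc => hc.1)
      ⟨p, hpP⟩ hpq (fun c hc d hd => by
        rw [hq]; exact hu.dist_le (by rw [dist_comm]; exact hc.2) hd.2)
      (L := fun c => c ∈ L ∨ c ∉ sphereSide p r b ∧ b) (by
        rw [hq]
        rintro c hc hcL d hd hdL
        rw [not_or, not_and] at hdL
        by_cases hcV : c ∈ sphereSide p r b <;> by_cases hdV : d ∈ sphereSide p r b
        · have hcL' := hcL.resolve_right fun h => h.1 hcV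
          exact nle c hcV d hdV fun h => hdL.1 (hlow c hcL' d hdV h)
        · have hb := hdL.2 hdV
          obtain ⟨h1, h2⟩ := h.sphereSide_of_notMem hr hdV hd.2 hcV
          have hne : c ≠ d := by rintro rfl; exact hdV hcV
          refine ⟨lt_of_le_of_ne (not_lt.1 fun h => hb (h2.1 h)) hne, by rwa [dist_comm]⟩
        · have hb := (hcL.resolve_left fun h => hcV (hL h)).2
          obtain ⟨h1, h2⟩ := h.sphereSide_of_notMem hr hcV hc.2 hdV
          exact ⟨h2.2 hb, h1⟩
        · exact absurd (hcL.resolve_left fun h => hcV (hL h)).2 (hdL.2 hdV))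
    rw [hq] at hm
    have hiff : ∀ c ∈ P, m < c ↔ ¬ (c ∈ L ∨ c ∉ sphereSide p r b ∧ b) := fun c hc =>
      ⟨fun h1 h2 => h1.asymm ((hm c hc).2.1 h2), (hm c hc).2.2⟩
    have hmV : m ∈ sphereSide p r b := by
      obtain ⟨h1, h2, h3⟩ := hm p hpP
      refine ⟨by rwa [dist_comm], ?_⟩
      by_cases hb : b
      · exact iff_of_true (h2 (Or.inr ⟨hp, hb⟩)) hb
      · refine iff_of_false (h3 ?_).asymm hb
        rintro (h4 | h4)
        · exact hp (hL h4)
        · exact hb h4.2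
    set W : Set M := {c | c ∈ Y' ∧ dist p c ≤ r} with hW
    have hWP : ∀ c ∈ W, c ∈ P := fun c hc => ⟨Finset.mem_union_left _ hc.1, hc.2⟩
    have hgWP : ∀ c ∈ W, g c ∈ P := fun c hc => by
      refine ⟨Finset.mem_union_right _ (Finset.mem_image_of_mem _ hc.1), ?_⟩
      by_cases hcV : c ∈ sphereSide p r b
      · exact ((suppIn_mem hg).2 hcV).1.le
      · rw [hg.2 c hcV]; exact hc.2
    have hmY : m ∉ Y' := fun hmY => by
      have := (hm m ⟨Finset.mem_union_left _ hmY, hmV.1.le⟩).1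
      rw [dist_self] at this
      exact hr.ne this
    have hout : ∀ c ∈ Y', c ∉ W → r < dist p c := fun c hc hcW => not_le.1 fun h => hcW ⟨hc, h⟩
    have hf := (h.pIso_of_mem_BP hg.1 (insert p (Y' : Set M))).insert hu hu h.lab h.lab (x := m)
      (y := m) (W := W) hmY (fun y hy => hy.1) (Or.inl ⟨by simp [hY'], by simp [hr.le]⟩)
      (fun c hc => by
        refine dist_pos.1 ?_
        rw [(hm _ (hgWP c hc)).1]; exact hr)
      (fun c hc => by
        rw [hiff c (hWP c hc), hiff _ (hgWP c hc), hgL, suppIn_mem hg])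
      (fun c hc => by rw [h.lab.top hN, h.lab.top hN])
      (fun c hc => by rw [h.lab.top hN, h.lab.top hN])
      (fun c hc d hd => by rw [(hm c (hWP c hc)).1, (hm d (hWP d hd)).1])
      (fun c hc d hd => by rw [(hm _ (hgWP c hc)).1, (hm _ (hgWP d hd)).1])
      (fun c hc d hd => by
        rw [(hm c (hWP c hc)).1, (hm _ (hgWP c hc)).1]
        by_cases hcV : c ∈ sphereSide p r b
        · have h1 : dist c p = r := by rw [dist_comm]; exact hcV.1
          have h2 : dist (g c) p = r := by rw [dist_comm]; exact ((suppIn_mem hg).2 hcV).1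
          have := h.dist_eq_of_mem_BP hg.1 (x := c) (y := d) (z := p)
          rwa [hgp, h1, h2] at this
        · rw [hg.2 c hcV]
          by_cases hdV : d ∈ sphereSide p r b
          · rw [(h.sphereSide_of_notMem hr hcV hc.2 hdV).1,
              (h.sphereSide_of_notMem hr hcV hc.2 ((suppIn_mem hg).2 hdV)).1]
          · rw [hg.2 d hdV])
      (fun c hc hcW => by rw [(hm p hpP).1]; exact hout c hc hcW)
      (fun c hc hcW => by
        have hcV : c ∉ sphereSide p r b := fun hcV => (hout c hc hcW).ne hcV.1.symm
        rw [hgp, (hm p hpP).1, hg.2 c hcV]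
        exact hout c hc hcW)
    obtain ⟨e, he, he'⟩ := h.exists_extension (insert m Y') (by rw [Finset.coe_insert]; exact hf)
    have heY : ∀ y ∈ Y', e y = g y := fun y hy => by
      rw [he' y (by simp [hy]), Function.update_of_ne]
      rintro rfl; exact hmY hy
    have hem : e m = m := by rw [he' m (by simp), Function.update_self]
    obtain ⟨k, hk, hk'⟩ := restr he (by rw [heY p (by simp [hY']), hgp])
      ⟨m, hmV.1, by rw [hem]; exact hmV.1⟩
    have hYP : ∀ y ∈ Y, y ∈ sphereSide p r b → y ∈ P := fun y hy hyV =>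
      ⟨by simp [hY', hy], hyV.1.le⟩
    refine ⟨k, hk, m, hmV, Set.mem_univ _, fun y hy => ?_, by rw [hk' m hmV, hem], fun y hy hyL => ?_,
      fun y hy hyV hyL => ?_⟩
    · by_cases hyV : y ∈ sphereSide p r b
      · rw [hk' y hyV, heY y (by simp [hY', hy])]
      · rw [hk.2 y hyV, hg.2 y hyV]
    · obtain ⟨h1, h2, -⟩ := hm y (hYP y hy (hL hyL))
      exact nle' y m (h2 (Or.inl hyL)) (by rwa [dist_comm])
    · obtain ⟨h1, -, h2⟩ := hm y (hYP y hy hyV)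
      exact nle' m y (h2 fun h => h.elim hyL fun h => h.1 hyV) h1
  · set Y : Finset M := insert p A with hY
    set W : Set M := {c | c ∈ Y ∧ dist p c ≤ r} with hW
    have key : ∀ c ∈ W, dist f c = r ∧ dist f' c = r ∧ (f < c ↔ f' < c) := by
      intro c hc
      by_cases hcV : c ∈ sphereSide p r b
      · have hcA : c ∈ A := by
          rcases Finset.mem_insert.1 hc.1 with rfl | h1
          · exact absurd hcV hp
          · exact h1
        rcases hA c hcA hcV with h1 | h1
        · obtain ⟨a1, a2⟩ := nle c hcV f hf h1.1
          obtain ⟨b1, b2⟩ := nle c hcV f' hf' h1.2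
          exact ⟨by rwa [dist_comm], by rwa [dist_comm], iff_of_false a1.asymm b1.asymm⟩
        · obtain ⟨a1, a2⟩ := nle f hf c hcV h1.1
          obtain ⟨b1, b2⟩ := nle f' hf' c hcV h1.2
          exact ⟨a2, b2, iff_of_true a1 b1⟩
      · obtain ⟨a1, a2⟩ := h.sphereSide_of_notMem hr hcV hc.2 hf
        obtain ⟨b1, b2⟩ := h.sphereSide_of_notMem hr hcV hc.2 hf'
        have n1 : f ≠ c := by rintro rfl; exact hcV hf
        have n2 : f' ≠ c := by rintro rfl; exact hcV hf'
        refine ⟨by rwa [dist_comm], by rwa [dist_comm], ?_⟩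
        rw [← not_le, ← not_le, not_iff_not, le_iff_lt_or_eq, le_iff_lt_or_eq, a2, b2]
        simp [n1.symm, n2.symm]
    have hfY : f ∉ Y := fun hfY => by
      have := (key f ⟨hfY, hf.1.le⟩).1
      rw [dist_self] at this
      exact hr.ne this
    have hout : ∀ c ∈ Y, c ∉ W → r < dist p c := fun c hc hcW => not_le.1 fun h => hcW ⟨hc, h⟩
    have hext := (h.pIso_of_mem_BP (BP M).one_mem (insert p (Y : Set M))).insert hu hu h.lab h.lab
      (x := f) (y := f') (W := W) hfY (fun y hy => hy.1) (Or.inl ⟨by simp [hY], by simp [hr.le]⟩)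
      (fun c hc => by
        refine dist_pos.1 ?_
        rw [Equiv.Perm.one_apply, (key c hc).2.1]; exact hr)
      (fun c hc => (key c hc).2.2)
      (fun c hc => by rw [h.lab.top hN, h.lab.top hN])
      (fun c hc => by rw [h.lab.top hN, h.lab.top hN])
      (fun c hc d hd => by rw [(key c hc).1, (key d hd).1])
      (fun c hc d hd => by
        rw [Equiv.Perm.one_apply, Equiv.Perm.one_apply, (key c hc).2.1, (key d hd).2.1])
      (fun c hc d hd => by
        rw [Equiv.Perm.one_apply, Equiv.Perm.one_apply, (key c hc).1, (key c hc).2.1])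
      (fun c hc hcW => by rw [dist_comm f, hf.1]; exact hout c hc hcW)
      (fun c hc hcW => by
        rw [Equiv.Perm.one_apply, Equiv.Perm.one_apply, dist_comm f', hf'.1]; exact hout c hc hcW)
    obtain ⟨e, he, he'⟩ := h.exists_extension (insert f Y) (by rw [Finset.coe_insert]; exact hext)
    have heY : ∀ y ∈ Y, e y = y := fun y hy => by
      rw [he' y (by simp [hy]), Function.update_of_ne, Equiv.Perm.one_apply]
      rintro rfl; exact hfY hy
    have hef : e f = f' := by rw [he' f (by simp), Function.update_self]
    obtain ⟨k, hk, hk'⟩ := restr he (heY p (by simp [hY])) ⟨f, hf.1, by rw [hef]; exact hf'.1⟩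
    refine ⟨k, hk, fun a ha => ?_, ?_⟩
    · by_cases haV : a ∈ sphereSide p r b
      · rw [hk' a haV, heY a (by simp [hY, ha])]
      · exact hk.2 a haV
    · rw [hk' f hf, hef]
      exact ⟨Or.inl le_rfl, Or.inl le_rfl⟩

end IsRich

theorem resolvable_empty {M : Type v} (G : Subgroup (Equiv.Perm M)) (g : Equiv.Perm M) (Y : Finset M) :
    Resolvable G ∅ g Y := by
  refine ⟨1, one_mem _, ∅, by simp, by simp, ?_⟩
  intro g₁ hg₁ g₂ hg₂ _ _ Y₁ Y₂
  exact ⟨1, one_mem _, 1, one_mem _, by simp, fun y _ => (hg₁.2 y (Set.notMem_empty y)).symm,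
    fun y _ => (hg₂.2 y (Set.notMem_empty y)).symm⟩

/-! ### Resolution on spheres and the induction over cells. -/

namespace IsRich

variable {N : ℕ∞} {M : Type v} [MetricSpace M] [LinearOrder M] {rk : M → ℝ → ℕ} {V : Set M}
  {B : Finset M} {g : Equiv.Perm M} {p q : M} {r : ℝ}

/-- The part of a sphere with labels in `J`, for finite `N`. -/
theorem resolvable_labelled (h : IsRich N rk) (hN : N ≠ ⊤) (hpq : p ≠ q) (hq : dist p q = r)
    (hg : g ∈ BP M) (hgp : g p = p) {Y : Finset M} (hY : ∀ y ∈ Y, dist p y = r → dist p (g y) = r)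
    (hC : ∀ y ∈ Y, dist p y = r → dist y (g y) < r → Resolvable (BP M) {x | dist y x < r} g Y)
    (J : Finset ℕ) : Resolvable (BP M) {x | dist p x = r ∧ rk x r ∈ J} g Y := by
  classical
  have hu := h.cu
  have hr : 0 < r := hq ▸ dist_pos.2 hpq
  have hrk : ∀ {u : Equiv.Perm M}, u ∈ BP M → u p = p → ∀ x, dist p x = r → dist p (u x) = r →
      rk (u x) r = rk x r := fun {u} hu hup x hx hux => by
    have hxp : x ≠ p := by
      rintro rfl
      rw [dist_self] at hx; exact hr.ne hx
    have := h.rk_of_mem_BP hu hxp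
    rw [hup, dist_comm, hx, dist_comm, hux] at this
    exact this.symm
  have cell : ∀ x y, dist p x = r → dist p y = r → (rk x r = rk y r ↔ dist x y < r) :=
    fun x y hx hy => by
    refine ⟨fun e => ?_, fun e => h.lab.congr _ _ _ e⟩
    by_contra! h1
    have h2 : dist x y = r := le_antisymm (hu.dist_le (y := p) (by rw [dist_comm, hx]) hy.le) h1
    refine h.lab.ne hN (x := x) (y := y) ?_ (by rw [h2, e])
    rintro rfl
    rw [dist_self] at h2; exact hr.ne h2
  have sph : ∀ x y, dist p x = r → dist x y < r → dist p y = r := fun x y hx hxy => by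
    have h1 : dist y x < dist x p := by rwa [dist_comm y, dist_comm x p, hx]
    rw [dist_comm, hu.dist_eq h1, dist_comm, hx]
  -- Elements fixing `p` and preserving the radius preserve labels, so the ball with label `j` is
  -- invariant and can be split off.
  induction J using Finset.induction_on with
  | empty =>
    have : {x | dist p x = r ∧ rk x r ∈ (∅ : Finset ℕ)} = ∅ := by ext; simp
    rw [this]
    exact resolvable_empty _ _ _
  | insert j J hj ih =>
    have hclan : IsClan {x | dist p x = r ∧ rk x r = j} := fun x hx y hy c hc => by
      have h1 := (cell x y hx.1 hy.1).1 (hx.2.trans hy.2.symm)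
      refine h1.trans_le (not_lt.1 fun h2 => hc ?_)
      have := sph x c hx.1 h2
      exact ⟨this, by rw [← (cell x c hx.1 this).2 h2, hx.2]⟩
    have res : Resolvable (BP M) {x | dist p x = r ∧ rk x r = j} g Y := by
      have hset : ∀ y, dist p y = r → rk y r = j →
          {x | dist p x = r ∧ rk x r = j} = {x | dist y x < r} := fun y hy hyj => by
        ext x
        refine ⟨fun hx => (cell y x hy hx.1).1 (hyj.trans hx.2.symm), fun hx => ?_⟩
        have := sph y x hy hx
        exact ⟨this, by rw [← (cell y x hy this).2 hx, hyj]⟩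
      by_cases hne : ∃ y ∈ Y, dist p y = r ∧ rk y r = j
      · obtain ⟨y, hy, h1, h2⟩ := hne
        rw [hset y h1 h2]
        have h3 := hY y hy h1
        exact hC y hy h1 ((cell y _ h1 h3).1 (hrk hg hgp y h1 h3).symm)
      · by_cases hne' : ∃ y, dist p y = r ∧ rk y r = j
        · obtain ⟨y, h1, h2⟩ := hne'
          refine ⟨1, one_mem _, ∅, by simp, fun z hz hzV => absurd ⟨z, hz, hzV⟩ hne, ?_⟩
          have hc := h.isCell_ball (y := y) (p := p) (by
            rintro rfl
            rw [dist_self] at h1; exact hr.ne h1)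
          rw [dist_comm y p, h1] at hc
          rw [hset y h1 h2]
          exact h.isAmalgBase_cell hc 1
        · have : {x | dist p x = r ∧ rk x r = j} = ∅ := by
            ext x
            exact iff_of_false (fun hx => hne' ⟨x, hx⟩) (Set.notMem_empty x)
          rw [this]
          exact resolvable_empty _ _ _
    refine res.union ih (fun x hx => ⟨hx.1, by simp [hx.2]⟩) (fun x hx => ⟨hx.1, by simp [hx.2]⟩)
      (fun x hx => (Finset.mem_insert.1 hx.2).imp (fun h => ⟨hx.1, h⟩) fun h => ⟨hx.1, h⟩)
      (fun x hx hx' => hj (hx.2 ▸ hx'.2)) fun u hu _ => ?_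
    have hup : u p = p := hu.2 p fun hp => hr.ne (by rw [← hp.1, dist_self])
    have hpres : ∀ x, dist p x = r → rk x r ∈ insert j J → dist p (u x) = r := fun x h1 h2 =>
      ((suppIn_mem hu).2 (show x ∈ {x | dist p x = r ∧ rk x r ∈ insert j J} from ⟨h1, h2⟩)).1
    obtain ⟨a, ha, ha'⟩ := h.exists_glue_clan hclan hu.1 (fun x => by
      constructor
      · intro hx
        have hxV : x ∈ {x | dist p x = r ∧ rk x r ∈ insert j J} :=
          (suppIn_mem hu).1 ⟨hx.1, by simp [hx.2]⟩
        exact ⟨hxV.1, by rw [← hrk hu.1 hup x hxV.1 hx.1, hx.2]⟩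
      · intro hx
        have h1 := hpres x hx.1 (by simp [hx.2])
        exact ⟨h1, by rw [hrk hu.1 hup x hx.1 h1, hx.2]⟩)
    exact exists_mul_of_restrict (fun x hx => (Finset.mem_insert.1 hx.2).imp (fun h => ⟨hx.1, h⟩)
      fun h => ⟨hx.1, h⟩) hu ha ha'

/-- For `N = ⊤` each side of `p` is a line whose classes are open `r`-balls. For finite `N` the
sphere consists of finitely many such balls, each invariant by its label. Either way only the balls
sent to themselves remain. -/
theorem resolvable_sphere (h : IsRich N rk) (hpq : p ≠ q) (hq : dist p q = r)
    (hg : g ∈ BP M) (hgp : g p = p) {Y : Finset M} (hgq : dist p (g q) = r)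
    (hC : ∀ y ∈ Y, dist p y = r → dist y (g y) < r → Resolvable (BP M) {x | dist y x < r} g Y) :
    Resolvable (BP M) {x | dist p x = r} g Y := by
  have hr : 0 < r := hq ▸ dist_pos.2 hpq
  by_cases hN : N = ⊤
  · have side : ∀ b : Prop, Resolvable (BP M) (sphereSide p r b) g Y := fun b => by
      have hl := h.isLine_sphereSide hN hpq hq (b := b)
      obtain ⟨k, hk, hk'⟩ := h.exists_glue_sphereSide hr hg hgp (L := sphereSide p r b) subset_rfl
        (fun _ _ y hy _ => hy) (h.mem_sphereSide_iff hg hgp hq hgq)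
      have hcl : ∀ y ∈ sphereSide p r b,
          {x | x ∈ sphereSide p r b ∧ (x ≤ y ∨ dist x y < r) ∧ (y ≤ x ∨ dist y x < r)} =
            {x | dist y x < r} := fun y hy => by
        ext x
        constructor
        · rintro ⟨hx, h1 | h1, h2 | h2⟩
          · rw [le_antisymm h1 h2]
            simpa using hr
          · exact h2
          · rw [dist_comm] at h1; exact h1
          · exact h2
        · intro hx
          have h1 : dist x y < dist y p := by rwa [dist_comm x, dist_comm y p, hy.1]
          have hxp : dist p x = r := by rw [dist_comm, h.cu.dist_eq h1, dist_comm, hy.1]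
          have h2 := h.cu.lt_iff h1
          refine ⟨⟨hxp, ?_⟩, Or.inr (by rw [dist_comm]; exact hx), Or.inr hx⟩
          have n1 : p ≠ x := dist_pos.1 (hxp ▸ hr)
          have n2 : p ≠ y := dist_pos.1 (hy.1 ▸ hr)
          rw [← hy.2, ← not_le, ← not_le, not_iff_not, le_iff_lt_or_eq, le_iff_lt_or_eq, h2]
          simp [n1.symm, n2.symm]
      refine (hl.resolvable hk Y (fun y hy hyV h1 h2 => ?_) (fun f hf _ => ?_)).congr
        (fun z hz _ => hz) fun z _ hzV => (hk' z hzV).symm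
      · have h3 : k y ∈ {x | x ∈ sphereSide p r b ∧ (x ≤ y ∨ dist x y < r) ∧ (y ≤ x ∨ dist y x < r)} :=
          ⟨(suppIn_mem hk).2 hyV, h1, h2⟩
        rw [hcl y hyV, hk' y hyV] at h3
        refine Resolvable.congr (g := g) (Y := Y) ?_ (fun z hz _ => hz) fun z _ hzV => hk' z hzV.1
        rw [hcl y hyV]
        exact hC y hy hyV.1 h3
      · rw [hcl f hf]
        have hc := h.isCell_ball (y := f) (p := p) (by
          rintro rfl
          have := hf.1
          rw [dist_self] at this; exact hr.ne this)
        rw [dist_comm f p, hf.1] at hc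
        exact h.resolvable_singleton hc (by simpa using hr)
    have hcov : ∀ x, dist p x = r → x ∈ sphereSide p r True ∨ x ∈ sphereSide p r False := fun x hx => by
      by_cases h1 : p < x
      · exact Or.inl ⟨hx, by simp [h1]⟩
      · exact Or.inr ⟨hx, by simp [h1]⟩
    refine (side True).union (side False) (fun x hx => hx.1) (fun x hx => hx.1)
      hcov (fun x hx hx' => hx'.2.1 (hx.2.2 trivial)) fun u hu _ => ?_
    have hup : u p = p := hu.2 p fun hp => hr.ne (by rw [← hp, dist_self])
    have huq : dist p (u q) = r := (suppIn_mem hu).2 hq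
    obtain ⟨a, ha, ha'⟩ := h.exists_glue_sphereSide hr hu.1 hup (L := sphereSide p r True) subset_rfl
        (fun _ _ y hy _ => hy) (h.mem_sphereSide_iff hu.1 hup hq huq)
    exact exists_mul_of_restrict hcov hu ha ha'
  · have hfin : {x | dist p x = r} = {x | dist p x = r ∧ rk x r ∈ Finset.range N.toNat} := by
      ext x
      refine ⟨fun hx => ⟨hx, ?_⟩, fun hx => hx.1⟩
      have := h.lab.lt_bound hN x r
      lift N to ℕ using hN
      simpa using this
    rw [hfin]
    refine h.resolvable_labelled hN hpq hq hg hgp (fun y _ hy => ?_) hC _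
    have := h.dist_eq_of_mem_BP hg (x := p) (y := y) (z := q)
    rw [hgp, hq, hgq] at this
    exact this.1 hy

/-- Each finite restriction of an automorphism of a cell extends to an amalgamation base. -/
theorem resolvable_cell (h : IsRich N rk) (hV : IsCell V B) (hg : g ∈ suppIn (BP M) V)
    (Y : Finset M) : Resolvable (BP M) V g Y := by
  classical
  have hu := h.cu
  induction n : (Y.filter (· ∈ V)).card using Nat.strong_induction_on generalizing V B g with
  | _ n ih =>
  subst n
  by_cases hne : ∃ x ∈ Y, x ∈ V
  swap
  · exact ⟨g, hg, ∅, by simp, fun y hy hyV => absurd ⟨y, hy, hyV⟩ hne, h.isAmalgBase_cell hV g⟩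
  obtain ⟨x, hx, hxV⟩ := hne
  -- The classes of the line given by the fixed point `p` are spheres about `p`; the invariant balls
  -- in these are the smaller cells.
  obtain ⟨p, hp, k, hk, k1, k2, k3⟩ := h.exists_fixed hV hg hx hxV
  have hl := h.isLine_cell hV hp
  have hkp := suppIn_fixing hk k2
  have hsph : ∀ y ∈ V \ {p},
      {x | x ∈ V \ {p} ∧ dist p x ≤ dist p y ∧ dist p y ≤ dist p x} = {x | dist p x = dist p y} := by
    intro y hy
    ext z
    refine ⟨fun hz => le_antisymm hz.2.1 hz.2.2, fun hz => ?_⟩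
    have hz' : dist p z = dist p y := hz
    refine ⟨⟨(hV.mem_iff p hp z).2 fun v hv => ?_, ?_⟩, hz'.le, hz'.ge⟩
    · rw [hz']
      exact (hV.mem_iff p hp y).1 hy.1 v hv
    · rintro rfl
      rw [dist_self] at hz'
      exact hy.2 (dist_eq_zero.1 hz'.symm).symm
  have hres : Resolvable (BP M) (V \ {p}) k Y := by
    refine hl.resolvable hkp Y (fun y hy hyV h1 h2 => ?_) (fun f hf _ => ?_)
    · rw [hsph y hyV]
      have hpy : p ≠ y := fun e => hyV.2 e.symm
      have hky := le_antisymm h1 h2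
      refine h.resolvable_sphere hpy rfl hk.1 k2 hky fun z hz hzr hzk => ?_
      -- the cell of `z`
      have hzp : z ≠ p := by
        rintro rfl
        rw [dist_self] at hzr
        exact hpy (dist_eq_zero.1 hzr.symm)
      have hc := h.isCell_ball hzp
      rw [← hzr] at hzk ⊢
      rw [dist_comm z p] at hc
      have hzV : z ∈ {x | dist z x < dist p z} := by
        change dist z z < _
        rw [dist_self, dist_pos]; exact hzp.symm
      have hcp : p ∉ {x | dist z x < dist p z} := fun h1 => by
        have h1' : dist z p < dist p z := h1
        rw [dist_comm] at h1'; exact lt_irrefl _ h1'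
      have hkz : ∀ w, k w ∈ {x | dist z x < dist p z} ↔ w ∈ {x | dist z x < dist p z} := fun w => by
        have e : dist z w < dist z p ↔ dist (k z) (k w) < dist (k z) p := by
          rw [h.dist_lt_of_mem_BP hk.1, k2]
        have e2 : dist (k z) p = dist z p := hu.dist_eq (by
          rw [dist_comm, dist_comm z p]; exact hzk)
        rw [e2, dist_comm z p] at e
        simp only [Set.mem_ofPred_eq]
        rw [e]
        exact ⟨fun h1 => hu.dist_lt (by rw [dist_comm]; exact hzk) h1, fun h1 => hu.dist_lt hzk h1⟩
      obtain ⟨a, ha, ha'⟩ := h.exists_glue_clan hc.isClan hk.1 hkz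
      have hsub : {x | dist z x < dist p z} ⊆ V := fun w hw => by
        have hz2 : z ∈ V := by
          have : z ∈ {x | dist p x = dist p y} := hzr
          rw [← hsph y hyV] at this
          exact this.1.1
        by_contra hwV
        have h3 := hV.isClan z hz2 p hp w hwV
        have hw' : dist z w < dist p z := hw
        rw [dist_comm p z] at hw'
        exact h3.asymm hw'
      refine (ih _ (Finset.card_lt_card ⟨fun w hw => ?_, fun hs => ?_⟩) hc ha rfl).congr
        (fun w hw _ => hw) fun w _ hwV => (ha' w hwV).symm
      · rw [Finset.mem_filter] at hw ⊢
        exact ⟨hw.1, hsub hw.2⟩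
      -- The count drops because `x` is not in the cell of `z`: otherwise `g x` would be there too,
      -- and then also `p`, by the bound on `dist p x`.
      · have hxc : x ∈ {x | dist z x < dist p z} :=
          (Finset.mem_filter.1 (hs (Finset.mem_filter.2 ⟨hx, hxV⟩))).2
        rcases k3 with rfl | k3
        · exact hcp hxc
        · have h3 := (hkz x).2 hxc
          rw [k1 x hx] at h3
          have h3' : dist z (g x) < dist p z := h3
          have h4 : dist z x < dist p z := hxc
          have h5 : dist x (g x) < dist p z := hu.dist_lt (by rwa [dist_comm]) h3'
          have h6 : dist z p ≤ max (dist z x) (dist x p) := hu.um z x p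
          have h7 : dist z p < dist p z := h6.trans_lt (max_lt h4 (by
            rw [dist_comm]; exact k3.trans_lt h5))
          rw [dist_comm] at h7
          exact lt_irrefl _ h7
    · rw [hsph f hf]
      have hpf : p ≠ f := fun e => hf.2 e.symm
      refine h.resolvable_sphere hpf rfl (BP M).one_mem rfl rfl fun z hz hzr _ => ?_
      rw [Finset.mem_singleton] at hz
      subst hz
      have hc := h.isCell_ball hpf.symm
      rw [dist_comm z p] at hc
      exact h.resolvable_singleton hc (by simpa using hpf)
  obtain ⟨e, he, D, hD, he', hb⟩ := hres
  have hep : e p = p := he.2 p fun h => h.2 rfl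
  refine ⟨e, suppIn_mono Set.sdiff_subset he, insert p D, fun d hd => ?_, fun y hy hyV => ?_,
    hb.insert_fixed hep⟩
  · rcases Finset.mem_insert.1 hd with rfl | hd
    · exact hp
    · exact (hD d hd).1
  · by_cases hyp : y = p
    · subst hyp
      exact ⟨Finset.mem_insert_self _ _, by rw [hep, ← k1 y hy, k2]⟩
    · have := he' y hy ⟨hyV, hyp⟩
      exact ⟨Finset.mem_insert_of_mem this.1, by rw [this.2, k1 y hy]⟩

end IsRich

/-! ### Adding a point to a finite ordered ultrametric space -/

/-- The space `X` with one additional point. -/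
inductive AddPoint (X : Type u) : Type u
  | old (x : X) : AddPoint X
  | new : AddPoint X

namespace AddPoint

variable {X : Type u}

theorem old_injective : Function.Injective (old : X → AddPoint X) := fun x y h => by
  injection h

instance [Finite X] : Finite (AddPoint X) :=
  Finite.of_injective (β := Option X) (fun x => match x with | old x => some x | new => none)
    (by rintro (x | _) (y | _) h <;> simp_all)

/-- The position of points in `AddPoint X`: the new point is next to `u`. -/
def key (u : X) (ε : ℤ) : AddPoint X → X ×ₗ ℤ
  | old x => toLex (x, 0)
  | new => toLex (u, ε)

theorem key_injective (u : X) {ε : ℤ} (hε : ε ≠ 0) : Function.Injective (key u ε) := by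
  rintro (x | _) (y | _) h
  · have := congrArg (fun z => (ofLex z).1) h
    simp only [key, ofLex_toLex] at this
    rw [this]
  · have := congrArg (fun z => (ofLex z).2) h
    exact absurd this.symm hε
  · have := congrArg (fun z => (ofLex z).2) h
    exact absurd this hε
  · rfl

variable [MetricSpace X]

/-- The new point has distance `r` from the `r`-ball of `u`. -/
noncomputable def adist (u : X) (r : ℝ) : AddPoint X → AddPoint X → ℝ
  | old x, old y => dist x y
  | old x, new => max (dist u x) r
  | new, old x => max (dist u x) r
  | new, new => 0

theorem adist_um (hu : ∀ x y z : X, dist x z ≤ max (dist x y) (dist y z)) (u : X) {r : ℝ}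
    (hr : 0 < r) (x y z : AddPoint X) :
    adist u r x z ≤ max (adist u r x y) (adist u r y z) := by
  rcases x with x | _ <;> rcases y with y | _ <;> rcases z with z | _ <;> simp only [adist]
  · exact hu x y z
  · refine max_le ?_ ((le_max_right _ _).trans (le_max_right _ _))
    refine (hu u y x).trans (max_le ((le_max_left _ _).trans (le_max_right _ _)) ?_)
    rw [dist_comm]; exact le_max_left _ _
  · refine (hu x u z).trans (max_le ?_ ?_)
    · rw [dist_comm]; exact (le_max_left _ _).trans (le_max_left _ _)
    · exact (le_max_left _ _).trans (le_max_right _ _)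
  · exact le_max_left _ _
  · refine max_le ?_ ((le_max_right _ _).trans (le_max_left _ _))
    exact (hu u y z).trans (max_le ((le_max_left _ _).trans (le_max_left _ _)) (le_max_right _ _))
  · exact hr.le.trans ((le_max_right _ _).trans (le_max_left _ _))
  · exact le_max_right _ _
  · simp

/-- The metric on `AddPoint X`. -/
noncomputable abbrev metric (hu : ∀ x y z : X, dist x z ≤ max (dist x y) (dist y z)) (u : X)
    {r : ℝ} (hr : 0 < r) : MetricSpace (AddPoint X) where
  dist := adist u r
  dist_self x := by rcases x with x | _ <;> simp [adist]
  dist_comm x y := by rcases x with x | _ <;> rcases y with y | _ <;> simp [adist, dist_comm]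
  dist_triangle x y z := by
    have nn : ∀ x y, 0 ≤ adist u r x y := fun x y => by
      rcases x with x | _ <;> rcases y with y | _ <;> simp [adist, hr.le]
    exact (adist_um hu u hr x y z).trans (max_le_add_of_nonneg (nn _ _) (nn _ _))
  eq_of_dist_eq_zero {x y} h := by
    have h' : adist u r x y = 0 := h
    have pos : ∀ z : X, max (dist u z) r ≠ 0 := fun z => (hr.trans_le (le_max_right _ _)).ne'
    rcases x with x | _ <;> rcases y with y | _ <;> simp only [adist] at h'
    · rw [dist_eq_zero.1 h']
    · exact absurd h' (pos _)
    · exact absurd h' (pos _)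
    · rfl

/-- The order on `AddPoint X`. -/
noncomputable abbrev order [LinearOrder X] (u : X) {ε : ℤ} (hε : ε ≠ 0) : LinearOrder (AddPoint X) :=
  LinearOrder.lift' (key u ε) (key_injective u hε)

end AddPoint

/-- The new point has distance `r` from the open `r`-ball of `a` and stands immediately beyond its
last (or before its first) point `u`, which keeps the order convex. The number `K` bounds the
`r`-polygons in the closed ball, so that room for one more child is guaranteed. -/
theorem IsOrderedUltrametric.exists_addPoint {N : ℕ∞} {X : Type u} [MetricSpace X] [LinearOrder X]
    [Finite X] (hX : IsOrderedUltrametric N X) (a : X) {q : ℚ} {r : ℝ} (hq : r = q) (hr : 0 < r)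
    {K : ℕ} (hK : ∀ P : Finset X, IsPolygon r P → (∀ c ∈ P, dist a c ≤ r) → P.card ≤ K)
    (hKN : ((K + 1 : ℕ) : ℕ∞) ≤ N) (up : Bool) :
    ∃ (B : Type u) (_ : MetricSpace B) (_ : LinearOrder B), Finite B ∧ IsOrderedUltrametric N B ∧
      ∃ f : X → B, StrictMono f ∧ (∀ x y, dist (f x) (f y) = dist x y) ∧
      (∀ P : Finset B, IsPolygon r P → (∀ c ∈ P, dist (f a) c ≤ r) → P.card ≤ K + 1) ∧
      ∃ n : B, (∀ c, dist n (f c) = max (dist a c) r) ∧ (up = true → f a < n) ∧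
        (up = false → n < f a) ∧ (up = true → ∀ c, a < c → r ≤ dist a c → n < f c) := by
  classical
  have hu := hX.isConvexUltrametric
  -- the last (first) point of the `r`-ball of `a`
  obtain ⟨u, ε, hε, hau, hε1, hε2, hext1, hext2⟩ : ∃ (u : X) (ε : ℤ), ε ≠ 0 ∧ dist a u < r ∧
      (up = true → 0 < ε ∧ a ≤ u) ∧ (up = false → ε < 0 ∧ u ≤ a) ∧
      (0 < ε → ∀ d, u < d → r ≤ dist u d) ∧ (ε < 0 → ∀ c, c < u → r ≤ dist u c) := by
    have hne : {x | dist a x < r}.Nonempty := ⟨a, by simpa using hr⟩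
    cases up
    · obtain ⟨u, hu1, hu2⟩ := Set.exists_min_image {x | dist a x < r} id (Set.toFinite _) hne
      refine ⟨u, -1, by norm_num, hu1, by simp, fun _ => ⟨by norm_num, hu2 a (by simpa using hr)⟩,
        fun h => absurd h (by norm_num), fun _ c hc => ?_⟩
      by_contra! h1
      exact not_le.2 hc (hu2 c (hu.dist_lt hu1 h1))
    · obtain ⟨u, hu1, hu2⟩ := Set.exists_max_image {x | dist a x < r} id (Set.toFinite _) hne
      refine ⟨u, 1, by norm_num, hu1, fun _ => ⟨by norm_num, hu2 a (by simpa using hr)⟩, by simp,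
        fun _ c hc => ?_, fun h => absurd h (by norm_num)⟩
      by_contra! h1
      exact not_le.2 hc (hu2 c (hu.dist_lt hu1 h1))
  let _ := AddPoint.metric hX.ultrametric u hr
  let _ := AddPoint.order u hε
  have doo : ∀ x y : X, dist (AddPoint.old x) (AddPoint.old y) = dist x y := fun _ _ => rfl
  have don : ∀ x : X, dist (AddPoint.old x) AddPoint.new = max (dist u x) r := fun _ => rfl
  have dno : ∀ x : X, dist AddPoint.new (AddPoint.old x) = max (dist u x) r := fun _ => rfl
  have loo : ∀ x y : X, AddPoint.old x < AddPoint.old y ↔ x < y := fun x y => by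
    change toLex (x, (0 : ℤ)) < toLex (y, (0 : ℤ)) ↔ _
    simp [Prod.Lex.toLex_lt_toLex]
  have lon : ∀ x : X, AddPoint.old x < AddPoint.new ↔ x < u ∨ x = u ∧ 0 < ε := fun x => by
    change toLex (x, (0 : ℤ)) < toLex (u, ε) ↔ _
    simp [Prod.Lex.toLex_lt_toLex]
  have lno : ∀ x : X, AddPoint.new < AddPoint.old x ↔ u < x ∨ u = x ∧ ε < 0 := fun x => by
    change toLex (u, ε) < toLex (x, (0 : ℤ)) ↔ _
    simp [Prod.Lex.toLex_lt_toLex]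
  have max_eq : ∀ c, max (dist u c) r = max (dist a c) r := fun c => by
    apply le_antisymm
    · refine max_le ?_ (le_max_right _ _)
      exact (hu.um u a c).trans (max_le (by rw [dist_comm]; exact hau.le.trans (le_max_right _ _))
        (le_max_left _ _))
    · refine max_le ?_ (le_max_right _ _)
      exact (hu.um a u c).trans (max_le (hau.le.trans (le_max_right _ _)) (le_max_left _ _))
  have old_part : ∀ P : Finset (AddPoint X), ∃ P₀ : Finset X, (∀ x, x ∈ P₀ ↔ AddPoint.old x ∈ P) ∧
      P.card ≤ P₀.card + 1 ∧ (AddPoint.new ∉ P → P.card = P₀.card) := by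
    intro P
    have e : (P.erase AddPoint.new) = (P.preimage AddPoint.old
        AddPoint.old_injective.injOn).map ⟨AddPoint.old, AddPoint.old_injective⟩ := by
      ext x
      rcases x with x | _
      · simp
      · simp
    have c := congrArg Finset.card e
    rw [Finset.card_map] at c
    refine ⟨P.preimage AddPoint.old AddPoint.old_injective.injOn, by simp, ?_, fun h => ?_⟩
    · rw [← c]
      exact Nat.sub_le_iff_le_add.1 Finset.pred_card_le_card_erase
    · rw [← c, Finset.erase_eq_of_notMem h]
  refine ⟨AddPoint X, inferInstance, inferInstance, inferInstance, ⟨AddPoint.adist_um hX.ultrametric u hr,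
    ?_, ?_, ?_⟩, AddPoint.old, fun x y h => (loo x y).2 h, doo, ?_, AddPoint.new,
    fun c => (dno c).trans (max_eq c), fun h => ?_, fun h => ?_, fun h c hac hrc => ?_⟩
  · rintro (x | _) (y | _) (z | _) hxy hyz
    · exact hu.cv x y z ((loo _ _).1 hxy) ((loo _ _).1 hyz)
    · rw [doo, don]
      have h1 : y ≤ u := by
        rcases (lon y).1 hyz with h | h
        · exact h.le
        · exact h.1.le
      have hxy' := (loo _ _).1 hxy
      refine le_trans ?_ (le_max_left _ _)
      rw [dist_comm u]
      rcases h1.eq_or_lt with rfl | h1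
      · exact le_rfl
      · exact hu.cv _ _ _ hxy' h1
    · rw [don, doo]
      rcases (lon x).1 hxy with h1 | ⟨rfl, h1⟩ <;> rcases (lno z).1 hyz with h2 | ⟨rfl, h2⟩
      · rw [dist_comm u]
        refine max_le (hu.cv _ _ _ h1 h2) ?_
        rcases lt_or_gt_of_ne hε with h3 | h3
        · refine (hext2 h3 x h1).trans ?_
          rw [dist_comm]; exact hu.cv _ _ _ h1 h2
        · exact (hext1 h3 z h2).trans (hu.cv' h1 h2)
      · rw [dist_comm u]
        refine max_le le_rfl ?_
        rw [dist_comm]; exact hext2 h2 x h1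
      · rw [dist_self]
        exact max_le dist_nonneg (hext1 h1 z h2)
      · exact absurd h1 h2.asymm
    · exact absurd hyz (lt_irrefl _)
    · rw [dno, dno]
      have h1 : u ≤ y := by
        rcases (lno y).1 hxy with h | h
        · exact h.le
        · exact h.1.le
      refine max_le_max ?_ le_rfl
      rcases h1.eq_or_lt with rfl | h1
      · rw [dist_self]; exact dist_nonneg
      · exact hu.cv _ _ _ h1 ((loo _ _).1 hyz)
    · exact absurd (hxy.trans hyz) (lt_irrefl _)
    · exact absurd hxy (lt_irrefl _)
    · exact absurd hxy (lt_irrefl _)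
  · have hmx : ∀ x, ∃ q' : ℚ, max (dist u x) r = q' := fun x => by
      rcases max_choice (dist u x) r with h | h
      · rw [h]; exact hX.rational u x
      · rw [h]; exact ⟨q, hq⟩
    rintro (x | _) (y | _)
    · exact hX.rational x y
    · exact hmx x
    · exact hmx y
    · exact ⟨0, by simp⟩
  · intro ρ P hρ hP
    obtain ⟨P₀, h0, h1, h2⟩ := old_part P
    have hP₀ : IsPolygon ρ P₀ := fun x hx y hy hxy => by
      change dist x y = _
      rw [← doo]
      exact hP ((h0 x).1 hx) ((h0 y).1 hy) fun e => hxy (AddPoint.old_injective e)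
    by_cases hn : AddPoint.new ∈ P
    · have hd : ∀ c ∈ P₀, max (dist u c) r = ρ := fun c hc => by
        rw [← don]
        exact hP ((h0 c).1 hc) hn (by simp)
      -- For side length above `r` the new point of a polygon can be replaced by `u`; for `r` itself
      -- the bound `K` applies.
      by_cases hρr : r < ρ
      · have hd' : ∀ c ∈ P₀, dist u c = ρ := fun c hc => by
          have := hd c hc
          rcases max_choice (dist u c) r with h | h
          · rw [← h, this]
          · rw [h] at this; exact absurd this hρr.ne
        have huP : u ∉ P₀ := fun h => by
          have := hd' u h
          rw [dist_self] at this; exact hρ.ne this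
        have h3 := hX.polygon ρ (insert u P₀) hρ (hP₀.insert fun z hz => by
          rw [dist_comm]; exact hd' z hz)
        rw [Finset.card_insert_of_notMem huP] at h3
        exact le_trans (by exact_mod_cast h1) h3
      · rcases P₀.eq_empty_or_nonempty with rfl | ⟨c, hc⟩
        · have h3 := hX.polygon ρ {u} hρ (by simp [IsPolygon])
          exact le_trans (by exact_mod_cast h1) h3
        · have hρ' : ρ = r := le_antisymm (not_lt.1 hρr) (by rw [← hd c hc]; exact le_max_right _ _)
          subst hρ'
          have := hK P₀ hP₀ fun c hc => by
            have := hd c hc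
            rw [max_eq] at this
            rw [← this]; exact le_max_left _ _
          exact le_trans (by exact_mod_cast h1.trans (Nat.add_le_add_right this 1)) hKN
    · rw [h2 hn]
      exact hX.polygon ρ P₀ hρ hP₀
  · intro P hP hPa
    obtain ⟨P₀, h0, h1, h2⟩ := old_part P
    have hP₀ : IsPolygon r P₀ := fun x hx y hy hxy => by
      change dist x y = _
      rw [← doo]
      exact hP ((h0 x).1 hx) ((h0 y).1 hy) fun e => hxy (AddPoint.old_injective e)
    exact h1.trans (Nat.add_le_add_right (hK P₀ hP₀ fun c hc => hPa _ ((h0 c).1 hc)) 1)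
  · obtain ⟨h1, h2⟩ := hε1 h
    rw [lon]
    exact h2.lt_or_eq.imp id fun h3 => ⟨h3, h1⟩
  · obtain ⟨h1, h2⟩ := hε2 h
    rw [lno]
    exact h2.lt_or_eq.imp id fun h3 => ⟨h3, h1⟩
  · rw [lno]
    left
    have h3 : dist u a < dist a c := by rw [dist_comm]; exact hau.trans_le hrc
    exact (hu.lt_iff h3).2 hac

theorem IsOrderedUltrametric.finset {N : ℕ∞} {X : Type u} [MetricSpace X] [LinearOrder X]
    (h : IsOrderedUltrametric N X) (A : Finset X) : IsOrderedUltrametric N A where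
  ultrametric x y z := h.ultrametric x y z
  convex x y z hxy hyz := h.convex x y z hxy hyz
  rational x y := h.rational x y
  polygon r P hr hP := by
    have := h.polygon r (P.map (Function.Embedding.subtype _)) hr (by
      intro x hx y hy hxy
      simp only [Finset.coe_map, Set.mem_image, Finset.mem_coe, Function.Embedding.subtype_apply]
        at hx hy
      obtain ⟨x, hx, rfl⟩ := hx
      obtain ⟨y, hy, rfl⟩ := hy
      exact hP hx hy fun e => hxy (by rw [e]))
    rwa [Finset.card_map] at this

/-- Adding `m` points on one side of `a`. -/
theorem IsOrderedUltrametric.exists_addPoints {N : ℕ∞} {X : Type u} [MetricSpace X] [LinearOrder X]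
    [Finite X] (hX : IsOrderedUltrametric N X) (a : X) {q : ℚ} {r : ℝ} (hq : r = q) (hr : 0 < r)
    {K : ℕ} (hK : ∀ P : Finset X, IsPolygon r P → (∀ c ∈ P, dist a c ≤ r) → P.card ≤ K)
    (up : Bool) (m : ℕ) (hKN : ((K + m : ℕ) : ℕ∞) ≤ N) :
    ∃ (B : Type u) (_ : MetricSpace B) (_ : LinearOrder B), Finite B ∧ IsOrderedUltrametric N B ∧
      ∃ f : X → B, StrictMono f ∧ (∀ x y, dist (f x) (f y) = dist x y) ∧
      (∀ P : Finset B, IsPolygon r P → (∀ c ∈ P, dist (f a) c ≤ r) → P.card ≤ K + m) ∧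
      ∃ R : Finset B, R.card = m ∧ IsPolygon r R ∧ (∀ n ∈ R, ∀ c, dist n (f c) = max (dist a c) r) ∧
        (up = true → ∀ n ∈ R, f a < n) ∧ (up = false → ∀ n ∈ R, n < f a) := by
  classical
  induction m with
  | zero =>
    exact ⟨X, inferInstance, inferInstance, inferInstance, hX, id, strictMono_id, fun _ _ => rfl, hK,
      ∅, rfl, by simp [IsPolygon], by simp, by simp, by simp⟩
  | succ m ih =>
    obtain ⟨B, _, _, _, hB, f, hf, hfd, hfK, R, hR, hRp, hRd, hR1, hR2⟩ :=
      ih (le_trans (by exact_mod_cast Nat.le_succ _) hKN)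
    obtain ⟨B', _, _, hfin, hB', f', hf', hfd', hfK', n, hn, hn1, hn2, -⟩ :=
      hB.exists_addPoint (f a) hq hr hfK hKN up
    have nR : ∀ x ∈ R, dist n (f' x) = r := fun x hx => by
      rw [hn, dist_comm, hRd x hx, dist_self, max_eq_right hr.le, max_self]
    have nmem : n ∉ R.image f' := by
      intro h
      obtain ⟨x, hx, e⟩ := Finset.mem_image.1 h
      have := nR x hx
      rw [e, dist_self] at this
      exact hr.ne this
    refine ⟨B', inferInstance, inferInstance, hfin, hB', f' ∘ f, hf'.comp hf, fun x y => ?_, hfK',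
      insert n (R.image f'), ?_, IsPolygon.insert ?_ ?_, fun y hy c => ?_, fun h y hy => ?_,
      fun h y hy => ?_⟩
    · rw [Function.comp_apply, Function.comp_apply, hfd', hfd]
    · rw [Finset.card_insert_of_notMem nmem, Finset.card_image_of_injective _ hf'.injective, hR]
    · intro x hx y hy hxy
      rw [Finset.mem_coe, Finset.mem_image] at hx hy
      obtain ⟨x, hx, rfl⟩ := hx
      obtain ⟨y, hy, rfl⟩ := hy
      rw [hfd']
      exact hRp hx hy fun e => hxy (by rw [e])
    · intro z hz
      obtain ⟨x, hx, rfl⟩ := Finset.mem_image.1 hz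
      rw [dist_comm]; exact nR x hx
    all_goals
      rw [Finset.mem_insert, Finset.mem_image] at hy
      rcases hy with rfl | ⟨x, hx, rfl⟩
    · rw [Function.comp_apply, hn, hfd]
    · rw [Function.comp_apply, hfd', hRd x hx]
    · exact hn1 h
    · exact hf' (hR1 h x hx)
    · exact hn2 h
    · exact hf' (hR2 h x hx)

/-! ### Urysohn spaces are rich. -/

namespace IsOrderedUrysohn

variable {N : ℕ∞} {M : Type u} [MetricSpace M] [LinearOrder M]

theorem exists_lift (h : IsOrderedUrysohn N M) (A : Finset M) : ∃ A' : Finset M, A ⊆ A' ∧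
    ∀ (B : Type u) [MetricSpace B] [LinearOrder B], Finite B → IsOrderedUltrametric N B →
      ∀ f : A' → B, StrictMono f → (∀ x y, dist (f x) (f y) = dist x y) →
        ∃ g : B → M, StrictMono g ∧ (∀ x y z, dist x y ≤ dist x z ↔
          dist (g x) (g y) ≤ dist (g x) (g z)) ∧ ∀ a : A', (a : M) ∈ A → g (f a) = a := by
  obtain ⟨A', hA, hA'⟩ := h.weaklyInjective A
  refine ⟨A', hA, fun B _ _ hfin hB f hf hfd => ?_⟩
  have hM := h.isOrderedUltrametric
  obtain ⟨g, hg, hga⟩ := hA' B hfin hB f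
    ((isOrderedBPEmbedding_iff (hM.finset A').ultrametric hB.ultrametric).2
      ⟨hf, fun x y z => by rw [hfd, hfd]⟩)
  obtain ⟨hg1, hg2⟩ := (isOrderedBPEmbedding_iff hB.ultrametric hM.ultrametric).1 hg
  exact ⟨g, hg1, hg2, hga⟩

/-- Preparation for new levels on the branch of `a`. -/
theorem exists_lift_level (h : IsOrderedUrysohn N M) (hN : 2 ≤ N) (a : M) {lo hi : ℝ} (h0 : 0 ≤ lo)
    (hlh : lo < hi) : ∃ (A : Finset M) (ha : a ∈ A) (q : ℚ), 0 < (q : ℝ) ∧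
      (∀ P : Finset A, IsPolygon (q : ℝ) P → (∀ c ∈ P, dist ⟨a, ha⟩ c ≤ (q : ℝ)) → P.card ≤ 1) ∧
      ∀ (B : Type u) [MetricSpace B] [LinearOrder B], Finite B → IsOrderedUltrametric N B →
      ∀ f : A → B, StrictMono f → (∀ x y, dist (f x) (f y) = dist x y) →
        ∃ g : B → M, StrictMono g ∧ (∀ x y z, dist x y ≤ dist x z ↔
          dist (g x) (g y) ≤ dist (g x) (g z)) ∧ g (f ⟨a, ha⟩) = a ∧
          ∀ x, dist (f ⟨a, ha⟩) x = q → lo < dist a (g x) ∧ dist a (g x) < hi := by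
  classical
  have hu := h.isOrderedUltrametric.isConvexUltrametric
  -- The lift back to `M` preserves only comparisons, so `c₁` and `c₂` are put into the
  -- configuration to keep the new distance inside the interval. The number `q` exceeds `dist a c₁`
  -- so slightly that no point of `A` has a distance from `a` in between, up to and including `q`.
  obtain ⟨p₁, h1, h2⟩ := exists_rat_btwn hlh
  obtain ⟨p₂, h3, h4⟩ := exists_rat_btwn h2
  have hp₁ : (0 : ℝ) < p₁ := h0.trans_lt h1
  obtain ⟨c₁, hc₁⟩ := h.distances hN a p₁ (by exact_mod_cast hp₁)
  obtain ⟨c₂, hc₂⟩ := h.distances hN a p₂ (by exact_mod_cast hp₁.trans h3)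
  obtain ⟨A, hA, hlift⟩ := h.exists_lift {a, c₁, c₂}
  have ha : a ∈ A := hA (by simp)
  have hcA₁ : c₁ ∈ A := hA (by simp)
  have hcA₂ : c₂ ∈ A := hA (by simp)
  obtain ⟨t, ht, hmin⟩ := Finset.exists_min_image (A.filter fun c => dist a c₁ < dist a c) (dist a)
    ⟨c₂, by simp [hcA₂, hc₁, hc₂, h3]⟩
  obtain ⟨q, hq1, hq2⟩ := exists_rat_btwn (Finset.mem_filter.1 ht).2
  have hqt : ∀ c ∈ A, dist a c ≤ q → dist a c ≤ dist a c₁ := fun c hc hcq => by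
    by_contra! h5
    exact not_lt.2 (hmin c (Finset.mem_filter.2 ⟨hc, h5⟩)) (hcq.trans_lt hq2)
  have hqc : (q : ℝ) < dist a c₂ :=
    hq2.trans_le (hmin c₂ (by simp [hcA₂, hc₁, hc₂, h3]))
  rw [hc₁] at hq1
  refine ⟨A, ha, q, hp₁.trans hq1, fun P hP hPa => ?_, fun B _ _ hfin hB f hf hfd => ?_⟩
  · refine Finset.card_le_one.2 fun x hx y hy => ?_
    by_contra hxy
    have h5 : dist (x : M) y = q := hP hx hy hxy
    have h6 := hqt x x.2 (hPa x hx)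
    have h7 := hqt y y.2 (hPa y hy)
    have h8 : dist (x : M) y ≤ dist a c₁ := hu.dist_le (y := a) (by rwa [dist_comm]) h7
    rw [h5, hc₁] at h8
    exact not_lt.2 h8 hq1
  · obtain ⟨g, hg, hgd, hga⟩ := hlift B hfin hB f hf hfd
    have lt : ∀ x y z, dist x y < dist x z ↔ dist (g x) (g y) < dist (g x) (g z) := fun x y z => by
      rw [← not_le, ← not_le, hgd]
    have ga := hga ⟨a, ha⟩ (by simp)
    have g1 := hga ⟨c₁, hcA₁⟩ (by simp)
    have g2 := hga ⟨c₂, hcA₂⟩ (by simp)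
    refine ⟨g, hg, hgd, ga, fun x hx => ⟨?_, ?_⟩⟩
    · have := (lt (f ⟨a, ha⟩) (f ⟨c₁, hcA₁⟩) x).1 (by
        rw [hfd, hx]; change dist a c₁ < _; rwa [hc₁])
      rw [ga, g1, hc₁] at this
      exact h1.trans this
    · have := (lt (f ⟨a, ha⟩) x (f ⟨c₂, hcA₂⟩)).1 (by rw [hfd, hx]; exact hqc)
      rw [ga, g2, hc₂] at this
      exact this.trans h4

theorem exists_level (h : IsOrderedUrysohn N M) (hN : N = ⊤) (a : M) {lo hi : ℝ} (h0 : 0 ≤ lo)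
    (hlh : lo < hi) (up : Bool) : ∃ y, lo < dist a y ∧ dist a y < hi ∧ (up = true → a < y) ∧
      (up = false → y < a) := by
  obtain ⟨A, ha, q, hq, hK, hlift⟩ := h.exists_lift_level (by simp [hN]) a h0 hlh
  obtain ⟨B, _, _, hfin, hB, f, hf, hfd, -, n, hn, hn1, hn2, -⟩ :=
    (h.isOrderedUltrametric.finset A).exists_addPoint ⟨a, ha⟩ rfl hq hK (by simp [hN]) up
  obtain ⟨g, hg, hgd, ga, hgn⟩ := hlift B hfin hB f hf hfd
  have := hgn n (by rw [dist_comm, hn, dist_self, max_eq_right hq.le])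
  refine ⟨g n, this.1, this.2, fun h => ?_, fun h => ?_⟩
  · exact ga.ge.trans_lt (hg (hn1 h))
  · exact (hg (hn2 h)).trans_le ga.le

theorem exists_child (h : IsOrderedUrysohn N M) (hN : N = ⊤) {a b : M} (hab : a ≠ b) (up : Bool) :
    ∃ y, dist a y = dist a b ∧ dist y b = dist a b ∧ (up = true → a < y) ∧ (up = false → y < a) ∧
      (up = true → a < b → y < b) := by
  classical
  obtain ⟨A, hA, hlift⟩ := h.exists_lift {a, b}
  have ha : a ∈ A := hA (by simp)
  have hb : b ∈ A := hA (by simp)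
  obtain ⟨q, hq⟩ := h.isOrderedUltrametric.rational a b
  obtain ⟨B, _, _, hfin, hB, f, hf, hfd, -, n, hn, hn1, hn2, hn3⟩ :=
    (h.isOrderedUltrametric.finset A).exists_addPoint (K := Nat.card A) ⟨a, ha⟩ hq (dist_pos.2 hab)
    (fun P _ _ => by
      rw [Nat.card_eq_fintype_card]; exact Finset.card_le_univ P) (by simp [hN]) up
  obtain ⟨g, hg, hgd, hga⟩ := hlift B hfin hB f hf hfd
  have ga := hga ⟨a, ha⟩ (by simp)
  have gb := hga ⟨b, hb⟩ (by simp)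
  have eq : ∀ x y z, dist x y = dist x z → dist (g x) (g y) = dist (g x) (g z) := fun x y z e =>
    le_antisymm ((hgd _ _ _).1 e.le) ((hgd _ _ _).1 e.ge)
  have dab : dist (f ⟨a, ha⟩) (f ⟨b, hb⟩) = dist a b := hfd _ _
  have dan : dist (f ⟨a, ha⟩) n = dist a b := by
    rw [dist_comm, hn, dist_self, max_eq_right dist_nonneg]
  have dbn : dist (f ⟨b, hb⟩) n = dist a b := by
    rw [dist_comm, hn]; exact max_self _
  refine ⟨g n, ?_, ?_, fun h => ?_, fun h => ?_, fun h hlt => ?_⟩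
  · have := eq _ _ _ (dan.trans dab.symm)
    rwa [ga, gb] at this
  · have := eq _ n (f ⟨a, ha⟩) (by rw [dbn, dist_comm (f ⟨b, hb⟩), dab])
    rwa [ga, gb, dist_comm, dist_comm b] at this
  · exact ga.ge.trans_lt (hg (hn1 h))
  · exact (hg (hn2 h)).trans_le ga.le
  · exact (hg (hn3 h ⟨b, hb⟩ hlt le_rfl)).trans_le gb.le

/-- A largest polygon in the closed ball with fewer than `N` points could be enlarged: a point is
added to a finite configuration and lifted back to `M`. -/
theorem exists_fullPolygon (h : IsOrderedUrysohn N M) {n : ℕ} (hN : N = n) {a b : M} (hab : a ≠ b) :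
    ∃ Q : Finset M, Q.card = n ∧ IsPolygon (dist a b) Q ∧ ∀ c ∈ Q, dist a c ≤ dist a b := by
  classical
  have hu := h.isOrderedUltrametric.isConvexUltrametric
  have r0 : 0 < dist a b := dist_pos.2 hab
  have bound : ∀ Q : Finset M, IsPolygon (dist a b) Q → Q.card ≤ n := fun Q hQ => by
    have := h.isOrderedUltrametric.polygon _ Q r0 hQ
    rw [hN] at this; exact_mod_cast this
  let T : Set ℕ := {k | ∃ Q : Finset M, Q.card = k ∧ IsPolygon (dist a b) Q ∧
    ∀ c ∈ Q, dist a c ≤ dist a b}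
  have hTb : BddAbove T := ⟨n, by rintro k ⟨Q, rfl, hQ, -⟩; exact bound Q hQ⟩
  have h2 : 2 ∈ T := by
    refine ⟨{a, b}, Finset.card_pair hab, ?_, by simp⟩
    exact IsPolygon.insert (by simp [IsPolygon]) (by simp [dist_comm])
  obtain ⟨Q, hQ, hQp, hQa⟩ := Nat.sSup_mem ⟨2, h2⟩ hTb
  have hmax : ∀ P : Finset M, IsPolygon (dist a b) P → (∀ c ∈ P, dist a c ≤ dist a b) →
      P.card ≤ Q.card := fun P h1 h2 => by
    rw [hQ]; exact le_csSup hTb ⟨P, rfl, h1, h2⟩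
  have hQ2 : 2 ≤ Q.card := by rw [hQ]; exact le_csSup hTb h2
  refine ⟨Q, ?_, hQp, hQa⟩
  by_contra hne
  have hlt := lt_of_le_of_ne (bound Q hQp) hne
  obtain ⟨A, hA, hlift⟩ := h.exists_lift (insert a Q)
  have ha : a ∈ A := hA (by simp)
  have hQA : ∀ c ∈ Q, c ∈ A := fun c hc => hA (by simp [hc])
  obtain ⟨q, hq⟩ := h.isOrderedUltrametric.rational a b
  obtain ⟨B, _, _, hfin, hB, f, hf, hfd, -, n', hn, -⟩ :=
    (h.isOrderedUltrametric.finset A).exists_addPoint (K := Q.card) ⟨a, ha⟩ hq r0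
    (fun P hP hPa => by
      rw [← Finset.card_map (Function.Embedding.subtype _)]
      refine hmax _ (fun x hx y hy hxy => ?_) fun c hc => ?_
      · simp only [Finset.coe_map, Set.mem_image, Finset.mem_coe, Function.Embedding.subtype_apply]
          at hx hy
        obtain ⟨x, hx, rfl⟩ := hx
        obtain ⟨y, hy, rfl⟩ := hy
        exact hP hx hy fun e => hxy (by rw [e])
      · obtain ⟨x, hx, rfl⟩ := Finset.mem_map.1 hc
        exact hPa x hx) (by rw [hN]; exact_mod_cast hlt) true
  obtain ⟨g, hg, hgd, hga⟩ := hlift B hfin hB f hf hfd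
  have dQ : ∀ c ∈ Q, dist c (g n') = dist a b := by
    intro c hc
    -- A second point of `Q` shows which value the side length takes after the lift.
    obtain ⟨c', hc', hcc⟩ := Finset.exists_mem_ne (by omega : 1 < Q.card) c
    have gc := hga ⟨c, hQA c hc⟩ (by simp [hc])
    have gc' := hga ⟨c', hQA c' hc'⟩ (by simp [hc'])
    have e : dist (f ⟨c, hQA c hc⟩) n' = dist (f ⟨c, hQA c hc⟩) (f ⟨c', hQA c' hc'⟩) := by
      rw [dist_comm, hn, hfd]
      exact (max_eq_right (hQa c hc)).trans (hQp hc hc' hcc.symm).symm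
    have := le_antisymm ((hgd _ _ _).1 e.le) ((hgd _ _ _).1 e.ge)
    rw [gc, gc'] at this
    exact this.trans (hQp hc hc' hcc.symm)
  have hmem : g n' ∉ Q := fun hc => by
    have := dQ _ hc
    rw [dist_self] at this
    exact r0.ne this
  have := hmax (insert (g n') Q) (hQp.insert dQ) fun c hc => by
    rcases Finset.mem_insert.1 hc with rfl | hc
    · obtain ⟨c, hc⟩ : Q.Nonempty := Finset.card_pos.1 (by omega)
      exact hu.dist_le (hQa c hc) (dQ c hc).le
    · exact hQa c hc
  rw [Finset.card_insert_of_notMem hmem] at this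
  omega

/-- For `2 ≤ N`, the Urysohn spaces are rich. -/
theorem isRich (h : IsOrderedUrysohn N M) (hN : 2 ≤ N) : IsRich N (rank N (X := M)) := by
  classical
  have hlab := isLabelling_rank h.isOrderedUltrametric
  refine ⟨h.countable, h.isOrderedUltrametric, hlab, hN, ?_, h.distances hN, ?_, ?_, ?_, ?_, ?_, ?_, ?_⟩
  · obtain ⟨f, -⟩ := h.universal PUnit inferInstance
      ⟨by simp, fun x y z h => absurd h (lt_irrefl _), fun x y => ⟨0, by simp⟩, fun r P _ _ => by
        have : P.card ≤ 1 := Finset.card_le_univ P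
        have h2 : ((P.card : ℕ) : ℕ∞) ≤ ((2 : ℕ) : ℕ∞) := Nat.cast_le.2 (this.trans one_le_two)
        exact h2.trans hN⟩
    exact ⟨f PUnit.unit⟩
  -- With `i` new points below `a` and `n - 1 - i` above it, a polygon with `n` points arises, on
  -- which the labels are forced: `a` gets `i`, and one of the other points gets `j`.
  · intro hNt a lo hi h0 hlh i j hij hi' hj
    lift N to ℕ using hNt with n hn
    obtain ⟨A, ha, q, hq, hK, hlift⟩ := h.exists_lift_level hN a h0 hlh
    have hi'' : i < n := by exact_mod_cast hi'
    have hj' : j < n := by exact_mod_cast hj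
    obtain ⟨B, _, _, _, hB, f, hf, hfd, hfK, L, hL, hLp, hLd, -, hL2⟩ :=
      (h.isOrderedUltrametric.finset A).exists_addPoints ⟨a, ha⟩ rfl hq hK false i
        (by exact_mod_cast (by omega : 1 + i ≤ n))
    obtain ⟨B', _, _, hfin, hB', f', hf', hfd', -, R, hR, hRp, hRd, hR1, -⟩ :=
      hB.exists_addPoints (f ⟨a, ha⟩) rfl hq hfK true (n - 1 - i)
        (by exact_mod_cast (by omega : 1 + i + (n - 1 - i) ≤ n))
    obtain ⟨g, hg, hgd, ga, hgx⟩ := hlift B' hfin hB' (f' ∘ f) (hf'.comp hf) (fun x y => by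
      rw [Function.comp_apply, Function.comp_apply, hfd', hfd])
    rw [Function.comp_apply] at ga hgx
    set e := f' (f ⟨a, ha⟩) with he
    have dL : ∀ x ∈ L, dist (f' x) e = q := fun x hx => by
      rw [hfd', hLd x hx, dist_self, max_eq_right hq.le]
    have dR : ∀ x ∈ R, dist x e = q := fun x hx => by
      rw [hRd x hx, dist_self, max_eq_right hq.le]
    have lL : ∀ x ∈ L, f' x < e := fun x hx => hf' (hL2 rfl x hx)
    have lR : ∀ x ∈ R, e < x := fun x hx => hR1 rfl x hx
    set T : Finset B' := insert e (L.image f' ∪ R) with hT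
    have hdisj : Disjoint (L.image f') R := by
      refine Finset.disjoint_left.2 fun x hx hx' => ?_
      obtain ⟨y, hy, rfl⟩ := Finset.mem_image.1 hx
      exact (lL y hy).asymm (lR _ hx')
    have heT : e ∉ L.image f' ∪ R := by
      intro h1
      rcases Finset.mem_union.1 h1 with h1 | h1
      · obtain ⟨y, hy, h2⟩ := Finset.mem_image.1 h1
        exact (lL y hy).ne h2
      · exact lt_irrefl _ (lR _ h1)
    have hTc : T.card = n := by
      rw [hT, Finset.card_insert_of_notMem heT, Finset.card_union_of_disjoint hdisj,
        Finset.card_image_of_injective _ hf'.injective, hL, hR]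
      omega
    have hTp : IsPolygon (q : ℝ) T := by
      refine IsPolygon.insert (fun x hx y hy hxy => ?_) fun z hz => ?_
      · rw [Finset.mem_coe, Finset.mem_union, Finset.mem_image] at hx hy
        rcases hx with ⟨x, hx, rfl⟩ | hx <;> rcases hy with ⟨y, hy, rfl⟩ | hy
        · rw [hfd']; exact hLp hx hy fun h => hxy (by rw [h])
        · rw [dist_comm, hRd y hy, dist_comm, hLd x hx, dist_self, max_eq_right hq.le, max_self]
        · rw [hRd x hx, dist_comm, hLd y hy, dist_self, max_eq_right hq.le, max_self]
        · exact hRp hx hy hxy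
      · rw [Finset.mem_union, Finset.mem_image] at hz
        rcases hz with ⟨x, hx, rfl⟩ | hz
        · exact dL x hx
        · exact dR z hz
    have hTi : (T.filter (· < e)).card = i := by
      rw [← hL, ← Finset.card_image_of_injective L hf'.injective]
      congr 1
      ext x
      simp only [hT, Finset.mem_filter, Finset.mem_insert, Finset.mem_union]
      constructor
      · rintro ⟨rfl | h1 | h1, h2⟩
        · exact absurd h2 (lt_irrefl _)
        · exact h1
        · exact absurd h2 (lR x h1).asymm
      · intro h1
        refine ⟨Or.inr (Or.inl h1), ?_⟩
        obtain ⟨y, hy, rfl⟩ := Finset.mem_image.1 h1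
        exact lL y hy
    have hn1 : 1 < n := by exact_mod_cast hN
    have heT' : e ∈ T := Finset.mem_insert_self _ _
    obtain ⟨b, hb, hbe⟩ := Finset.exists_mem_ne (by rw [hTc]; exact hn1) e
    have gd : ∀ x ∈ T, ∀ y ∈ T, x ≠ y → dist (g x) (g y) = dist (g e) (g b) :=
      fun x hx y hy hxy => dist_eq_of_isPolygon hTp (fun x _ y _ z _ h => le_antisymm
        ((hgd _ _ _).1 h.le) ((hgd _ _ _).1 h.ge)) heT' hb hbe.symm hx hy hxy
    set s := dist (g e) (g b) with hs
    have hNt : (n : ℕ∞) ≠ ⊤ := by simp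
    have g1 : ∀ x ∈ T, rank n (g x) s < n := fun x _ => by exact_mod_cast hlab.lt_bound hNt (g x) s
    have g2 : ∀ x ∈ T, ∀ y ∈ T, x < y → rank n (g x) s < rank n (g y) s := fun x hx y hy hxy => by
      have := hlab.lt hNt _ _ (hg hxy)
      rwa [gd x hx y hy hxy.ne] at this
    have hei := eq_card_filter_lt hTc (fun x => rank n (g x) s) g1 g2 e heT'
    obtain ⟨-, him⟩ := image_eq_range_of_strictMono hTc (fun x => rank n (g x) s) g1 g2
    obtain ⟨x, hx, hxj⟩ := Finset.mem_image.1 (him ▸ Finset.mem_range.2 hj')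
    simp only [hTi] at hei hxj
    have hxe : e ≠ x := by
      rintro rfl
      exact hij (hei.symm.trans hxj)
    have hax := hgx x (hTp heT' hx hxe)
    have hd := gd e heT' x hx hxe
    rw [ga] at hei hd
    exact ⟨g x, hax.1, hax.2, by rw [hd]; exact hei, by rw [hd]; exact hxj⟩
  · intro hNt a b hab j hj
    lift N to ℕ using hNt with n hn
    obtain ⟨Q, hc, hQ, hQa⟩ := h.exists_fullPolygon rfl hab
    have hNt : (n : ℕ∞) ≠ ⊤ := by simp
    obtain ⟨-, him⟩ := image_eq_range_of_strictMono hc (fun x => rank n x (dist a b))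
      (fun x _ => by exact_mod_cast hlab.lt_bound hNt x _) (fun x hx y hy hxy => by
        have := hlab.lt hNt x y hxy
        rwa [hQ hx hy hxy.ne] at this)
    obtain ⟨x, hx, hxj⟩ := Finset.mem_image.1
      (him ▸ Finset.mem_range.2 (by exact_mod_cast hj : j < n))
    exact ⟨x, hQa x hx, hxj⟩
  · intro hNt a lo hi h0 hlh
    obtain ⟨y, h1, h2, h3, -⟩ := h.exists_level hNt a h0 hlh true
    exact ⟨y, h1, h2, h3 rfl⟩
  · intro hNt a lo hi h0 hlh
    obtain ⟨y, h1, h2, -, h3⟩ := h.exists_level hNt a h0 hlh false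
    exact ⟨y, h1, h2, h3 rfl⟩
  · intro hNt a b hab
    obtain ⟨y, h1, h2, h3, -, h4⟩ := h.exists_child hNt hab.ne true
    exact ⟨y, h3 rfl, h4 rfl hab, h1, h2⟩
  · intro hNt a b hab
    obtain ⟨y, h1, -, h3, -⟩ := h.exists_child hNt hab true
    exact ⟨y, h3 rfl, h1⟩
  · intro hNt a b hab
    obtain ⟨y, h1, -, -, h3, -⟩ := h.exists_child hNt hab false
    exact ⟨y, h3 rfl, h1⟩

end IsOrderedUrysohn

/-! ### A colouring of the rationals -/

/-- The fractions `2 ^ k * odd / 3 ^ m` have valuation `k` and spacing `2 ^ (k + 1) / 3 ^ m`, which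
is below the length of the interval for large `m`. The odd number used is the least one above `t`.
-/
theorem exists_padicValRat_eq (k : ℕ) {lo hi : ℝ} (h : lo < hi) :
    ∃ q : ℚ, lo < q ∧ (q : ℝ) < hi ∧ padicValRat 2 q = k := by
  obtain ⟨m, hm⟩ := pow_unbounded_of_one_lt (2 ^ (k + 1) / (hi - lo)) (by norm_num : (1 : ℝ) < 3)
  have h3 : (0 : ℝ) < 3 ^ m := by positivity
  have h2 : (0 : ℝ) < 2 ^ k := by positivity
  rw [div_lt_iff₀ (sub_pos.2 h), pow_succ] at hm
  set t : ℝ := lo * 3 ^ m / 2 ^ k with ht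
  have htlo : lo * 3 ^ m = t * 2 ^ k := by rw [ht]; field_simp
  set a : ℤ := ⌊(t - 1) / 2⌋ + 1 with ha
  have h4 : t < 2 * a + 1 := by
    have := Int.lt_floor_add_one ((t - 1) / 2)
    rw [ha]; push_cast; linarith
  have h5 : (2 * a + 1 : ℝ) ≤ t + 2 := by
    have := Int.floor_le ((t - 1) / 2)
    rw [ha]; push_cast; linarith
  refine ⟨2 ^ k * ((2 * a + 1 : ℤ) : ℚ) / 3 ^ m, ?_, ?_, ?_⟩
  · push_cast
    rw [lt_div_iff₀ h3, htlo, mul_comm]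
    exact mul_lt_mul_of_pos_left h4 h2
  · push_cast
    rw [div_lt_iff₀ h3]
    nlinarith [mul_le_mul_of_nonneg_left h5 h2.le]
  · have : Fact (Nat.Prime 2) := ⟨Nat.prime_two⟩
    have ne : ((2 * a + 1 : ℤ) : ℚ) ≠ 0 := by
      have : (2 * a + 1 : ℤ) ≠ 0 := by omega
      exact_mod_cast this
    rw [padicValRat.div (by positivity) (by positivity), padicValRat.mul (by positivity) ne,
      padicValRat.pow, padicValRat.pow, padicValRat.of_int,
      padicValInt.eq_zero_of_not_dvd (by omega)]
    have e2 : padicValRat 2 (2 : ℚ) = 1 := by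
      exact_mod_cast padicValRat.self (p := 2) (by norm_num)
    have e3 : padicValRat 2 (3 : ℚ) = 0 := by
      have : padicValRat 2 ((3 : ℕ) : ℚ) = padicValNat 2 3 := padicValRat.of_nat
      rw [padicValNat.eq_zero_of_not_dvd (by norm_num)] at this
      exact_mod_cast this
    rw [e2, e3]
    simp

/-- A colouring of the rationals such that all colours are dense. -/
theorem exists_dense_colouring (C : Type v) [Countable C] [Nonempty C] :
    ∃ c : ℚ → C, ∀ (x : C) (lo hi : ℝ), lo < hi → ∃ q : ℚ, lo < q ∧ (q : ℝ) < hi ∧ c q = x := by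
  obtain ⟨e, he⟩ := exists_surjective_nat C
  refine ⟨fun q => e (padicValRat 2 q).natAbs, fun x lo hi h => ?_⟩
  obtain ⟨k, rfl⟩ := he x
  obtain ⟨q, h1, h2, h3⟩ := exists_padicValRat_eq k h
  exact ⟨q, h1, h2, by simp only [h3, Int.natAbs_natCast]⟩

/-! ### The space of finite modifications of a colouring -/

/-- The functions which differ from `c` in finitely many places only, all of them positive. -/
def FiniteModification {C : Type v} (c : ℚ → C) : Type v :=
  {f : ℚ → C // {q | f q ≠ c q}.Finite ∧ ∀ q ≤ 0, f q = c q}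

namespace FiniteModification

variable {C : Type v} {c : ℚ → C}

instance : CoeFun (FiniteModification c) fun _ => ℚ → C := ⟨Subtype.val⟩

theorem ext {f g : FiniteModification c} (h : ∀ q, f q = g q) : f = g := Subtype.ext (funext h)

theorem finite_diff (f g : FiniteModification c) : {q | f q ≠ g q}.Finite := by
  refine (f.2.1.union g.2.1).subset fun q hq => ?_
  by_contra h
  simp only [Set.mem_union, Set.mem_ofPred_eq, not_or, not_not] at h
  exact hq (h.1.trans h.2.symm)

/-- The largest place where `f` and `g` differ, and `0` if there is none. -/
noncomputable def delta (f g : FiniteModification c) : ℚ :=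
  (insert 0 (finite_diff f g).toFinset).max' (Finset.insert_nonempty _ _)

theorem delta_le_iff {f g : FiniteModification c} {r : ℚ} :
    delta f g ≤ r ↔ 0 ≤ r ∧ ∀ q, f q ≠ g q → q ≤ r := by
  simp [delta, Finset.max'_le_iff]

theorem delta_nonneg (f g : FiniteModification c) : 0 ≤ delta f g := (delta_le_iff.1 le_rfl).1

theorem eq_of_delta_lt {f g : FiniteModification c} {q : ℚ} (h : delta f g < q) : f q = g q := by
  by_contra h1
  exact not_lt.2 ((delta_le_iff.1 le_rfl).2 q h1) h

theorem apply_delta_ne {f g : FiniteModification c} (h : f ≠ g) : f (delta f g) ≠ g (delta f g) := by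
  have h1 := Finset.max'_mem (insert 0 (finite_diff f g).toFinset) (Finset.insert_nonempty _ _)
  rcases Finset.mem_insert.1 h1 with h2 | h2
  · refine absurd (ext fun q => ?_) h
    rcases le_or_gt q 0 with hq | hq
    · rw [f.2.2 q hq, g.2.2 q hq]
    · exact eq_of_delta_lt (h2.trans_lt hq)
  · exact (Set.Finite.mem_toFinset _).1 h2

theorem pos_of_ne {f g : FiniteModification c} {q : ℚ} (h : f q ≠ g q) : 0 < q := by
  by_contra! h1
  exact h ((f.2.2 q h1).trans (g.2.2 q h1).symm)

theorem delta_eq {f g : FiniteModification c} {q : ℚ} (h : f q ≠ g q)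
    (h' : ∀ p, q < p → f p = g p) : delta f g = q := by
  apply le_antisymm
  · refine delta_le_iff.2 ⟨(pos_of_ne h).le, fun p hp => ?_⟩
    by_contra! h1
    exact hp (h' p h1)
  · by_contra! h1
    exact h (eq_of_delta_lt h1)

theorem delta_comm (f g : FiniteModification c) : delta f g = delta g f := by
  unfold delta; congr 2; ext q; simp [ne_comm]

theorem delta_self (f : FiniteModification c) : delta f f = 0 :=
  le_antisymm (delta_le_iff.2 ⟨le_rfl, by simp⟩) (delta_nonneg _ _)

theorem delta_um (f g h : FiniteModification c) : delta f h ≤ max (delta f g) (delta g h) := by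
  refine delta_le_iff.2 ⟨(delta_nonneg f g).trans (le_max_left _ _), fun q hq => ?_⟩
  by_contra! h1
  exact hq ((eq_of_delta_lt ((le_max_left _ _).trans_lt h1)).trans
    (eq_of_delta_lt ((le_max_right _ _).trans_lt h1)))

noncomputable instance : MetricSpace (FiniteModification c) where
  dist f g := delta f g
  dist_self f := by simp [delta_self]
  dist_comm f g := by rw [delta_comm]
  dist_triangle f g h := by
    have := (delta_um f g h).trans (max_le_add_of_nonneg (delta_nonneg _ _) (delta_nonneg _ _))
    exact_mod_cast this
  eq_of_dist_eq_zero {f g} h := by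
    have h0 : delta f g = 0 := by exact_mod_cast h
    by_contra hne
    have := pos_of_ne (apply_delta_ne hne)
    rw [h0] at this
    exact lt_irrefl _ this

theorem dist_def (f g : FiniteModification c) : dist f g = delta f g := rfl

theorem dist_eq {f g : FiniteModification c} {q : ℚ} (h : f q ≠ g q)
    (h' : ∀ p, q < p → f p = g p) : dist f g = q := by rw [dist_def, delta_eq h h']

open Classical in
/-- The modification of `f` at `q`. -/
noncomputable def update (f : FiniteModification c) {q : ℚ} (hq : 0 < q) (v : C) :
    FiniteModification c :=
  ⟨Function.update f q v, (f.2.1.insert q).subset fun p hp => by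
    by_cases h : p = q
    · exact Or.inl h
    · refine Or.inr ?_
      simpa [Function.update_of_ne h] using hp, fun p hp => by
    rw [Function.update_of_ne (hp.trans_lt hq).ne]; exact f.2.2 p hp⟩

theorem update_self (f : FiniteModification c) {q : ℚ} (hq : 0 < q) (v : C) :
    f.update hq v q = v := Function.update_self _ _ _

theorem update_of_ne (f : FiniteModification c) {q : ℚ} (hq : 0 < q) (v : C) {p : ℚ} (h : p ≠ q) :
    f.update hq v p = f p := Function.update_of_ne h _ _

theorem update_of_gt (f : FiniteModification c) {q : ℚ} (hq : 0 < q) (v : C) (p : ℚ) (h : q < p) :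
    f p = f.update hq v p := (f.update_of_ne hq v h.ne').symm

theorem dist_update {f : FiniteModification c} {q : ℚ} (hq : 0 < q) {v : C} (hv : f q ≠ v) :
    dist f (f.update hq v) = q :=
  dist_eq (by rwa [update_self]) (f.update_of_gt hq v)

theorem countable [Countable C] : Countable (FiniteModification c) := by
  classical
  have : Function.Injective fun f : FiniteModification c =>
      f.2.1.toFinset.image fun q => (q, f q) := by
    intro f g h
    have key : ∀ (f : FiniteModification c) q x,
        (q, x) ∈ f.2.1.toFinset.image (fun q => (q, f q)) ↔ f q ≠ c q ∧ f q = x := by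
      intro f q x
      simp only [Finset.mem_image, Set.Finite.mem_toFinset, Set.mem_ofPred_eq, Prod.mk.injEq]
      constructor
      · rintro ⟨q, h1, rfl, h2⟩; exact ⟨h1, h2⟩
      · rintro ⟨h1, h2⟩; exact ⟨q, h1, rfl, h2⟩
    have hk : ∀ q x, (f q ≠ c q ∧ f q = x) ↔ (g q ≠ c q ∧ g q = x) := fun q x => by
      rw [← key, ← key]
      exact iff_of_eq (congrArg (fun s => (q, x) ∈ s) h)
    refine ext fun q => ?_
    by_cases hf : f q = c q
    · by_cases hg : g q = c q
      · rw [hf, hg]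
      · exact ((hk q _).2 ⟨hg, rfl⟩).2
    · exact ((hk q _).1 ⟨hf, rfl⟩).2.symm
  exact this.countable


open Classical in
/-- The label given by the colour. -/
noncomputable def label (code : C → ℕ) (f : FiniteModification c) (r : ℝ) : ℕ :=
  -- The default for irrational `r` does not depend on `f`, as all modifications take the value `c
  -- 0` at `0`.
  if h : ∃ q : ℚ, (q : ℝ) = r then code (f h.choose) else code (f 0)

theorem label_cast (code : C → ℕ) (f : FiniteModification c) (q : ℚ) :
    label code f (q : ℝ) = code (f q) := by
  have h : ∃ p : ℚ, (p : ℝ) = q := ⟨q, rfl⟩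
  rw [label, dif_pos h]
  have : h.choose = q := by exact_mod_cast h.choose_spec
  rw [this]

section order

variable [LinearOrder C]

/-- The lexicographic order, large places being more significant. -/
def Lex (f g : FiniteModification c) : Prop := ∃ q, f q < g q ∧ ∀ p, q < p → f p = g p

theorem isStrictTotalOrder_lex : IsStrictTotalOrder (FiniteModification c) Lex where
  trichotomous f g h1 h2 := by
    by_contra hne
    rcases lt_or_gt_of_ne (apply_delta_ne hne) with h | h
    · exact h1 ⟨_, h, fun p hp => eq_of_delta_lt hp⟩
    · exact h2 ⟨_, h, fun p hp => (eq_of_delta_lt hp).symm⟩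
  irrefl f := by rintro ⟨q, h, -⟩; exact lt_irrefl _ h
  trans f g h := by
    rintro ⟨q, h1, h2⟩ ⟨p, h3, h4⟩
    rcases lt_trichotomy q p with h | rfl | h
    · exact ⟨p, by rwa [h2 p h], fun s hs => (h2 s (h.trans hs)).trans (h4 s hs)⟩
    · exact ⟨q, h1.trans h3, fun s hs => (h2 s hs).trans (h4 s hs)⟩
    · exact ⟨q, by rwa [← h4 q h], fun s hs => (h2 s hs).trans (h4 s (h.trans hs))⟩

open Classical in
noncomputable instance : LinearOrder (FiniteModification c) :=
  have := isStrictTotalOrder_lex (c := c)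
  linearOrderOfSTO Lex

theorem lt_def {f g : FiniteModification c} : f < g ↔ ∃ q, f q < g q ∧ ∀ p, q < p → f p = g p :=
  Iff.rfl

theorem apply_delta_lt {f g : FiniteModification c} (h : f < g) :
    f (delta f g) < g (delta f g) := by
  obtain ⟨q, h1, h2⟩ := lt_def.1 h
  rwa [delta_eq h1.ne h2]

theorem lt_update {f : FiniteModification c} {q : ℚ} (hq : 0 < q) {v : C} (hv : f q < v) :
    f < f.update hq v := lt_def.2 ⟨q, by rwa [update_self], f.update_of_gt hq v⟩

theorem update_lt {f : FiniteModification c} {q : ℚ} (hq : 0 < q) {v : C} (hv : v < f q) :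
    f.update hq v < f :=
  lt_def.2 ⟨q, by rwa [update_self], fun p hp => (f.update_of_gt hq v p hp).symm⟩

/-- The points of a polygon differ pairwise last at one and the same place, so they take distinct
values there, and the number of colours bounds the polygon. -/
theorem isOrderedUltrametric {N : ℕ∞} (hN : 1 ≤ N) (hC : ∀ P : Finset C, (P.card : ℕ∞) ≤ N) :
    IsOrderedUltrametric N (FiniteModification c) where
  ultrametric f g h := by
    rw [dist_def, dist_def, dist_def]; exact_mod_cast delta_um f g h
  convex f g h := by
    rw [dist_def, dist_def]
    rintro ⟨q, h1, h2⟩ ⟨p, h3, h4⟩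
    have h5 := delta_eq h1.ne h2
    rw [h5]
    have key := (delta_le_iff (f := f) (g := h)).1 le_rfl
    rcases lt_trichotomy q p with hqp | rfl | hqp
    · exact_mod_cast hqp.le.trans (key.2 p (by rw [h2 p hqp]; exact h3.ne))
    · exact_mod_cast key.2 q (h1.trans h3).ne
    · exact_mod_cast key.2 q (by rw [← h4 q hqp]; exact h1.ne)
  rational f g := ⟨_, rfl⟩
  polygon r P hr hP := by
    classical
    by_cases h : P.card ≤ 1
    · exact le_trans (by exact_mod_cast h) hN
    · obtain ⟨a, ha, b, hb, hab⟩ := Finset.one_lt_card.1 (not_le.1 h)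
      have hr' : r = delta a b := (hP ha hb hab).symm
      have inj : Set.InjOn (fun f : FiniteModification c => f (delta a b)) P := by
        intro f hf g hg hfg
        by_contra hne
        have h1 : dist f g = r := hP hf hg hne
        rw [hr', dist_def] at h1
        have h2 : delta f g = delta a b := by exact_mod_cast h1
        have h3 := apply_delta_ne hne
        rw [h2] at h3
        exact h3 hfg
      rw [← Finset.card_image_of_injOn inj]
      exact hC _

theorem isLabelling_label {N : ℕ∞} {code : C → ℕ} (h1 : N ≠ ⊤ → StrictMono code)
    (h2 : N ≠ ⊤ → ∀ x, (code x : ℕ∞) < N) (h3 : N = ⊤ → ∀ x, code x = 0) :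
    IsLabelling N (label (c := c) code) where
  lt hN f g hfg := by
    rw [dist_def, label_cast, label_cast]
    exact h1 hN (apply_delta_lt hfg)
  lt_bound hN f r := by
    unfold label; split_ifs <;> exact h2 hN _
  congr f g r hfg := by
    unfold label
    split_ifs with h
    · rw [← h.choose_spec, dist_def] at hfg
      rw [eq_of_delta_lt (by exact_mod_cast hfg)]
    · rw [f.2.2 0 le_rfl, g.2.2 0 le_rfl]
  top hN f r := by
    unfold label; split_ifs <;> exact h3 hN _

/-- Changing the value at a place `q` moves a point exactly by `q`, which gives most of the
conditions. Density of the colours is needed for finite `N` only: as `a` equals `c` just above `lo`,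
up to its next exceptional place, it has the colour required at some place there. -/
theorem isRich [Countable C] {N : ℕ∞} (hN : 2 ≤ N) {code : C → ℕ}
    (hc : ∀ (x : C) (lo hi : ℝ), lo < hi → ∃ q : ℚ, lo < q ∧ (q : ℝ) < hi ∧ c q = x)
    [Nontrivial C] (hC : ∀ P : Finset C, (P.card : ℕ∞) ≤ N) (h1 : N ≠ ⊤ → StrictMono code)
    (h2 : N ≠ ⊤ → ∀ x, (code x : ℕ∞) < N) (h3 : N = ⊤ → ∀ x, code x = 0)
    (h4 : N ≠ ⊤ → ∀ j : ℕ, (j : ℕ∞) < N → ∃ x, code x = j)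
    (h5 : N = ⊤ → DenselyOrdered C ∧ NoMinOrder C ∧ NoMaxOrder C) :
    IsRich N (label (c := c) code) := by
  have dpos : ∀ {a b : FiniteModification c}, a ≠ b → 0 < delta a b := fun h =>
    pos_of_ne (apply_delta_ne h)
  refine ⟨countable, isOrderedUltrametric (le_trans (by norm_num) hN) hC, isLabelling_label h1 h2 h3,
    hN, ⟨⟨c, by simp, fun _ _ => rfl⟩⟩, fun f q hq => ?_, ?_, ?_, ?_, ?_, ?_, ?_, ?_⟩
  · obtain ⟨v, hv⟩ := exists_ne (f q)
    exact ⟨f.update hq v, dist_update hq hv.symm⟩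
  · intro hNt a lo hi h0 hlh i j hij hi' hj
    obtain ⟨x, rfl⟩ := h4 hNt i hi'
    obtain ⟨y, rfl⟩ := h4 hNt j hj
    obtain ⟨hi₁, hi₂, hi₃, hi₄⟩ : ∃ hi₁ : ℝ, lo < hi₁ ∧ hi₁ ≤ hi ∧
        ∀ q : ℚ, lo < q → (q : ℝ) < hi₁ → a q = c q := by
      have hfin := a.2.1
      by_cases hne : {q | (a.1 q ≠ c q) ∧ lo < (q : ℝ)}.Nonempty
      · obtain ⟨t, ht, hmin⟩ := Set.exists_min_image _ id (hfin.subset fun q hq => hq.1) hne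
        refine ⟨min hi t, lt_min hlh ht.2, min_le_left _ _, fun q hq1 hq2 => ?_⟩
        by_contra h6
        have h7 : t ≤ q := hmin q ⟨h6, hq1⟩
        have h8 : (t : ℝ) ≤ q := by exact_mod_cast h7
        exact not_lt.2 h8 (hq2.trans_le (min_le_right _ _))
      · refine ⟨hi, hlh, le_rfl, fun q hq1 _ => ?_⟩
        by_contra h6
        exact hne ⟨q, h6, hq1⟩
    obtain ⟨q, hq1, hq2, hq3⟩ := hc x lo hi₁ hi₂
    have hq : 0 < q := by exact_mod_cast h0.trans_lt hq1
    have hax : a q = x := (hi₄ q hq1 hq2).trans hq3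
    have hd : dist a (a.update hq y) = q := dist_update hq (by
      rw [hax]; rintro rfl; exact hij rfl)
    refine ⟨a.update hq y, ?_⟩
    rw [hd, label_cast, label_cast, update_self, hax]
    exact ⟨hq1, hq2.trans_le hi₃, rfl, rfl⟩
  · intro hNt a b hab j hj
    obtain ⟨y, rfl⟩ := h4 hNt j hj
    refine ⟨a.update (dpos hab) y, ?_, ?_⟩
    · by_cases h : a (delta a b) = y
      · have : a.update (dpos hab) y = a := ext fun q => by
          by_cases hq : q = delta a b
          · rw [hq, update_self, h]
          · rw [update_of_ne _ _ _ hq]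
        rw [this, dist_self]; exact dist_nonneg
      · rw [dist_update _ h, dist_def]
    · rw [dist_def, label_cast, update_self]
  · intro hNt a lo hi h0 hlh
    obtain ⟨_, _, _⟩ := h5 hNt
    obtain ⟨q, hq1, hq2⟩ := exists_rat_btwn hlh
    have hq : 0 < q := by exact_mod_cast h0.trans_lt hq1
    obtain ⟨v, hv⟩ := exists_gt (a q)
    refine ⟨a.update hq v, ?_⟩
    rw [dist_update hq hv.ne]
    exact ⟨hq1, hq2, lt_update hq hv⟩
  · intro hNt a lo hi h0 hlh
    obtain ⟨_, _, _⟩ := h5 hNt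
    obtain ⟨q, hq1, hq2⟩ := exists_rat_btwn hlh
    have hq : 0 < q := by exact_mod_cast h0.trans_lt hq1
    obtain ⟨v, hv⟩ := exists_lt (a q)
    refine ⟨a.update hq v, ?_⟩
    rw [dist_update hq hv.ne']
    exact ⟨hq1, hq2, update_lt hq hv⟩
  · intro hNt a b hab
    obtain ⟨_, _, _⟩ := h5 hNt
    obtain ⟨v, hv1, hv2⟩ := exists_between (apply_delta_lt hab)
    have agree : ∀ p, delta a b < p → a.update (dpos hab.ne) v p = b p := fun p hp => by
      rw [← a.update_of_gt _ v p hp]; exact eq_of_delta_lt hp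
    have hvb : a.update (dpos hab.ne) v (delta a b) < b (delta a b) := by rwa [update_self]
    exact ⟨a.update (dpos hab.ne) v, lt_update _ hv1, lt_def.2 ⟨_, hvb, agree⟩,
      dist_update _ hv1.ne, dist_eq hvb.ne agree⟩
  · intro hNt a b hab
    obtain ⟨_, _, _⟩ := h5 hNt
    obtain ⟨v, hv⟩ := exists_gt (a (delta a b))
    exact ⟨a.update (dpos hab) v, lt_update _ hv, dist_update _ hv.ne⟩
  · intro hNt a b hab
    obtain ⟨_, _, _⟩ := h5 hNt
    obtain ⟨v, hv⟩ := exists_lt (a (delta a b))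
    exact ⟨a.update (dpos hab) v, update_lt _ hv, dist_update _ hv.ne'⟩

end order

end FiniteModification

/-- There are rich spaces for all `N ≥ 2`. -/
theorem exists_isRich {N : ℕ∞} (hN : 2 ≤ N) : ∃ (M : Type) (_ : MetricSpace M) (_ : LinearOrder M)
    (rk : M → ℝ → ℕ), IsRich N rk := by
  induction N using ENat.recTopCoe with
  | top =>
    obtain ⟨c, hc⟩ := exists_dense_colouring ℚ
    exact ⟨FiniteModification c, inferInstance, inferInstance, _,
      FiniteModification.isRich (code := fun _ => 0) hN hc (fun _ => le_top) (fun h => absurd rfl h)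
        (fun h => absurd rfl h) (fun _ _ => rfl) (fun h => absurd rfl h)
        fun _ => ⟨inferInstance, inferInstance, inferInstance⟩⟩
  | coe n =>
    have hn : 2 ≤ n := by exact_mod_cast hN
    have : Nontrivial (Fin n) := Fin.nontrivial_iff_two_le.2 hn
    obtain ⟨c, hc⟩ := exists_dense_colouring (Fin n)
    have hnt : (n : ℕ∞) ≠ ⊤ := ENat.natCast_ne_top n
    exact ⟨FiniteModification c, inferInstance, inferInstance, _,
      FiniteModification.isRich (code := Fin.val) hN hc
        (fun P => by
          have := Finset.card_le_univ P
          rw [Fintype.card_fin] at this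
          exact_mod_cast this)
        (fun _ => Fin.val_strictMono) (fun _ x => by exact_mod_cast x.2) (fun h => absurd h hnt)
        (fun _ j hj => ⟨⟨j, by exact_mod_cast hj⟩, rfl⟩) fun h => absurd h hnt⟩

/-! ### Rich spaces are Urysohn spaces. -/

namespace IsRich

variable {N : ℕ∞} {M : Type v} [MetricSpace M] [LinearOrder M] {rk : M → ℝ → ℕ}

/-- Partial isomorphisms from a finite space extend to the whole space. -/
theorem exists_embedding (h : IsRich N rk) {B : Type u} [MetricSpace B] [LinearOrder B] [Finite B]
    (hB : IsOrderedUltrametric N B) {rkB : B → ℝ → ℕ} (hrk : IsLabelling N rkB) {f : B → M}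
    {Y : Set B} (hf : PIso rkB rk f Y) :
    ∃ g : B → M, IsOrderedBPEmbedding g ∧ ∀ y ∈ Y, g y = f y := by
  classical
  have ext : ∀ T : Finset B, ∃ g : B → M, PIso rkB rk g (Y ∪ T) ∧ ∀ y ∈ Y, g y = f y := by
    intro T
    induction T using Finset.induction_on with
    | empty => exact ⟨f, by simpa using hf, fun _ _ => rfl⟩
    | insert x T _ ih =>
      obtain ⟨g, hg, hgf⟩ := ih
      by_cases hx : x ∈ Y ∪ (T : Set B)
      · refine ⟨g, hg.mono ?_, hgf⟩
        rw [Finset.coe_insert, Set.union_insert, Set.insert_eq_of_mem hx]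
      · obtain ⟨y, hy⟩ := h.exists_insert hB.isConvexUltrametric hrk hg (Set.toFinite _) hx
        refine ⟨Function.update g x y, ?_, fun z hz => ?_⟩
        · rwa [Finset.coe_insert, Set.union_insert]
        · rw [Function.update_of_ne (by rintro rfl; exact hx (Or.inl hz)), hgf z hz]
  have := Fintype.ofFinite B
  obtain ⟨g, hg, hgf⟩ := ext Finset.univ
  have mem : ∀ x : B, x ∈ Y ∪ ((Finset.univ : Finset B) : Set B) := fun x => by simp
  exact ⟨g, (isOrderedBPEmbedding_iff hB.ultrametric h.ou.ultrametric).2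
    ⟨fun x y => hg.lt x (mem x) y (mem y), fun x y z => hg.le x (mem x) y (mem y) z (mem z)⟩, hgf⟩

/-- A finite set is contained in one that determines the labels of its points. -/
theorem exists_labelled (h : IsRich N rk) (A : Finset M) : ∃ A' : Finset M, A ⊆ A' ∧
    ∀ (B : Type v) [MetricSpace B] [LinearOrder B] (rkB : B → ℝ → ℕ), IsLabelling N rkB →
      ∀ f : M → B, (∀ x ∈ A', ∀ y ∈ A', x < y → f x < f y) →
        (∀ x ∈ A', ∀ y ∈ A', ∀ z ∈ A',
          dist x y ≤ dist x z ↔ dist (f x) (f y) ≤ dist (f x) (f z)) → PIso rk rkB f A := by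
  classical
  induction hN : N using ENat.recTopCoe with
  | top =>
    refine ⟨A, subset_rfl, fun B _ _ rkB hrk f h1 h2 => ⟨h1, h2, fun x _ y _ _ => ?_⟩⟩
    rw [h.lab.top hN, hrk.top rfl]
  | coe n =>
    -- A polygon with `N` points through each pair is added to `A`; on such polygons there is only
    -- one labelling. This is why weak injectivity has a larger set `A'`.
    have ex : ∀ p : M × M, ∃ Q : Finset M, p.1 ≠ p.2 →
        p.1 ∈ Q ∧ p.2 ∈ Q ∧ Q.card = n ∧ IsPolygon (dist p.1 p.2) Q := fun p => by
      by_cases hp : p.1 = p.2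
      · exact ⟨∅, fun h => absurd hp h⟩
      · obtain ⟨Q, hQ⟩ := h.exists_fullPolygon hN hp
        exact ⟨Q, fun _ => hQ⟩
    choose Q hQ using ex
    refine ⟨A ∪ (A ×ˢ A).biUnion Q, Finset.subset_union_left,
      fun B _ _ rkB hrk f h1 h2 => ⟨fun x hx y hy => h1 x (Finset.mem_union_left _ hx) y
        (Finset.mem_union_left _ hy), fun x hx y hy z hz => h2 x (Finset.mem_union_left _ hx) y
        (Finset.mem_union_left _ hy) z (Finset.mem_union_left _ hz), fun x hx y hy hxy => ?_⟩⟩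
    obtain ⟨hx', hy', hc, hp⟩ := hQ (x, y) hxy
    have sub : ∀ z ∈ Q (x, y), z ∈ A ∪ (A ×ˢ A).biUnion Q := fun z hz =>
      Finset.mem_union_right _ (Finset.mem_biUnion.2 ⟨(x, y), Finset.mk_mem_product hx hy, hz⟩)
    exact (hN ▸ h.lab : IsLabelling n rk).eq_of_fullPolygon hrk hp hc
      (fun a ha b hb => h1 a (sub a ha) b (sub b hb)) (fun a ha b hb hab =>
        dist_eq_of_isPolygon hp (fun x hx y hy z hz e => le_antisymm
          ((h2 x (sub x hx) y (sub y hy) z (sub z hz)).1 e.le)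
          ((h2 x (sub x hx) z (sub z hz) y (sub y hy)).1 e.ge)) hx' hy' hxy ha hb hab) x hx'

/-- Rich spaces are Urysohn spaces. -/
theorem isOrderedUrysohn (h : IsRich N rk) : IsOrderedUrysohn N M := by
  classical
  refine ⟨h.countable, h.ou, fun B _ _ _ hB => ?_, fun A => ?_, fun _ => h.distances⟩
  · obtain ⟨m⟩ := h.nonempty
    obtain ⟨g, hg, -⟩ := h.exists_embedding hB (isLabelling_rank hB) (f := fun _ => m) (Y := ∅)
      ⟨by simp, by simp, by simp⟩
    exact ⟨g, hg⟩
  · obtain ⟨A', hA, hA'⟩ := h.exists_labelled A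
    refine ⟨A', hA, fun B _ _ _ hB f hf => ?_⟩
    rcases isEmpty_or_nonempty B with hE | ⟨⟨b₀⟩⟩
    · refine ⟨isEmptyElim, (isOrderedBPEmbedding_iff hB.ultrametric h.ou.ultrametric).2
        ⟨fun x => isEmptyElim x, fun x => isEmptyElim x⟩, fun a => isEmptyElim (f a)⟩
    obtain ⟨hf1, hf2⟩ := (isOrderedBPEmbedding_iff (h.ou.finset A').ultrametric hB.ultrametric).1 hf
    let F : M → B := fun x => if hx : x ∈ A' then f ⟨x, hx⟩ else b₀
    have hF : ∀ x (hx : x ∈ A'), F x = f ⟨x, hx⟩ := fun x hx => dif_pos hx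
    have hP := hA' B (rank N) (isLabelling_rank hB) F
      (fun x hx y hy hxy => by rw [hF x hx, hF y hy]; exact hf1 hxy)
      (fun x hx y hy z hz => by rw [hF x hx, hF y hy, hF z hz]; exact hf2 ⟨x, hx⟩ ⟨y, hy⟩ ⟨z, hz⟩)
    have := h.nonempty
    -- On `A` the embedding respects labels, so its inverse is a partial isomorphism from `B` to
    -- `M`, which extends to all of `B`.
    have hi : ∀ a ∈ (A : Set M), Function.invFunOn F A (F a) = a := hP.injOn.leftInvOn_invFunOn
    obtain ⟨g, hg, hgF⟩ := h.exists_embedding hB (isLabelling_rank hB) (hP.of_inverse hi)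
    refine ⟨g, hg, fun a ha => ?_⟩
    rw [← hF a a.2, hgF _ ⟨a, ha, rfl⟩, hi a ha]

end IsRich

/-! ### The cases `N ≤ 1` -/

theorem IsOrderedUltrametric.subsingleton {N : ℕ∞} {X : Type u} [MetricSpace X] [LinearOrder X]
    (h : IsOrderedUltrametric N X) (hN : ¬ 2 ≤ N) : Subsingleton X := by
  classical
  refine ⟨fun x y => ?_⟩
  by_contra hxy
  have := h.polygon (dist x y) {x, y} (dist_pos.2 hxy)
    (IsPolygon.insert (by simp [IsPolygon]) (by simp [dist_comm]))
  rw [Finset.card_pair hxy] at this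
  exact hN this

theorem IsOrderedUltrametric.ne_zero {N : ℕ∞} {X : Type u} [MetricSpace X] [LinearOrder X]
    (h : IsOrderedUltrametric N X) (x : X) : N ≠ 0 := by
  rintro rfl
  have := h.polygon 1 {x} one_pos (by simp [IsPolygon])
  simp at this

theorem exists_isOrderedUrysohn_of_not_two_le {N : ℕ∞} (hN : ¬ 2 ≤ N) :
    ∃ (M : Type) (_ : MetricSpace M) (_ : LinearOrder M), IsOrderedUrysohn N M := by
  -- One point, or none if `N = 0`, since a single point is already a polygon.
  let M := {_x : Unit // N ≠ 0}
  have hM : IsOrderedUltrametric N M := by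
    refine ⟨fun x y z => ?_, fun x y z hxy => absurd hxy ?_, fun x y => ⟨0, ?_⟩, fun r P _ _ => ?_⟩
    · rw [Subsingleton.elim x z, dist_self]
      exact le_max_of_le_left dist_nonneg
    · rw [Subsingleton.elim x y]; exact lt_irrefl _
    · rw [Subsingleton.elim x y, dist_self, Rat.cast_zero]
    · rcases P.eq_empty_or_nonempty with rfl | ⟨x, -⟩
      · simp
      · have : P.card ≤ 1 := Finset.card_le_one.2 fun a _ b _ => Subsingleton.elim a b
        exact le_trans (by exact_mod_cast this) (Order.one_le_iff_ne_zero.2 x.2)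
  have emb : ∀ (B : Type) [MetricSpace B] [LinearOrder B], Finite B → IsOrderedUltrametric N B →
      ∃ g : B → M, IsOrderedBPEmbedding g := by
    intro B _ _ _ hB
    have := hB.subsingleton hN
    refine ⟨fun b => ⟨(), hB.ne_zero b⟩, (isOrderedBPEmbedding_iff hB.ultrametric
      hM.ultrametric).2 ⟨fun x y hxy => absurd hxy ?_, fun x y z => ?_⟩⟩
    · rw [Subsingleton.elim x y]; exact lt_irrefl _
    · rw [Subsingleton.elim y z]; simp
  refine ⟨M, inferInstance, inferInstance, inferInstance, hM, emb, fun A => ⟨A, subset_rfl,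
    fun B _ _ hfin hB f _ => ?_⟩, fun h => absurd h hN⟩
  obtain ⟨g, hg⟩ := emb B hfin hB
  exact ⟨g, hg, fun a _ => Subsingleton.elim _ _⟩

theorem exists_isOrderedUrysohn (N : ℕ∞) :
    ∃ (M : Type) (_ : MetricSpace M) (_ : LinearOrder M), IsOrderedUrysohn N M := by
  by_cases hN : 2 ≤ N
  · obtain ⟨M, i₁, i₂, rk, h⟩ := exists_isRich hN
    exact ⟨M, i₁, i₂, h.isOrderedUrysohn⟩
  · exact exists_isOrderedUrysohn_of_not_two_le hN

/-! ### Cofinal amalgamation -/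

theorem mem_suppIn_univ {M : Type u} {G : Subgroup (Equiv.Perm M)} {g : Equiv.Perm M} :
    g ∈ suppIn G Set.univ ↔ g ∈ G :=
  ⟨fun h => h.1, fun h => ⟨h, fun x hx => absurd (Set.mem_univ x) hx⟩⟩

section CAP

variable {M : Type u} [MetricSpace M] [LinearOrder M]

/-- The restriction of a bp-automorphism to a finite set. -/
def PartialBP.restrict [DecidableEq M] (hu : ∀ x y z : M, dist x z ≤ max (dist x y) (dist y z))
    {g : Equiv.Perm M} (hg : g ∈ BP M) (D : Finset M) : PartialBP M where
  dom := D
  rng := D.image g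
  toEquiv := g.subtypeEquiv fun a => by simp
  isBPEquiv := isBPEquiv_of_finite fun x y z => dist_le_iff_of_isBPEquiv hu hu hg.1 x y z
  strictMono := fun _ _ h => hg.2 h

/-- The partial bp-automorphisms which are amalgamation bases. -/
def PartialBP.amalgBases (M : Type u) [MetricSpace M] [LinearOrder M] : Set (PartialBP M) :=
  {S | ∃ g ∈ BP M, (∀ x : S.dom, g x = S.toEquiv x) ∧ IsAmalgBase (BP M) Set.univ S.dom g}

/-- Conjugation by the two embeddings turns automorphisms extending `T₁` and `T₂` into automorphisms
extending `S`, which can be amalgamated since `S` is a base. The finite part that matters is then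
resolved once more, to return to the subfamily. -/
theorem PartialBP.hasCAP (hu : ∀ x y z : M, dist x z ≤ max (dist x y) (dist y z))
    (hr : ∀ g ∈ BP M, ∀ Y : Finset M, Resolvable (BP M) Set.univ g Y) :
    HasCAP {S : PartialBP M | S.Extendable} := by
  classical
  refine ⟨PartialBP.amalgBases M, ⟨?_, ?_⟩, ?_⟩
  · rintro S ⟨g, hg, h, -⟩
    exact ⟨g, hg, h⟩
  · rintro S ⟨g, hg, h⟩
    obtain ⟨k, hk, D, -, h1, h2⟩ := hr g hg S.dom
    refine ⟨PartialBP.restrict hu hk.1 D, ⟨k, hk.1, fun _ => rfl, h2⟩, 1, one_mem _, fun x => ?_⟩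
    obtain ⟨h3, h4⟩ := h1 x x.2 (Set.mem_univ _)
    exact ⟨h3, h4.trans (h x)⟩
  · rintro S ⟨gS, hgS, eS, hb⟩ T₁ ⟨g₁, hg₁, e₁, -⟩ T₂ ⟨g₂, hg₂, e₂, -⟩ φ₁ φ₂ ⟨hφ₁, i₁⟩ ⟨hφ₂, i₂⟩
    have conj : ∀ {T : PartialBP M} {g φ : Equiv.Perm M}, (∀ x : T.dom, g x = T.toEquiv x) →
        (∀ x : S.dom, ∃ h : φ x ∈ T.dom, (T.toEquiv ⟨φ x, h⟩ : M) = φ (S.toEquiv x)) →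
        ∀ x ∈ S.dom, (φ⁻¹ * g * φ) x = gS x := by
      intro T g φ e i x hx
      obtain ⟨h1, h2⟩ := i ⟨x, hx⟩
      have h3 := e ⟨φ x, h1⟩
      change φ⁻¹ (g (φ x)) = gS x
      rw [Equiv.Perm.inv_eq_iff_eq, eS ⟨x, hx⟩, ← h2]
      exact h3
    have hc₁ : φ₁⁻¹ * g₁ * φ₁ ∈ BP M := mul_mem (mul_mem (inv_mem hφ₁) hg₁) hφ₁
    have hc₂ : φ₂⁻¹ * g₂ * φ₂ ∈ BP M := mul_mem (mul_mem (inv_mem hφ₂) hg₂) hφ₂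
    obtain ⟨g, hg, k, hk, h1, h2, h3⟩ := hb _ (mem_suppIn_univ.2 hc₁) _ (mem_suppIn_univ.2 hc₂)
      (conj e₁ i₁) (conj e₂ i₂) (T₁.dom.image ⇑φ₁⁻¹) (T₂.dom.image ⇑φ₂⁻¹)
    obtain ⟨g', hg', D, -, h4, h5⟩ := hr g hg.1 (T₁.dom.image ⇑φ₁⁻¹ ∪ (T₂.dom.image ⇑φ₂⁻¹).image k)
    refine ⟨PartialBP.restrict hu hg'.1 D, ⟨g', hg'.1, fun _ => rfl, h5⟩, φ₁⁻¹, k * φ₂⁻¹,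
      ⟨inv_mem hφ₁, fun x => ?_⟩, ⟨mul_mem hk.1 (inv_mem hφ₂), fun x => ?_⟩, fun x hx => ?_⟩
    · have hx := Finset.mem_image_of_mem (⇑φ₁⁻¹) x.2
      obtain ⟨h6, h7⟩ := h4 _ (Finset.mem_union_left _ hx) (Set.mem_univ _)
      refine ⟨h6, ?_⟩
      change g' (φ₁⁻¹ x) = _
      rw [h7, h2 _ hx, ← e₁ x]
      simp
    · have hx := Finset.mem_image_of_mem (⇑φ₂⁻¹) x.2
      obtain ⟨h6, h7⟩ := h4 _ (Finset.mem_union_right _ (Finset.mem_image_of_mem k hx)) (Set.mem_univ _)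
      refine ⟨h6, ?_⟩
      change g' (k (φ₂⁻¹ x)) = k (φ₂⁻¹ _)
      rw [h7, h3 _ hx, ← e₂ x]
      simp
    · rw [inv_apply_apply, Equiv.Perm.mul_apply, inv_apply_apply]
      rcases hx with hx | hx
      · exact (h1 x hx).1.symm
      · obtain ⟨y, hy⟩ := S.toEquiv.surjective ⟨x, hx⟩
        have h6 := (h1 y y.2).2
        rw [eS y, hy] at h6
        exact h6.symm

end CAP

/-! ### Comeager conjugacy classes -/

theorem isOpen_induced_pointwise_iff {α : Type u} {X : Type v} (f : X → α → α) (s : Set X) :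
    @IsOpen X (TopologicalSpace.induced f (@Pi.topologicalSpace α (fun _ => α) (fun _ => ⊥))) s ↔
      ∀ g ∈ s, ∃ Y : Finset α, ∀ g', (∀ y ∈ Y, f g' y = f g y) → g' ∈ s := by
  let _ : TopologicalSpace α := ⊥
  have : DiscreteTopology α := ⟨rfl⟩
  let _ : TopologicalSpace X := TopologicalSpace.induced f inferInstance
  constructor
  · rintro ⟨t, ht, rfl⟩ g hg
    obtain ⟨I, u, h1, h2⟩ := isOpen_pi_iff.1 ht (f g) hg
    refine ⟨I, fun g' hg' => h2 fun i hi => ?_⟩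
    rw [hg' i hi]
    exact (h1 i hi).2
  · intro h
    refine isOpen_iff_forall_mem_open.2 fun g hg => ?_
    obtain ⟨Y, hY⟩ := h g hg
    refine ⟨f ⁻¹' ((Y : Set α).pi fun y => {f g y}), fun g' hg' => hY g' fun y hy => hg' y hy,
      isOpen_induced (isOpen_set_pi Y.finite_toSet fun _ _ => isOpen_discrete _), fun y _ => rfl⟩

section Comeager

variable {M : Type u} {G : Subgroup (Equiv.Perm M)} {D : Finset M} {g k : Equiv.Perm M}

theorem IsAmalgBase.congr {V : Set M} (h : IsAmalgBase G V D g) (hk : ∀ x ∈ D, k x = g x) :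
    IsAmalgBase G V D k := by
  intro g₁ hg₁ g₂ hg₂ e₁ e₂ Y₁ Y₂
  obtain ⟨a, ha, b, hb, h1, h2, h3⟩ := h g₁ hg₁ g₂ hg₂ (fun x hx => (e₁ x hx).trans (hk x hx))
    (fun x hx => (e₂ x hx).trans (hk x hx)) Y₁ Y₂
  refine ⟨a, ha, b, hb, fun x hx => ?_, h2, h3⟩
  rw [hk x hx]; exact h1 x hx

theorem IsAmalgBase.conj [DecidableEq M] (h : IsAmalgBase G Set.univ D g) {w : Equiv.Perm M}
    (hw : w ∈ G) : IsAmalgBase G Set.univ (D.image w) (w * g * w⁻¹) := by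
  have hw' : w ∈ suppIn G Set.univ := ⟨hw, fun x hx => absurd (Set.mem_univ x) hx⟩
  have cj : ∀ {a : Equiv.Perm M}, a ∈ suppIn G Set.univ → w⁻¹ * a * w ∈ suppIn G Set.univ :=
    fun ha => mul_mem (mul_mem (inv_mem hw') ha) hw'
  have cj' : ∀ {a : Equiv.Perm M}, a ∈ suppIn G Set.univ → w * a * w⁻¹ ∈ suppIn G Set.univ :=
    fun ha => mul_mem (mul_mem hw' ha) (inv_mem hw')
  intro g₁ hg₁ g₂ hg₂ e₁ e₂ Y₁ Y₂
  have tr : ∀ {a : Equiv.Perm M}, (∀ x ∈ D.image w, a x = (w * g * w⁻¹) x) →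
      ∀ x ∈ D, (w⁻¹ * a * w) x = g x := fun {a} e x hx => by
    have := e _ (Finset.mem_image_of_mem w hx)
    simp only [Equiv.Perm.mul_apply, inv_apply_apply] at this ⊢
    rw [this, inv_apply_apply]
  obtain ⟨a, ha, b, hb, h1, h2, h3⟩ := h _ (cj hg₁) _ (cj hg₂) (tr e₁) (tr e₂)
    (Y₁.image ⇑w⁻¹) (Y₂.image ⇑w⁻¹)
  refine ⟨_, cj' ha, _, cj' hb, fun x hx => ?_, fun y hy => ?_, fun y hy => ?_⟩
  · obtain ⟨d, hd, rfl⟩ := Finset.mem_image.1 hx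
    simp only [Equiv.Perm.mul_apply, inv_apply_apply]
    rw [(h1 d hd).1, (h1 d hd).2]
    exact ⟨rfl, rfl⟩
  · have := h2 _ (Finset.mem_image_of_mem (⇑w⁻¹) hy)
    simp only [Equiv.Perm.mul_apply, apply_inv_apply] at this ⊢
    rw [this, apply_inv_apply]
  · have := h3 _ (Finset.mem_image_of_mem (⇑w⁻¹) hy)
    simp only [Equiv.Perm.mul_apply, apply_inv_apply, inv_apply_apply] at this ⊢
    rw [this]

/-- Permutations of `G` all of whose finite restrictions extend to amalgamation bases, and which
realize all extensions of these. -/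
structure IsGeneric (G : Subgroup (Equiv.Perm M)) (g : Equiv.Perm M) : Prop where
  mem : g ∈ G
  base : ∀ Y : Finset M, ∃ D, Y ⊆ D ∧ IsAmalgBase G Set.univ D g
  realize : ∀ D, IsAmalgBase G Set.univ D g → ∀ k ∈ G, (∀ x ∈ D, k x = g x) → ∀ Y : Finset M,
    ∃ h ∈ G, (∀ x ∈ D, h x = x ∧ h (g x) = g x) ∧ ∀ y ∈ Y, g (h y) = h (k y)

/-- Back and forth with pairs `(D, h)` such that `D` is a base for `g` and `h` intertwines `g` and
`g'` on `D`. To reach a new point, `base` enlarges `D`, and `realize` for the other permutation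
corrects `h` without changing it on `D`. The empty base starts the construction. -/
theorem IsGeneric.exists_conj [Countable M]
    (closed : ∀ e : Equiv.Perm M, (∀ Y : Finset M, ∃ h ∈ G, ∀ y ∈ Y, e y = h y) → e ∈ G)
    (free : ∀ g, IsAmalgBase G Set.univ ∅ g) {g g' : Equiv.Perm M} (hg : IsGeneric G g)
    (hg' : IsGeneric G g') : ∃ e ∈ G, e * g * e⁻¹ = g' := by
  classical
  obtain ⟨e, -, he⟩ := exists_perm_of_backAndForth
    {p : Finset M × (M → M) | IsAmalgBase G Set.univ p.1 g ∧ ∃ h ∈ G, p.2 = ⇑h ∧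
      ∀ x ∈ p.1, h (g x) = g' (h x)} (by
      rintro ⟨D, f⟩ ⟨-, h, -, rfl, -⟩
      exact h.injective.injOn) (by
      rintro ⟨D, f⟩ ⟨hD, h, hh, hf, hx⟩ x
      dsimp only at hf hx hD
      subst hf
      obtain ⟨D', h1, h2⟩ := hg.base (insert x D)
      have hk : h * g * h⁻¹ ∈ G := mul_mem (mul_mem hh hg.mem) (inv_mem hh)
      have hkg : ∀ z ∈ D.image h, (h * g * h⁻¹) z = g' z := fun z hz => by
        obtain ⟨d, hd, rfl⟩ := Finset.mem_image.1 hz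
        simp only [Equiv.Perm.mul_apply, inv_apply_apply]
        exact hx d hd
      obtain ⟨u, hu, u1, u2⟩ := hg'.realize (D.image h)
        ((hD.conj hh).congr fun z hz => (hkg z hz).symm) _ hk hkg (D'.image h)
      refine ⟨(D', ⇑(u * h)), ⟨h2, u * h, mul_mem hu hh, rfl, fun y hy => ?_⟩,
        (Finset.subset_insert _ _).trans h1, fun y hy => ?_, h1 (Finset.mem_insert_self _ _)⟩
      · have := u2 _ (Finset.mem_image_of_mem h hy)
        simp only [Equiv.Perm.mul_apply, inv_apply_apply] at this ⊢
        exact this.symm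
      · exact (u1 _ (Finset.mem_image_of_mem h hy)).1) (by
      rintro ⟨D, f⟩ ⟨hD, h, hh, hf, hx⟩ z
      dsimp only at hf hx hD
      subst hf
      obtain ⟨D', h1, h2⟩ := hg'.base (insert z (D.image h))
      have hk : h⁻¹ * g' * h ∈ G := mul_mem (mul_mem (inv_mem hh) hg'.mem) hh
      obtain ⟨u, hu, u1, u2⟩ := hg.realize D hD _ hk (fun x hxD => by
        simp only [Equiv.Perm.mul_apply]
        rw [← hx x hxD, inv_apply_apply]) (D'.image ⇑h⁻¹)
      have hw : u * h⁻¹ ∈ G := mul_mem hu (inv_mem hh)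
      have u3 : ∀ y ∈ D', g ((u * h⁻¹) y) = (u * h⁻¹) (g' y) := fun y hy => by
        have := u2 _ (Finset.mem_image_of_mem (⇑h⁻¹) hy)
        simp only [Equiv.Perm.mul_apply, apply_inv_apply] at this ⊢
        exact this
      refine ⟨(D'.image ⇑(u * h⁻¹), ⇑(h * u⁻¹)), ⟨(h2.conj hw).congr fun x hx => ?_, h * u⁻¹,
        mul_mem hh (inv_mem hu), rfl, fun x hx => ?_⟩, fun d hd => ?_, fun d hd => ?_,
        (u * h⁻¹) z, Finset.mem_image_of_mem _ (h1 (Finset.mem_insert_self _ _)), by simp⟩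
      · obtain ⟨y, hy, rfl⟩ := Finset.mem_image.1 hx
        rw [u3 y hy]
        simp
      · obtain ⟨y, hy, rfl⟩ := Finset.mem_image.1 hx
        rw [u3 y hy]
        simp
      · refine Finset.mem_image.2 ⟨h d, h1 (Finset.mem_insert_of_mem
          (Finset.mem_image_of_mem h hd)), ?_⟩
        rw [Equiv.Perm.mul_apply, inv_apply_apply, (u1 d hd).1]
      · have : u⁻¹ d = d := by rw [Equiv.Perm.inv_eq_iff_eq, (u1 d hd).1]
        change h (u⁻¹ d) = h d
        rw [this])
    (p₀ := (∅, ⇑(1 : Equiv.Perm M))) ⟨free g, 1, one_mem _, rfl, by simp⟩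
  refine ⟨e, closed e fun Y => ?_, ?_⟩
  · obtain ⟨q, ⟨-, h, hh, hq, -⟩, h1, h2⟩ := he Y
    exact ⟨h, hh, fun y hy => by rw [h2 y (h1 hy), hq]⟩
  · rw [mul_inv_eq_iff_eq_mul]
    ext x
    obtain ⟨q, ⟨-, h, hh, hq, hx⟩, h1, h2⟩ := he {x, g x}
    have hxq : x ∈ q.1 := h1 (by simp)
    have hgq : g x ∈ q.1 := h1 (by simp)
    rw [Equiv.Perm.mul_apply, Equiv.Perm.mul_apply, h2 x hxq, h2 _ hgq, hq, hx x hxq]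

end Comeager

section BPComeager

variable {M : Type u} [MetricSpace M] [LinearOrder M]

/-- Genericity is the conjunction of countably many dense open conditions. Those for `base` are
dense by resolvability, those for `realize` by the amalgamation property of the base. Finite graphs
`τ` stand in for the extensions `k`, of which there may be uncountably many. -/
theorem BP.isGeneric_mem_residual [Countable M]
    (hr : ∀ g ∈ BP M, ∀ Y : Finset M, Resolvable (BP M) Set.univ g Y) :
    {g : BP M | IsGeneric (BP M) g} ∈ @residual (BP M) (BP.pointwiseTopology M) := by
  classical
  let _ : TopologicalSpace (BP M) := BP.pointwiseTopology M
  have hopen : ∀ s : Set (BP M), IsOpen s ↔ ∀ g ∈ s, ∃ Y : Finset M, ∀ g' : BP M,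
      (∀ y ∈ Y, (g' : Equiv.Perm M) y = (g : Equiv.Perm M) y) → g' ∈ s := fun s =>
    isOpen_induced_pointwise_iff (fun g : BP M => ((g : Equiv.Perm M) : M → M)) s
  have hdense : ∀ s : Set (BP M), (∀ g : BP M, ∀ Y : Finset M, ∃ g' ∈ s,
      ∀ y ∈ Y, (g' : Equiv.Perm M) y = (g : Equiv.Perm M) y) → Dense s := by
    intro s hs
    refine dense_iff_inter_open.2 fun t ht ⟨g, hg⟩ => ?_
    obtain ⟨Y, hY⟩ := (hopen t).1 ht g hg
    obtain ⟨g', h1, h2⟩ := hs g Y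
    exact ⟨g', hY g' h2, h1⟩
  have r1 : ∀ Y : Finset M, {g : BP M | ∃ D, Y ⊆ D ∧ IsAmalgBase (BP M) Set.univ D g} ∈
      residual (BP M) := by
    intro Y
    refine residual_of_dense_open ((hopen _).2 ?_) (hdense _ ?_)
    · rintro g ⟨D, h1, h2⟩
      exact ⟨D, fun g' hg' => ⟨D, h1, h2.congr hg'⟩⟩
    · intro g Y'
      obtain ⟨k, hk, D, -, h1, h2⟩ := hr g g.2 (Y ∪ Y')
      exact ⟨⟨k, hk.1⟩, ⟨D, fun y hy => (h1 y (by simp [hy]) (Set.mem_univ _)).1, h2⟩,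
        fun y hy => (h1 y (by simp [hy]) (Set.mem_univ _)).2⟩
  have r2 : ∀ p : Finset M × Finset (M × M), {g : BP M | (IsAmalgBase (BP M) Set.univ p.1 g ∧
      ∃ k ∈ BP M, (∀ x ∈ p.1, k x = (g : Equiv.Perm M) x) ∧ ∀ q ∈ p.2, k q.1 = q.2) →
      ∃ h ∈ BP M, (∀ x ∈ p.1, h x = x ∧ h ((g : Equiv.Perm M) x) = (g : Equiv.Perm M) x) ∧
        ∀ q ∈ p.2, (g : Equiv.Perm M) (h q.1) = h q.2} ∈ residual (BP M) := by
    rintro ⟨D, τ⟩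
    refine residual_of_dense_open ((hopen _).2 ?_) (hdense _ ?_)
    · intro g hg
      by_cases hc : ∃ h ∈ BP M, (∀ x ∈ D, h x = x ∧ h ((g : Equiv.Perm M) x) = (g : Equiv.Perm M) x) ∧
        ∀ q ∈ τ, (g : Equiv.Perm M) (h q.1) = h q.2
      · obtain ⟨h, hh, h1, h2⟩ := hc
        refine ⟨D ∪ τ.image fun q => h q.1, fun g' hg' _ => ⟨h, hh, fun x hx => ?_, fun q hq => ?_⟩⟩
        · rw [hg' x (by simp [hx])]; exact h1 x hx
        · rw [hg' _ (Finset.mem_union_right _ (Finset.mem_image_of_mem _ hq)), h2 q hq]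
      -- If the conclusion fails for `g`, so does the premise, and the premise depends only on the
      -- values of `g` on `D`.
      · have hn := fun h => hc (hg h)
        refine ⟨D, fun g' hg' hp => absurd ?_ hn⟩
        obtain ⟨hb, k, hk, h1, h2⟩ := hp
        exact ⟨hb.congr fun x hx => (hg' x hx).symm, k, hk, fun x hx => (h1 x hx).trans (hg' x hx), h2⟩
    · intro g Y
      by_cases hp : IsAmalgBase (BP M) Set.univ D g ∧
        ∃ k ∈ BP M, (∀ x ∈ D, k x = (g : Equiv.Perm M) x) ∧ ∀ q ∈ τ, k q.1 = q.2
      · obtain ⟨hb, k, hk, h1, h2⟩ := hp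
        obtain ⟨g', hg', h, hh, h3, h4, h5⟩ := hb g (mem_suppIn_univ.2 g.2) k (mem_suppIn_univ.2 hk)
          (fun _ _ => rfl) h1 (D ∪ Y) (τ.image Prod.fst)
        refine ⟨⟨g', hg'.1⟩, fun _ => ⟨h, hh.1, fun x hx => ?_, fun q hq => ?_⟩,
          fun y hy => h4 y (by simp [hy])⟩
        · change h x = x ∧ h (g' x) = g' x
          rw [h4 x (by simp [hx])]; exact h3 x hx
        · have := h5 _ (Finset.mem_image_of_mem Prod.fst hq)
          rw [h2 q hq] at this
          exact this
      · exact ⟨g, fun h => absurd h hp, fun _ _ => rfl⟩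
  refine Filter.mem_of_superset (Filter.inter_mem (countable_iInter_mem.2 r1)
    (countable_iInter_mem.2 r2)) ?_
  rintro g ⟨h1, h2⟩
  rw [Set.mem_iInter] at h1 h2
  refine ⟨g.2, h1, fun D hD k hk hkg Y => ?_⟩
  obtain ⟨h, hh, h3, h4⟩ := h2 (D, Y.image fun y => (y, k y)) ⟨hD, k, hk, hkg, by
    intro q hq
    obtain ⟨y, -, rfl⟩ := Finset.mem_image.1 hq
    rfl⟩
  exact ⟨h, hh, h3, fun y hy => h4 _ (Finset.mem_image_of_mem _ hy)⟩

theorem BP.exists_conjugatesOf_mem_residual [Countable M]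
    (closed : ∀ e : Equiv.Perm M, (∀ Y : Finset M, ∃ h ∈ BP M, ∀ y ∈ Y, e y = h y) → e ∈ BP M)
    (free : ∀ g, IsAmalgBase (BP M) Set.univ ∅ g)
    (hr : ∀ g ∈ BP M, ∀ Y : Finset M, Resolvable (BP M) Set.univ g Y) :
    ∃ g : BP M, conjugatesOf g ∈ @residual (BP M) (BP.pointwiseTopology M) := by
  have h := BP.isGeneric_mem_residual hr
  by_cases hne : ∃ g : BP M, IsGeneric (BP M) g
  · obtain ⟨g, hg⟩ := hne
    refine ⟨g, Filter.mem_of_superset h fun g' hg' => ?_⟩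
    obtain ⟨e, he, hc⟩ := hg.exists_conj closed free hg'
    exact isConj_iff.2 ⟨⟨e, he⟩, Subtype.ext hc⟩
  -- Without generic elements the empty set would be residual and any class would do; so no appeal
  -- to the Baire category theorem is needed.
  · exact ⟨1, Filter.mem_of_superset h fun g hg => absurd ⟨g, hg⟩ hne⟩

end BPComeager

/-! ### The main theorem -/

theorem resolvable_of_subsingleton {M : Type u} [Subsingleton M] {G : Subgroup (Equiv.Perm M)}
    (g : Equiv.Perm M) (hg : g ∈ G) (Y : Finset M) : Resolvable G Set.univ g Y :=
  ⟨g, mem_suppIn_univ.2 hg, Y, fun _ _ => Set.mem_univ _, fun _ h _ => ⟨h, rfl⟩,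
    fun _ _ _ _ _ _ _ _ => ⟨1, one_mem _, 1, one_mem _, fun _ _ =>
      ⟨Subsingleton.elim _ _, Subsingleton.elim _ _⟩, fun _ _ => Subsingleton.elim _ _,
      fun _ _ => Subsingleton.elim _ _⟩⟩

/-- With only two labels the order of two points determines both, so for `N = 2` preserving labels
is automatic. -/
theorem IsLabelling.eq_of_eq_two {X : Type u} [MetricSpace X] [LinearOrder X] {rk : X → ℝ → ℕ}
    (h : IsLabelling 2 rk) {x y : X} (hxy : x < y) :
    rk x (dist x y) = 0 ∧ rk y (dist x y) = 1 := by
  have hN : (2 : ℕ∞) ≠ ⊤ := by decide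
  have h1 := h.lt hN x y hxy
  have h2 : rk y (dist x y) < 2 := by exact_mod_cast h.lt_bound hN y (dist x y)
  omega

namespace IsRich

variable {N : ℕ∞} {M : Type u} [MetricSpace M] [LinearOrder M] {rk : M → ℝ → ℕ}

theorem mem_BP_of_forall_finset (h : IsRich N rk) {e : Equiv.Perm M}
    (he : ∀ Y : Finset M, ∃ g ∈ BP M, ∀ y ∈ Y, e y = g y) : e ∈ BP M := by
  classical
  refine h.mem_BP.2 ⟨fun x y hxy => ?_, fun x y z => ?_⟩
  · obtain ⟨g, hg, hge⟩ := he {x, y}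
    rw [hge x (by simp), hge y (by simp)]
    exact (h.mem_BP.1 hg).1 x y hxy
  · obtain ⟨g, hg, hge⟩ := he {x, y, z}
    rw [hge x (by simp), hge y (by simp), hge z (by simp)]
    exact (h.mem_BP.1 hg).2 x y z

theorem extendable (h : IsRich N rk) (hN : N = 2 ∨ N = ⊤) (S : PartialBP M) : S.Extendable := by
  classical
  let f : M → M := fun x => if hx : x ∈ S.dom then S.toEquiv ⟨x, hx⟩ else x
  have hf : ∀ x (hx : x ∈ S.dom), f x = S.toEquiv ⟨x, hx⟩ := fun x hx => dif_pos hx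
  have lt : ∀ x ∈ S.dom, ∀ y ∈ S.dom, x < y → f x < f y := fun x hx y hy hxy => by
    rw [hf x hx, hf y hy]; exact S.strictMono (a := ⟨x, hx⟩) (b := ⟨y, hy⟩) hxy
  obtain ⟨e, he, hef⟩ := h.exists_extension S.dom (f := f) ⟨lt, fun x hx y hy z hz => by
      rw [hf x hx, hf y hy, hf z hz]
      exact dist_le_iff_of_isBPEquiv (h.ou.finset S.dom).ultrametric (h.ou.finset S.rng).ultrametric
        S.isBPEquiv ⟨x, hx⟩ ⟨y, hy⟩ ⟨z, hz⟩, fun x hx y hy hxy => by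
    rcases hN with rfl | hN
    · rcases lt_or_gt_of_ne hxy with h1 | h1
      · rw [(h.lab.eq_of_eq_two h1).1, (h.lab.eq_of_eq_two (lt x hx y hy h1)).1]
      · rw [dist_comm, (h.lab.eq_of_eq_two h1).2, dist_comm,
          (h.lab.eq_of_eq_two (lt y hy x hx h1)).2]
    · rw [h.lab.top hN, h.lab.top hN]⟩
  exact ⟨e, he, fun x => (hef x x.2).trans (hf x x.2)⟩

end IsRich


theorem mainTheorem4 (N : ℕ∞) :
    (∃ (M : Type) (_ : MetricSpace M) (_ : LinearOrder M), IsOrderedUrysohn N M) ∧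
    ∀ (M : Type u) [MetricSpace M] [LinearOrder M], IsOrderedUrysohn N M →
      HasCAP {S : PartialBP M | S.Extendable} ∧
      (N ≤ 2 ∨ N = ⊤ → ∀ S : PartialBP M, S.Extendable) ∧
      ∃ g : BP M, conjugatesOf g ∈ @residual (BP M) (BP.pointwiseTopology M) := by
  refine ⟨exists_isOrderedUrysohn N, fun M _ _ hM => ?_⟩
  have hu := hM.isOrderedUltrametric.ultrametric
  have := hM.countable
  by_cases hN : 2 ≤ N
  · have h := hM.isRich hN
    have hr : ∀ g ∈ BP M, ∀ Y : Finset M, Resolvable (BP M) Set.univ g Y := fun g hg Y =>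
      h.resolvable_cell h.isCell_univ (mem_suppIn_univ.2 hg) Y
    exact ⟨PartialBP.hasCAP hu hr, fun hN' => h.extendable (hN'.imp_left fun h2 => le_antisymm h2 hN),
      BP.exists_conjugatesOf_mem_residual (fun _ => h.mem_BP_of_forall_finset)
        (h.isAmalgBase_cell h.isCell_univ) hr⟩
  · have := hM.isOrderedUltrametric.subsingleton hN
    have hr : ∀ g ∈ BP M, ∀ Y : Finset M, Resolvable (BP M) Set.univ g Y :=
      resolvable_of_subsingleton
    refine ⟨PartialBP.hasCAP hu hr, fun _ S => ⟨1, one_mem _, fun _ => Subsingleton.elim _ _⟩,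
      BP.exists_conjugatesOf_mem_residual (fun e _ => ?_) (fun _ _ _ _ _ _ _ _ _ => ?_) hr⟩
    · rw [Subsingleton.elim e 1]; exact one_mem _
    · exact ⟨1, one_mem _, 1, one_mem _, fun _ _ => ⟨Subsingleton.elim _ _, Subsingleton.elim _ _⟩,
        fun _ _ => Subsingleton.elim _ _, fun _ _ => Subsingleton.elim _ _⟩
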